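/- **Setting.** Let $\omega\subset\mathbb{R}^2$ be a bounded open set with Lipschitz boundary, $Y=[0,1]^2$, $\Omega=\omega\times(-\tfrac12,\tfrac12)$, and let $\theta:\mathbb{R}^2\to\mathbb{R}$ be $Y$-periodic of class $C^2$, $\theta_0=\theta-\int_Y\theta$. For $h>0$ let $\Omega^h=\omega\times(-\tfrac{h^2}{2},\tfrac{h^2}{2})$, $P^h(x',x_3)=(x',h^2x_3)$, and $$\Theta^h(x',x_3)=\bigl(x',h^2\theta(\tfrac{x'}{h})\bigr)+x_3\,\mathbf n^h(x'),\qquad \mathbf n^h=\frac{\bigl(-h\,\partial_1\theta(\tfrac{x'}{h}),-h\,\partial_2\theta(\tfrac{x'}{h}),1\bigr)}{\sqrt{1+h^2|\nabla\theta(\tfrac{x'}{h})|^2}},\qquad \hat\Omega^h=\Theta^h(\Omega^h).$$ Let $h$ run through a sequence of positive numbers tending to $0$. Functions $f^h\in L^2(\omega)$ two-scale converge to $f\in L^2(\omega\times Y)$ if $\int_\omega f^h(x)\psi(x,\tfrac{x}{h})\,dx\to\int_\omega\int_Y f\psi\,dy\,dx$ for all $\psi\in L^2(\omega;C_\#(Y))$,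 where $C_\#(Y)$ is the space of continuous $Y$-periodic functions; for functions on $\Omega$ the test functions are $\psi\in L^2(\Omega;C_\#(Y))$ and one evaluates $\psi(x,\tfrac{x'}{h})$ with $x=(x',x_3)$. By $\dot H^m_\#(Y)$ we denote the $Y$-periodic functions in $H^m$ with mean zero; $\operatorname{sym}M=\frac12(M+M^T)$. **Hypotheses.** Let $\mathbf y^h\in W^{1,2}(\hat\Omega^h;\mathbb{R}^3)$ and $\mathbf R^h\in W^{1,2}(\omega;SO(3))$, write $F^h=(\nabla\mathbf y^h)\circ\Theta^h\circ P^h$, and define for $\alpha=1,2$ $$u^h_\alpha(x')=\frac1{h^4}\Bigl(\int_{-1/2}^{1/2}\mathbf y^h_\alpha\circ\Theta^h\circ P^h\,dx_3-x_\alpha-h^2\mathbf R^h_{\alpha3}(x')\theta_0(\tfrac{x'}{h})\Bigr),\qquad v^h(x')=\frac1{h^2}\int_{-1/2}^{1/2}\mathbf y^h_3\circ\Theta^h\circ P^h\,dx_3-\theta(\tfrac{x'}{h}).$$ Suppose that there are constants $C$, and $C_p$ for $1\le p<\infty$, independent of $h$, with $$\|F^h-\mathbf R^h\|_{L^2(\Omega)}\le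 Ch^4,\qquad \|\mathbf R^h-\mathbf I\|_{L^p(\omega)}\le C_ph^2,\qquad \|\nabla\mathbf R^h\|_{L^2(\omega)}\le Ch^2,$$ and that there are $u\in W^{1,2}(\omega;\mathbb{R}^2)$, $v\in W^{2,2}(\omega)$, $\mathbf A\in W^{1,2}(\omega;\mathbb{R}^{3\times3})$ with $\mathbf A=\mathbf e_3\otimes\nabla v-\nabla v\otimes\mathbf e_3$ such that $$v^h\to v\text{ in }W^{1,2}(\omega),\quad u^h\rightharpoonup u\text{ in }W^{1,2}(\omega;\mathbb{R}^2),\quad \tfrac{\mathbf R^h-\mathbf I}{h^2}\rightharpoonup\mathbf A\text{ in }W^{1,2}(\omega;\mathbb{R}^{3\times 3}),$$ $$\tfrac{F^h-\mathbf I}{h^2}\rightharpoonup\mathbf A\text{ in }L^2(\Omega;\mathbb{R}^{3\times 3}),\quad \tfrac{\operatorname{sym}(\mathbf R^h-\mathbf I)}{h^4}\to\tfrac{\mathbf A^2}{2}\text{ in }L^2(\Omega;\mathbb{R}^{3\times 3}).$$ Suppose finally that, for some $u_1\in L^2(\omega;\dot H^1_\#(Y))^2$ and $v_1\in L^2(\omega;\dot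 H^2_\#(Y))$, the gradients $\nabla u^h$ two-scale converge to $\nabla u(x')+\nabla_yu_1(x',y)$ and the gradients $\nabla\frac1{h^2}(\mathbf R^h_{13},\mathbf R^h_{23})$ two-scale converge to $-\nabla^2v(x')-\nabla_y^2v_1(x',y)$ (both on $\omega$). **Conclusion.** Put $\mathbf G^h=\dfrac{(\mathbf R^h)^TF^h-\mathbf I}{h^4}$. Every subsequence of $(\mathbf G^h)$ has a further subsequence that two-scale converges to some $\mathbf G\in L^2(\Omega\times Y;\mathbb{R}^{3\times3})$. Whenever a subsequence of $(\mathbf G^h)$ two-scale converges to some $\mathbf G$, there are $\mathbf G_0,\mathbf G_1\in L^2(\omega\times Y;\mathbb{R}^{2\times2})$ such that the block $\mathbf G''=(\mathbf G_{\alpha\beta})_{\alpha,\beta=1,2}$ satisfies, almost everywhere, $$\mathbf G''(x',x_3,y)=\mathbf G_0(x',y)+x_3\,\mathbf G_1(x',y),\qquad \mathbf G_1=-\nabla^2v-\nabla_y^2v_1,$$ $$\operatorname{sym}\mathbf G_0=\operatorname{sym}\nabla u+\operatorname{sym}\nabla_yu_1-\bigl(\nabla^2v+\nabla_y^2v_1\bigr)\theta_0(y)+\tfrac12\nabla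 v\otimes\nabla v .$$ -/

import Mathlib

open MeasureTheory Filter Topology

noncomputable section

namespace WrinkledPlate

/-- The plane, with generic point `x' = (x₁, x₂)` (components indexed by `0, 1`). -/
abbrev R2 : Type := Fin 2 → ℝ

/-- Three-dimensional space, written as plane times line: `x = (x', x₃)`. -/
abbrev R3 : Type := R2 × ℝ

/-- Canonical basis of the plane. -/
def e2 (i : Fin 2) : R2 := Pi.single i 1

/-- Canonical basis of `R3`. -/
def e3 : Fin 3 → R3 := ![(e2 0, 0), (e2 1, 0), (0, 1)]

/-- The canonical cell `Y = [0,1]²`. -/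
def Y : Set R2 := Set.Icc 0 1

/-- A bounded open subset of the plane with Lipschitz boundary: near each boundary point, in
suitably rotated Cartesian coordinates, the set is the region above a Lipschitz graph. -/
structure IsLipschitzDomain (ω : Set R2) : Prop where
  isOpen : IsOpen ω
  isBounded : Bornology.IsBounded ω
  lipschitz_boundary : ∀ x₀ ∈ frontier ω, ∃ Q ∈ Matrix.orthogonalGroup (Fin 2) ℝ,
    ∃ γ : ℝ → ℝ, ∃ K : NNReal, LipschitzWith K γ ∧
      ∀ᶠ x in 𝓝 x₀, x ∈ ω ↔ γ ((Q.mulVec x) 0) < (Q.mulVec x) 1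

/-- `Y`-periodic functions on the plane. -/
def IsYPeriodic (f : R2 → ℝ) : Prop := ∀ (i : Fin 2) (x : R2), f (x + e2 i) = f x

/-! ### Sobolev spaces -/

/-- `g` is the weak derivative of `u` in direction `e` on the open set `U`. -/
def IsWeakDeriv {E : Type*} [NormedAddCommGroup E] [NormedSpace ℝ E] [MeasureSpace E]
    (U : Set E) (e : E) (u g : E → ℝ) : Prop :=
  ∀ φ : E → ℝ, ContDiff ℝ (⊤ : ℕ∞) φ → HasCompactSupport φ → tsupport φ ⊆ U →
    ∫ x in U, u x * fderiv ℝ φ x e = - ∫ x in U, g x * φ x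

/-- `u ∈ W^{1,2}(U)`, and `Du x i` is (a representative of) its weak derivative in the
direction `b i`. -/
structure HasW12Grad {E : Type*} [NormedAddCommGroup E] [NormedSpace ℝ E] [MeasureSpace E]
    {d : ℕ} (b : Fin d → E) (U : Set E) (u : E → ℝ) (Du : E → Fin d → ℝ) : Prop where
  memLp : MemLp u 2 (volume.restrict U)
  grad_memLp : ∀ i, MemLp (fun x => Du x i) 2 (volume.restrict U)
  weakDeriv : ∀ i, IsWeakDeriv U (b i) u (fun x => Du x i)

/-- Strong convergence in `L²(μ)`. -/
structure L2Tendsto {X : Type*} [MeasurableSpace X] (μ : Measure X)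
    (f : ℕ → X → ℝ) (f₀ : X → ℝ) : Prop where
  memLp : ∀ n, MemLp (f n) 2 μ
  memLp_lim : MemLp f₀ 2 μ
  tendsto : Tendsto (fun n => eLpNorm (fun x => f n x - f₀ x) 2 μ) atTop (𝓝 0)

/-- Weak convergence in `L²(μ)`. -/
structure L2WeakTendsto {X : Type*} [MeasurableSpace X] (μ : Measure X)
    (f : ℕ → X → ℝ) (f₀ : X → ℝ) : Prop where
  memLp : ∀ n, MemLp (f n) 2 μ
  memLp_lim : MemLp f₀ 2 μ
  tendsto : ∀ g : X → ℝ, MemLp g 2 μ →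
    Tendsto (fun n => ∫ x, f n x * g x ∂μ) atTop (𝓝 (∫ x, f₀ x * g x ∂μ))

/-- Strong convergence `u n → u₀` in `W^{1,2}(ω)`; the gradients are `Du n` and `Du₀`. -/
structure W12Tendsto (ω : Set R2) (u : ℕ → R2 → ℝ) (Du : ℕ → R2 → Fin 2 → ℝ)
    (u₀ : R2 → ℝ) (Du₀ : R2 → Fin 2 → ℝ) : Prop where
  grad : ∀ n, HasW12Grad e2 ω (u n) (Du n)
  grad_lim : HasW12Grad e2 ω u₀ Du₀
  tendsto : L2Tendsto (volume.restrict ω) u u₀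
  grad_tendsto : ∀ i,
    L2Tendsto (volume.restrict ω) (fun n x => Du n x i) (fun x => Du₀ x i)

/-- Weak convergence `u n ⇀ u₀` in `W^{1,2}(ω)`; the gradients are `Du n` and `Du₀`. -/
structure W12WeakTendsto (ω : Set R2) (u : ℕ → R2 → ℝ) (Du : ℕ → R2 → Fin 2 → ℝ)
    (u₀ : R2 → ℝ) (Du₀ : R2 → Fin 2 → ℝ) : Prop where
  grad : ∀ n, HasW12Grad e2 ω (u n) (Du n)
  grad_lim : HasW12Grad e2 ω u₀ Du₀
  tendsto : L2WeakTendsto (volume.restrict ω) u u₀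
  grad_tendsto : ∀ i,
    L2WeakTendsto (volume.restrict ω) (fun n x => Du n x i) (fun x => Du₀ x i)

/-! ### Periodic Sobolev spaces on the cell -/

/-- `g` is the weak derivative of `u` in direction `i` in the sense of `Y`-periodic functions:
the test functions are smooth and `Y`-periodic, so this includes the periodicity of the traces
of `u` on the boundary of the cell. -/
def IsPerWeakDeriv (i : Fin 2) (u g : R2 → ℝ) : Prop :=
  ∀ φ : R2 → ℝ, ContDiff ℝ (⊤ : ℕ∞) φ → IsYPeriodic φ →
    ∫ y in Y, u y * fderiv ℝ φ y (e2 i) = - ∫ y in Y, g y * φ y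

/-- A function of `(x, y)` in `L²(ω × Y)`. -/
def MemL2Cell (ω : Set R2) (w : R2 → R2 → ℝ) : Prop :=
  MemLp (fun z : R2 × R2 => w z.1 z.2) 2
    ((volume.restrict ω).prod (volume.restrict Y))

/-- `w ∈ L²(ω; Ḣ¹_#(Y))` (zero mean over `Y`), with `y`-gradient `Dw`. -/
structure HasL2DotH1Grad (ω : Set R2) (w : R2 → R2 → ℝ) (Dw : R2 → R2 → Fin 2 → ℝ) :
    Prop where
  memLp : MemL2Cell ω w
  grad_memLp : ∀ i, MemL2Cell ω (fun x y => Dw x y i)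
  mean_zero : ∀ᵐ x ∂(volume.restrict ω), ∫ y in Y, w x y = 0
  weakDeriv : ∀ᵐ x ∂(volume.restrict ω), ∀ i, IsPerWeakDeriv i (w x) (fun y => Dw x y i)

/-- `w ∈ L²(ω; Ḣ²_#(Y))` (zero mean over `Y`), with `y`-gradient `Dw` and
`y`-Hessian `D2w`. -/
structure HasL2DotH2Hess (ω : Set R2) (w : R2 → R2 → ℝ) (Dw : R2 → R2 → Fin 2 → ℝ)
    (D2w : R2 → R2 → Matrix (Fin 2) (Fin 2) ℝ) : Prop where
  grad : HasL2DotH1Grad ω w Dw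
  hess_memLp : ∀ i j, MemL2Cell ω (fun x y => D2w x y i j)
  hess_weakDeriv : ∀ᵐ x ∂(volume.restrict ω), ∀ i j,
    IsPerWeakDeriv j (fun y => Dw x y i) (fun y => D2w x y i j)

/-! ### Two-scale convergence -/

/-- The class of a point of the plane modulo `ℤ²`. -/
def toTorus (y : R2) : UnitAddTorus (Fin 2) := fun i => (y i : UnitAddCircle)

/-- Two-scale convergence of `u n` (oscillating at the scale `h n` in the plane variables) to
`u₀ ∈ L²(μ × Y)`. Here `p` extracts the plane variables: for functions on `ω` it is the
identity, for functions on `ω × (-1/2, 1/2)` it is `(x', x₃) ↦ x'`.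
The space of continuous `Y`-periodic functions is the Banach space of continuous functions on
the torus, so that the test functions `Ψ` are the elements of `L²(μ; C_#(Y))`. -/
structure TwoScaleTendsto {X : Type*} [MeasurableSpace X] (μ : Measure X) (p : X → R2)
    (h : ℕ → ℝ) (u : ℕ → X → ℝ) (u₀ : X → R2 → ℝ) : Prop where
  memLp : ∀ n, MemLp (u n) 2 μ
  memLp_lim : MemLp (fun z : X × R2 => u₀ z.1 z.2) 2 (μ.prod (volume.restrict Y))
  tendsto : ∀ Ψ : X → C(UnitAddTorus (Fin 2), ℝ), MemLp Ψ 2 μ →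
    Tendsto (fun n => ∫ x, u n x * Ψ x (toTorus ((h n)⁻¹ • p x)) ∂μ) atTop
      (𝓝 (∫ x, (∫ y in Y, u₀ x y * Ψ x (toTorus y)) ∂μ))

/-! ### The wrinkled plate -/

/-- `∂_α θ (x'/h)`. -/
def dθ (θ : R2 → ℝ) (h : ℝ) (α : Fin 2) (x : R2) : ℝ := fderiv ℝ θ (h⁻¹ • x) (e2 α)

/-- The unit normal of the wrinkled mid-surface `x' ↦ (x', h² θ(x'/h))`. -/
def normal (θ : R2 → ℝ) (h : ℝ) (x : R2) : R3 :=
  (Real.sqrt (h ^ 2 * dθ θ h 0 x ^ 2 + h ^ 2 * dθ θ h 1 x ^ 2 + 1))⁻¹ •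
    ((fun α => -h * dθ θ h α x, 1) : R3)

/-- The parametrization `Θ^h` of the wrinkled plate. -/
def Θ (θ : R2 → ℝ) (h : ℝ) (x : R3) : R3 :=
  ((x.1, h ^ 2 * θ (h⁻¹ • x.1)) : R3) + x.2 • normal θ h x.1

/-- The flat plate `Ω^h = ω × (-h²/2, h²/2)` of thickness `h²`. -/
def plate (ω : Set R2) (h : ℝ) : Set R3 := ω ×ˢ Set.Ioo (-(h ^ 2 / 2)) (h ^ 2 / 2)

/-- The rescaled plate `Ω = Ω¹ = ω × (-1/2, 1/2)`. -/
def plate₁ (ω : Set R2) : Set R3 := plate ω 1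

/-- The wrinkled plate `Θ^h(Ω^h)`. -/
def wrinkledPlate (ω : Set R2) (θ : R2 → ℝ) (h : ℝ) : Set R3 := Θ θ h '' plate ω h

/-- The rescaling `P^h(x', x₃) = (x', h² x₃)`. -/
def P (h : ℝ) (x : R3) : R3 := (x.1, h ^ 2 * x.2)

/-- `θ₀ = θ - ⟨θ⟩`. -/
def θ₀ (θ : R2 → ℝ) (y : R2) : ℝ := θ y - ∫ z in Y, θ z

/-- The corrected in-plane displacement `u^h`. -/
def inPlaneDisp (θ : R2 → ℝ) (h : ℝ) (y : R3 → Fin 3 → ℝ)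
    (R : R2 → Matrix (Fin 3) (Fin 3) ℝ) (x : R2) (α : Fin 2) : ℝ :=
  1 / h ^ 4 * ((∫ t in (-1 / 2 : ℝ)..(1 / 2), y (Θ θ h (P h (x, t))) α.castSucc)
    - x α - h ^ 2 * (R x α.castSucc 2 * θ₀ θ (h⁻¹ • x)))

/-- The corrected out-of-plane displacement `v^h`. -/
def outOfPlaneDisp (θ : R2 → ℝ) (h : ℝ) (y : R3 → Fin 3 → ℝ) (x : R2) : ℝ :=
  1 / h ^ 2 * (∫ t in (-1 / 2 : ℝ)..(1 / 2), y (Θ θ h (P h (x, t))) 2) - θ (h⁻¹ • x)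

/-- The scaled deformation gradient `(∇y) ∘ Θ^h ∘ P^h`, for a given weak gradient `Dy`. -/
def pulledGrad (θ : R2 → ℝ) (h : ℝ) (Dy : R3 → Matrix (Fin 3) (Fin 3) ℝ) (x : R3) :
    Matrix (Fin 3) (Fin 3) ℝ := Dy (Θ θ h (P h x))

/-- The scaled strain `G^h = ((R^h)ᵀ (∇y^h) ∘ Θ^h ∘ P^h - I) / h⁴`. -/
def strain (θ : R2 → ℝ) (h : ℝ) (Dy : R3 → Matrix (Fin 3) (Fin 3) ℝ)
    (R : R2 → Matrix (Fin 3) (Fin 3) ℝ) (x : R3) : Matrix (Fin 3) (Fin 3) ℝ :=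
  (1 / h ^ 4) • ((R x.1).transpose * pulledGrad θ h Dy x - 1)

/-- Symmetric part of a square matrix. -/
def sym {m : ℕ} (M : Matrix (Fin m) (Fin m) ℝ) : Matrix (Fin m) (Fin m) ℝ :=
  (1 / 2 : ℝ) • (M + M.transpose)

/-- The matrix `e₃ ⊗ w - w ⊗ e₃` for a plane vector `w`, viewed in space as `(w₁, w₂, 0)`. -/
def skewOf (w : Fin 2 → ℝ) : Matrix (Fin 3) (Fin 3) ℝ :=
  Matrix.vecMulVec (Pi.single 2 1) ![w 0, w 1, 0]
    - Matrix.vecMulVec ![w 0, w 1, 0] (Pi.single 2 1)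

end WrinkledPlate

end

/-! Write F and R for the scaled gradient and the rotation, H = (F - R)/h⁴ for their scaled
difference, and let t_β and n be the vectors with ∂_β(Θ∘P) = t_β and ∂₃(Θ∘P) = h² n. Everything is
read off from two integral identities for H, tested with oscillating products φ(x') g(x'/h) η(x₃).
Since RᵀF - I = Rᵀ(F - R) and R - I is O(h²) in L², the strain differs from H by an error that tends
to zero in L¹. Against bounded oscillating test functions both have the same limit
(`tendsto_scaledDiff`). Moreover t_β → e_β and n → e₃ uniformly (`exists_frame_bound`), so the
tested expressions select single entries of the limit.

Transverse identity. The chain rule for y∘Θ∘P and the commutation of weak mixed derivatives give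
∂₃(F t_β) = h² ∂_β(F n). The rotation depends on x' only and ∂₃t_β = h² ∂_βn, so ∂₃(R t_β) = h²
∂_β(R n) - h² (∂_βR) n. Subtracting and dividing by h⁴ gives ∂₃(H t_β) = h² ∂_β(H n) + h⁻² (∂_βR) n
(`transverse_identity`). Differentiating an oscillating test function costs only h⁻¹, so the first
term on the right disappears, and ∂₃G_{αβ} is the two-scale limit of h⁻² ∂_βR_{α3}, that is -∇²v -
∇_y²v₁. This does not depend on x₃, and a du Bois-Reymond argument with parameters
(`ae_eq_integral_thick`, `affine_of_transverse`) shows that G'' is affine in x₃, with its thickness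
average as constant part.

In-plane identity. Averaging the chain rule over the thickness, the part of t_β linear in x₃ drops
out, and the average of y_α has derivative h⁴ times the average of (H t_β)_α, plus R_{αβ} + h
∂_βθ(x'/h) R_{α3}. The corrector h² R_{α3} θ₀(x'/h) in the definition of u^h has exactly the
oscillating term h ∂_βθ R_{α3} in its derivative, so it cancels, and ∂_βu_α is the average of (H
t_β)_α plus (R_{αβ} - δ_{αβ})/h⁴ minus h⁻² ∂_βR_{α3} θ₀(x'/h) (`in_plane_identity`). The middle term
has no known limit by itself, but its symmetric part tends to A²/2, whose in-plane block is -½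
∇v⊗∇v. Symmetrising the identity and comparing limits yields the formula for sym G₀
(`IsPlateSequence.sym_average`). The Hessians in it are symmetric, which removes the symmetrisation
from the term with θ₀.

Compactness comes from periodic unfolding: a measure preserving map of space times cell turns
two-scale convergence into weak L² convergence (`measurePreserving_unfold`,
`twoScaleTendsto_of_unfold`). The chain rule is proved by mollification
(`integral_comp_mul_fderiv_eq`). It applies for small h because the derivative of Θ is within O(h)
of the identity on the thin slab. -/

namespace WrinkledPlate

/-! ### Separating families of test functions -/

/-- A family of functions separates the integrable functions. -/
def IsSeparating {α : Type*} [MeasurableSpace α] (μ : Measure α) (S : Set (α → ℝ)) : Prop :=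
  ∀ F : α → ℝ, Integrable F μ → (∀ s ∈ S, ∫ x, F x * s x ∂μ = 0) → F =ᵐ[μ] 0

/-- The tensor products of two separating families are a separating family. -/
theorem ae_eq_zero_of_integral_prod_mul_eq_zero {α β : Type*} [MeasurableSpace α]
    [MeasurableSpace β] {μ : Measure α} {ν : Measure β} [SFinite μ] [SFinite ν]
    {f : α × β → ℝ} (hf : Integrable f (μ.prod ν)) {S : Set (α → ℝ)} {T : Set (β → ℝ)}
    (hT : ∀ t ∈ T, AEStronglyMeasurable t ν ∧ ∃ C, ∀ y, |t y| ≤ C)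
    (sepS : IsSeparating μ S) (sepT : IsSeparating ν T)
    (h : ∀ s ∈ S, ∀ t ∈ T, ∫ x, (∫ y, f (x, y) * t y ∂ν) * s x ∂μ = 0) :
    f =ᵐ[μ.prod ν] 0 := by
  have hft : ∀ t ∈ T, Integrable (fun z : α × β => f z * t z.2) (μ.prod ν) := by
    intro t ht
    obtain ⟨hm, C, hC⟩ := hT t ht
    exact hf.mul_bdd (c := C) hm.comp_snd (ae_of_all _ fun z => hC z.2)
  have h1 : ∀ t ∈ T, (fun x => ∫ y, f (x, y) * t y ∂ν) =ᵐ[μ] 0 := fun t ht =>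
    sepS _ (hft t ht).integral_prod_left fun s hs => h s hs t ht
  -- The moment against t vanishes for almost every x, with an exceptional set depending on t.
  -- Integrating over A first and swapping the integrals lets the second family act on one fixed
  -- function, so these exceptional sets never have to be united.
  have h2 : ∀ A : Set α, MeasurableSet A → (fun y => ∫ x in A, f (x, y) ∂μ) =ᵐ[ν] 0 := by
    intro A hA
    have hfA : Integrable f ((μ.restrict A).prod ν) := by
      have : (μ.restrict A).prod ν = (μ.prod ν).restrict (A ×ˢ Set.univ) := by
        rw [← Measure.prod_restrict, Measure.restrict_univ]
      rw [this]; exact hf.restrict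
    refine sepT _ hfA.integral_prod_right fun t ht => ?_
    obtain ⟨hm, C, hC⟩ := hT t ht
    have h3 : Integrable (fun z : α × β => f z * t z.2) ((μ.restrict A).prod ν) :=
      hfA.mul_bdd (c := C) hm.comp_snd (ae_of_all _ fun z => hC z.2)
    calc ∫ y, (∫ x in A, f (x, y) ∂μ) * t y ∂ν
        = ∫ y, (∫ x in A, f (x, y) * t y ∂μ) ∂ν := by simp_rw [integral_mul_const]
      _ = ∫ x in A, (∫ y, f (x, y) * t y ∂ν) ∂μ :=
          (integral_integral_swap (f := fun x y => f (x, y) * t y) h3).symm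
      _ = 0 := by
          rw [integral_congr_ae (ae_restrict_of_ae (h1 t ht))]; simp
  have h4 : ∀ s, MeasurableSet s → ∫ z in s, f z ∂(μ.prod ν) = 0 := by
    have hrect : ∀ A B, MeasurableSet A → MeasurableSet B →
        ∫ z in A ×ˢ B, f z ∂(μ.prod ν) = 0 := by
      intro A B hA _
      have : Integrable f ((μ.restrict A).prod (ν.restrict B)) := by
        rw [Measure.prod_restrict]; exact hf.restrict
      rw [← Measure.prod_restrict, integral_prod_symm _ this,
        integral_congr_ae (ae_restrict_of_ae (h2 A hA))]
      simp
    intro s hs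
    refine MeasurableSpace.induction_on_inter (C := fun s _ => ∫ z in s, f z ∂(μ.prod ν) = 0)
      generateFrom_prod.symm isPiSystem_prod (by simp) ?_ ?_ ?_ s hs
    · rintro _ ⟨A, hA, B, hB, rfl⟩
      exact hrect A B hA hB
    · intro t ht h0
      have h5 := integral_add_compl ht hf
      have h6 := hrect Set.univ Set.univ .univ .univ
      rw [Set.univ_prod_univ, setIntegral_univ] at h6
      linarith
    · intro g hd hm h0
      rw [integral_iUnion hm hd hf.integrableOn]
      simp [h0]
  exact hf.ae_eq_zero_of_forall_setIntegral_eq_zero fun s hs _ => h4 s hs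

/-- Smooth functions with compact support in an open set. -/
def testFunctions {E : Type*} [NormedAddCommGroup E] [NormedSpace ℝ E] (U : Set E) :
    Set (E → ℝ) :=
  {φ | ContDiff ℝ (⊤ : ℕ∞) φ ∧ HasCompactSupport φ ∧ tsupport φ ⊆ U}

/-- Fundamental lemma of the calculus of variations, in the form needed for the domain, the open
cell and the thickness interval alike. -/
theorem isSeparating_testFunctions {E : Type*} [NormedAddCommGroup E] [NormedSpace ℝ E]
    [FiniteDimensional ℝ E] [MeasurableSpace E] [BorelSpace E] {μ : Measure E}
    {U : Set E} (hU : IsOpen U) :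
    IsSeparating (μ.restrict U) (testFunctions U) := by
  intro F hF h
  rw [EventuallyEq, ae_restrict_iff' hU.measurableSet]
  refine hU.ae_eq_zero_of_integral_contDiff_smul_eq_zero
    (IntegrableOn.locallyIntegrableOn hF) fun g hg hgc hgU => ?_
  rw [← h g ⟨hg, hgc, hgU⟩, setIntegral_eq_integral_of_forall_compl_eq_zero]
  · simp [mul_comm]
  · intro x hx
    rw [image_eq_zero_of_notMem_tsupport (fun hx' => hx (hgU hx')), mul_zero]

theorem testFunctions_bounded {E : Type*} [NormedAddCommGroup E] [NormedSpace ℝ E]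
    {U : Set E} {φ : E → ℝ} (hφ : φ ∈ testFunctions U) : ∃ C, ∀ x, |φ x| ≤ C :=
  hφ.2.1.exists_bound_of_continuous hφ.1.continuous

/-! ### Periodic functions -/

/-- The componentwise fractional part. -/
noncomputable def fr (y : R2) : R2 := fun i => Int.fract (y i)

theorem measurable_fr : Measurable fr :=
  measurable_pi_lambda _ fun i => (measurable_pi_apply i).fract

theorem norm_fr_le (y : R2) : ‖fr y‖ ≤ 1 := by
  refine (pi_norm_le_iff_of_nonneg zero_le_one).2 fun i => ?_
  rw [Real.norm_eq_abs, abs_of_nonneg (Int.fract_nonneg _)]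
  exact (Int.fract_lt_one _).le

theorem IsYPeriodic.add_int {f : R2 → ℝ} (hf : IsYPeriodic f) (y : R2) (m : Fin 2 → ℤ) :
    f (y + fun i => (m i : ℝ)) = f y := by
  have h1 : ∀ (i : Fin 2) (k : ℤ) (x : R2), f (x + (k : ℝ) • e2 i) = f x := by
    intro i k x
    have hp : Function.Periodic f (e2 i) := hf i
    have := hp.zsmul k x
    rwa [← Int.cast_smul_eq_zsmul ℝ] at this
  have : (y + fun i => (m i : ℝ)) = y + (m 0 : ℝ) • e2 0 + (m 1 : ℝ) • e2 1 := by
    ext i; fin_cases i <;> simp [e2]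
  rw [this, h1, h1]

theorem fr_add_e2 (y : R2) (i : Fin 2) : fr (y + e2 i) = fr y := by
  ext j
  by_cases hij : j = i
  · subst hij; simp [fr, e2]
  · simp [fr, e2, hij]

theorem toTorus_eq_of_fr_eq {y z : R2} (h : fr y = fr z) : toTorus y = toTorus z := by
  funext i
  have := congrFun h i
  simp only [fr] at this
  obtain ⟨k, hk⟩ := Int.fract_eq_fract.1 this
  change ((y i : ℝ) : UnitAddCircle) = (z i : ℝ)
  have h2 : y i = z i + k • (1:ℝ) := by simp; linarith
  rw [h2, AddCircle.coe_add]
  simp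

theorem continuous_toTorus : Continuous toTorus :=
  continuous_pi fun i => (AddCircle.continuous_mk' 1).comp (continuous_apply i)

theorem exists_int_of_toTorus_eq {a b : R2} (hab : toTorus a = toTorus b) (i : Fin 2) :
    ∃ k : ℤ, b i = a i + k := by
  have h1 : ((a i : ℝ) : UnitAddCircle) = (b i : ℝ) := congrFun hab i
  have h2 : ((b i - a i : ℝ) : UnitAddCircle) = 0 := by
    rw [AddCircle.coe_sub, h1, sub_self]
  obtain ⟨n, hn⟩ := AddCircle.coe_eq_zero_iff 1 |>.1 h2
  exact ⟨n, by simp at hn; linarith⟩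

/-- A continuous periodic function descends to the torus. -/
theorem IsYPeriodic.exists_lift {g : R2 → ℝ} (hg : IsYPeriodic g) (hc : Continuous g) :
    ∃ G : C(UnitAddTorus (Fin 2), ℝ), ∀ y, G (toTorus y) = g y := by
  have hq : IsOpenQuotientMap toTorus :=
    IsOpenQuotientMap.piMap fun _ : Fin 2 =>
      (QuotientAddGroup.isOpenQuotientMap_mk :
        IsOpenQuotientMap ((↑) : ℝ → UnitAddCircle))
  have hfac : ∀ a b, toTorus a = toTorus b → g a = g b := by
    intro a b hab
    choose k hk using exists_int_of_toTorus_eq hab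
    rw [← hg.add_int a k]
    congr 1; ext i; simp [hk]
  have hG : ∀ y, g (Function.surjInv hq.surjective (toTorus y)) = g y := fun y =>
    hfac _ _ (Function.surjInv_eq hq.surjective _)
  refine ⟨⟨fun p => g (Function.surjInv hq.surjective p), ?_⟩, hG⟩
  rw [hq.isQuotientMap.continuous_iff]
  convert hc using 1
  exact funext hG

/-- The open cell. -/
def openCell : Set R2 := Set.univ.pi fun _ : Fin 2 => Set.Ioo (0 : ℝ) 1

theorem isOpen_openCell : IsOpen openCell :=
  isOpen_set_pi Set.finite_univ fun _ _ => isOpen_Ioo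

theorem fr_eq_self {y : R2} (hy : y ∈ openCell) : fr y = y := by
  ext i
  exact Int.fract_eq_self.2 ⟨(hy i trivial).1.le, (hy i trivial).2⟩

theorem restrict_Y_eq : (volume : Measure R2).restrict Y = volume.restrict openCell := by
  have : Y = Set.univ.pi fun _ : Fin 2 => Set.Icc (0 : ℝ) 1 := (Set.pi_univ_Icc 0 1).symm
  rw [this, openCell]
  refine Measure.restrict_congr_set ?_
  exact Measure.pi_Ioo_ae_eq_pi_Icc.symm

/-- The periodic extension of a smooth function with compact support in the open cell is
smooth. -/
theorem contDiff_comp_fr {g : R2 → ℝ} (hg : g ∈ testFunctions openCell) :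
    ContDiff ℝ (⊤ : ℕ∞) (fun y => g (fr y)) := by
  rw [contDiff_iff_contDiffAt]
  intro y
  -- Off the lattice lines the fractional part is locally a translation. On them, the image of the
  -- support of `g` in the torus is compact and misses the class of `y`, so the extension vanishes
  -- near `y`.
  by_cases hy : fr y ∈ openCell
  · have h1 : ∀ᶠ z in 𝓝 y, fr z = z - fun i => (⌊y i⌋ : ℝ) := by
      have h2 : ∀ i, ∀ᶠ z : R2 in 𝓝 y, z i ∈ Set.Ioo (⌊y i⌋ : ℝ) (⌊y i⌋ + 1) := by
        intro i
        refine (continuous_apply i).continuousAt.eventually (isOpen_Ioo.mem_nhds ?_)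
        have h3 := hy i trivial
        simp only [fr, Int.fract] at h3
        exact ⟨by linarith [h3.1], by linarith [h3.2]⟩
      filter_upwards [eventually_all.2 h2] with z hz
      ext i
      have h4 : ⌊z i⌋ = ⌊y i⌋ := Int.floor_eq_iff.2 ⟨(hz i).1.le, (hz i).2⟩
      simp [fr, Int.fract, h4]
    have h5 : ContDiff ℝ (⊤ : ℕ∞) (fun z : R2 => g (z - fun i => (⌊y i⌋ : ℝ))) :=
      hg.1.comp (contDiff_id.sub contDiff_const)
    refine h5.contDiffAt.congr_of_eventuallyEq ?_
    filter_upwards [h1] with z hz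
    rw [hz]
  · have hK : IsClosed (toTorus '' tsupport g) :=
      (hg.2.1.isCompact.image continuous_toTorus).isClosed
    have hy' : y ∈ (toTorus ⁻¹' (toTorus '' tsupport g))ᶜ := by
      rintro ⟨k, hk, hky⟩
      apply hy
      have hk' := hg.2.2 hk
      have : fr y = fr k := by
        ext i
        obtain ⟨n, hn⟩ := exists_int_of_toTorus_eq hky i
        simp [fr, hn]
      rw [this, fr_eq_self hk']
      exact hk'
    have h1 : ∀ᶠ z in 𝓝 y, g (fr z) = 0 := by
      filter_upwards [(hK.preimage continuous_toTorus).isOpen_compl.mem_nhds hy'] with z hz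
      refine image_eq_zero_of_notMem_tsupport fun hz' => hz ⟨fr z, hz', ?_⟩
      refine toTorus_eq_of_fr_eq ?_
      ext i; simp [fr]
    exact (contDiffAt_const (c := (0:ℝ))).congr_of_eventuallyEq h1

/-- Smooth periodic functions. -/
def smoothPeriodic : Set (R2 → ℝ) := {g | ContDiff ℝ (⊤ : ℕ∞) g ∧ IsYPeriodic g}

/-- Test functions of the open cell extend smoothly and periodically, and the boundary of the cell
is a null set; so the periodic functions test at least as much as those of the open cell. -/
theorem isSeparating_smoothPeriodic :
    IsSeparating ((volume : Measure R2).restrict Y) smoothPeriodic := by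
  intro F hF h
  rw [restrict_Y_eq] at *
  refine isSeparating_testFunctions isOpen_openCell F hF fun g hg => ?_
  rw [← h (fun y => g (fr y)) ⟨contDiff_comp_fr hg, fun i y => by simp only [fr_add_e2]⟩]
  refine setIntegral_congr_fun isOpen_openCell.measurableSet fun y hy => ?_
  simp only [fr_eq_self hy]

theorem IsYPeriodic.bounded {g : R2 → ℝ} (hg : IsYPeriodic g) (hc : Continuous g) :
    ∃ C, ∀ y, |g y| ≤ C := by
  obtain ⟨G, hG⟩ := hg.exists_lift hc
  exact ⟨‖G‖, fun y => by rw [← hG y]; exact G.norm_coe_le_norm _⟩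

theorem smoothPeriodic_bounded {g : R2 → ℝ} (hg : g ∈ smoothPeriodic) : ∃ C, ∀ y, |g y| ≤ C :=
  hg.2.bounded hg.1.continuous

instance : IsProbabilityMeasure ((volume : Measure R2).restrict Y) := by
  constructor
  rw [Measure.restrict_apply_univ, Y, Real.volume_Icc_pi]
  simp

/-- A translate of the unit interval is another fundamental interval of the circle. Projection to
the circle preserves measure on it, and the fractional part reads the circle back on [0,1). -/
theorem measurePreserving_fract_sub (a : ℝ) :
    MeasurePreserving (fun t : ℝ => Int.fract (t - a)) (volume.restrict (Set.Icc (0:ℝ) 1))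
      (volume.restrict (Set.Icc (0:ℝ) 1)) := by
  have hIcc : (volume : Measure ℝ).restrict (Set.Icc 0 1) = volume.restrict (Set.Ioc 0 1) :=
    (Measure.restrict_congr_set Ioc_ae_eq_Icc).symm
  let q : UnitAddCircle → ℝ := fun c => (AddCircle.measurableEquivIco 1 0 c : ℝ)
  have hqm : Measurable q :=
    measurable_subtype_coe.comp (AddCircle.measurableEquivIco 1 0).measurable
  have hq : ∀ x : ℝ, q (x : UnitAddCircle) = Int.fract x := fun x =>
    (AddCircle.coe_equivIco_mk_apply (1:ℝ) x).trans (by rw [div_one, mul_one])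
  have hmk := fun t : ℝ => UnitAddCircle.measurePreserving_mk t
  have hqmp : MeasurePreserving q volume (volume.restrict (Set.Icc (0:ℝ) 1)) := by
    refine ⟨hqm, ?_⟩
    rw [← (hmk 0).map_eq, Measure.map_map hqm (hmk 0).measurable, zero_add,
      ← Measure.restrict_congr_set (Ioo_ae_eq_Ioc (μ := volume) (a := (0:ℝ)) (b := 1)),
      ← Measure.restrict_congr_set (Ioo_ae_eq_Icc (μ := volume) (a := (0:ℝ)) (b := 1))]
    conv_rhs => rw [← Measure.map_id (μ := volume.restrict (Set.Ioo (0:ℝ) 1))]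
    refine Measure.map_congr ?_
    filter_upwards [ae_restrict_mem measurableSet_Ioo] with x hx
    rw [Function.comp_apply, hq]
    exact Int.fract_eq_self.2 ⟨hx.1.le, hx.2⟩
  have hsub : MeasurePreserving (fun t : ℝ => t - a) (volume.restrict (Set.Icc (0:ℝ) 1))
      (volume.restrict (Set.Ioc (-a) (-a + 1))) := by
    rw [hIcc]
    have := (measurePreserving_sub_right (volume : Measure ℝ) a).restrict_preimage
      (measurableSet_Ioc (a := -a) (b := -a + 1))
    convert this using 2
    ext t; simp [add_comm]
  have := hqmp.comp ((hmk (-a)).comp hsub)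
  convert this using 1
  ext t
  exact (hq _).symm

theorem measurePreserving_fr_sub (a : R2) :
    MeasurePreserving (fun y : R2 => fr (y - a)) (volume.restrict Y) (volume.restrict Y) := by
  have h := measurePreserving_pi (fun _ : Fin 2 => (volume.restrict (Set.Icc (0:ℝ) 1)))
    (fun _ : Fin 2 => (volume.restrict (Set.Icc (0:ℝ) 1)))
    (fun i => measurePreserving_fract_sub (a i))
  have hY : (volume : Measure R2).restrict Y
      = Measure.pi fun _ : Fin 2 => (volume.restrict (Set.Icc (0:ℝ) 1)) := by
    rw [Y, ← Set.pi_univ_Icc, volume_pi, Measure.restrict_pi_pi]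
    rfl
  rw [hY]
  exact h

end WrinkledPlate

namespace WrinkledPlate

instance : (volume : Measure R3).IsAddHaarMeasure :=
  Measure.prod.instIsAddHaarMeasure (volume : Measure R2) (volume : Measure ℝ)

/-! ### Periodic unfolding and two-scale compactness -/

/-- The point within distance `h` of `z.1` in the plane variables whose plane part is `h * z.2`
modulo the lattice `h ℤ²`. -/
noncomputable def unfold (h : ℝ) (z : R3 × R2) : R3 :=
  (z.1.1 + h • fr (z.2 - h⁻¹ • z.1.1), z.1.2)

/-- The product of Lebesgue measure on space and on the unit cell. -/
noncomputable abbrev cellMeasure : Measure (R3 × R2) :=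
  (volume : Measure R3).prod (volume.restrict Y)

/-- The map is a composition of two shears and a projection: for a fixed point of space the cell
variable is rotated on the torus, then for a fixed cell variable space is translated. Because it
acts on all of space and not on cells contained in the domain, no boundary layer appears. -/
theorem measurePreserving_unfold (h : ℝ) :
    MeasurePreserving (unfold h) cellMeasure volume := by
  have h1 : MeasurePreserving (fun z : R3 × R2 => (z.1, fr (z.2 - h⁻¹ • z.1.1)))
      cellMeasure cellMeasure := by
    refine (MeasurePreserving.id (volume : Measure R3)).skew_product
      (g := fun x y => fr (y - h⁻¹ • x.1)) ?_ ?_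
    · exact measurable_fr.comp (by fun_prop)
    · exact ae_of_all _ fun x => (measurePreserving_fr_sub (h⁻¹ • x.1)).map_eq
  have h2 : MeasurePreserving (fun z : R2 × R3 => (z.1, ((z.2.1 + h • z.1, z.2.2) : R3)))
      ((volume.restrict Y).prod (volume : Measure R3))
      ((volume.restrict Y).prod (volume : Measure R3)) := by
    refine (MeasurePreserving.id ((volume : Measure R2).restrict Y)).skew_product
      (g := fun (y : R2) (x : R3) => ((x.1 + h • y, x.2) : R3)) ?_ ?_
    · fun_prop
    · refine ae_of_all _ fun y => ?_
      have := (measurePreserving_add_right (volume : Measure R3) (h • y, 0)).map_eq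
      have e : (fun x : R3 => ((x.1 + h • y, x.2) : R3)) = fun x => x + (h • y, 0) := by
        ext x <;> simp
      change Measure.map (fun x : R3 => ((x.1 + h • y, x.2) : R3)) volume = volume
      rw [e]
      exact this
  have h3 := (measurePreserving_snd (μ := (volume : Measure R2).restrict Y)
    (ν := (volume : Measure R3))).comp (h2.comp (Measure.measurePreserving_swap.comp h1))
  exact h3

theorem dist_unfold_le {h : ℝ} (hh : 0 ≤ h) (z : R3 × R2) : dist (unfold h z) z.1 ≤ h := by
  rw [unfold, Prod.dist_eq]
  simp only [dist_self, dist_self_add_left, norm_smul, Real.norm_eq_abs, abs_of_nonneg hh]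
  refine max_le ?_ hh
  exact (mul_le_mul_of_nonneg_left (norm_fr_le _) hh).trans (by simp)

/-- The vector x'/h + fr(y - x'/h) differs from y by a lattice vector. Hence unfolding replaces the
fast variable x'/h by the independent cell variable. -/
theorem toTorus_unfold {h : ℝ} (hh : h ≠ 0) (z : R3 × R2) :
    toTorus (h⁻¹ • (unfold h z).1) = toTorus z.2 := by
  refine toTorus_eq_of_fr_eq ?_
  ext i
  simp only [fr, unfold, Pi.smul_apply, Pi.add_apply, Pi.sub_apply, smul_eq_mul, mul_add,
    ← mul_assoc, inv_mul_cancel₀ hh, one_mul]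
  rw [Int.fract_eq_fract]
  exact ⟨-⌊z.2 i - h⁻¹ * z.1.1 i⌋, by rw [Int.fract]; push_cast; ring⟩

/-- Unfolding preserves measure and moves points by at most h. Uniform continuity settles compactly
supported continuous functions, and density the rest. Vector values are allowed because the test
functions of two-scale convergence take values in the continuous functions on the torus. -/
theorem tendsto_eLpNorm_unfold_sub {E : Type*} [NormedAddCommGroup E] [NormedSpace ℝ E]
    {h : ℕ → ℝ} (h_pos : ∀ n, 0 < h n) (h_lim : Tendsto h atTop (𝓝 0))
    {f : R3 → E} (hf : MemLp f 2 volume) :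
    Tendsto (fun n => eLpNorm (fun z => f (unfold (h n) z) - f z.1) 2 cellMeasure) atTop
      (𝓝 0) := by
  rw [ENNReal.tendsto_nhds_zero]
  intro ε hε
  have hε3 : ε / 3 ≠ 0 := (ENNReal.div_pos hε.ne' (by simp)).ne'
  obtain ⟨g, hgs, hfg, hgc, hg⟩ :=
    hf.exists_hasCompactSupport_eLpNorm_sub_le ENNReal.ofNat_ne_top hε3
  have hmp1 := measurePreserving_fst (μ := (volume : Measure R3))
    (ν := (volume : Measure R2).restrict Y)
  have hfgm : AEStronglyMeasurable (f - g) volume := (hf.sub hg).1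
  -- For h < 1 both terms of the difference vanish off K, so a uniform bound δ becomes an L² bound
  -- δ·M with M finite.
  let K := Metric.cthickening 1 (tsupport g)
  have hK : IsCompact K := hgs.isCompact.cthickening
  let M : ENNReal := (volume K) ^ (1 / (2 : ENNReal).toReal)
  have hM : M ≠ ⊤ := ENNReal.rpow_ne_top_of_nonneg (by simp) hK.measure_lt_top.ne
  obtain ⟨δ, hδ, hδM⟩ : ∃ δ : ℝ, 0 < δ ∧ ENNReal.ofReal δ * M ≤ ε / 3 := by
    have h0 : Tendsto (fun δ : ℝ => ENNReal.ofReal δ * M) (𝓝[>] 0) (𝓝 0) := by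
      have h1 : Tendsto (fun δ : ℝ => ENNReal.ofReal δ) (𝓝[>] 0) (𝓝 0) := by
        have := (ENNReal.continuous_ofReal.tendsto 0).mono_left
          (nhdsWithin_le_nhds (s := Set.Ioi (0:ℝ)))
        simpa using this
      simpa using ENNReal.Tendsto.mul_const h1 (Or.inr hM)
    have h2 := (h0.eventually (gt_mem_nhds (pos_iff_ne_zero.2 hε3))).and
      (self_mem_nhdsWithin (s := Set.Ioi (0:ℝ)))
    obtain ⟨δ, h3, h4⟩ := h2.exists
    exact ⟨δ, h4, h3.le⟩
  have huc := hgs.uniformContinuous_of_continuous hgc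
  obtain ⟨r, hr, hgr⟩ := Metric.uniformContinuous_iff.1 huc δ hδ
  filter_upwards [h_lim.eventually (gt_mem_nhds hr), h_lim.eventually (gt_mem_nhds one_pos)]
    with n hn hn1
  have hd := fun z => dist_unfold_le (h_pos n).le z
  have hmid : eLpNorm (fun z : R3 × R2 => g (unfold (h n) z) - g z.1) 2 cellMeasure
      ≤ ε / 3 := by
    refine le_trans ?_ hδM
    have hb : ∀ z : R3 × R2, ‖g (unfold (h n) z) - g z.1‖ ≤
        ‖(Prod.fst ⁻¹' K).indicator (fun _ => δ) z‖ := by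
      intro z
      by_cases hz : z.1 ∈ K
      · rw [Set.indicator_of_mem (by exact hz), Real.norm_of_nonneg hδ.le, ← dist_eq_norm]
        exact (hgr ((hd z).trans_lt hn)).le
      · have h1 : z.1 ∉ tsupport g := fun h => hz (Metric.self_subset_cthickening _ h)
        have h2 : unfold (h n) z ∉ tsupport g := fun h => hz
          (Metric.mem_cthickening_of_dist_le _ _ _ _ h (by rw [dist_comm]; exact (hd z).trans hn1.le))
        rw [image_eq_zero_of_notMem_tsupport h1, image_eq_zero_of_notMem_tsupport h2]
        simp
    refine (eLpNorm_mono hb).trans ((eLpNorm_indicator_const_le _ _).trans ?_)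
    rw [hmp1.measure_preimage hK.isClosed.measurableSet.nullMeasurableSet,
      Real.enorm_of_nonneg hδ.le]
  have e1 : (fun z : R3 × R2 => f (unfold (h n) z) - f z.1) =
      (((f - g) ∘ unfold (h n)) + fun z : R3 × R2 => g (unfold (h n) z) - g z.1)
        - (f - g) ∘ Prod.fst := by
    ext z; simp
  have hmp := measurePreserving_unfold (h n)
  have m1 : AEStronglyMeasurable ((f - g) ∘ unfold (h n)) cellMeasure :=
    hfgm.comp_measurePreserving hmp
  have m2 : AEStronglyMeasurable (fun z : R3 × R2 => g (unfold (h n) z) - g z.1) cellMeasure :=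
    (hg.1.comp_measurePreserving hmp).sub (hg.1.comp_measurePreserving hmp1)
  have m3 : AEStronglyMeasurable ((f - g) ∘ Prod.fst) cellMeasure :=
    hfgm.comp_measurePreserving hmp1
  rw [e1]
  refine (eLpNorm_sub_le (m1.add m2) m3 (by norm_num)).trans ?_
  refine (add_le_add (eLpNorm_add_le m1 m2 (by norm_num)) le_rfl).trans ?_
  rw [eLpNorm_comp_measurePreserving hfgm hmp, eLpNorm_comp_measurePreserving hfgm hmp1]
  calc _ ≤ ε / 3 + ε / 3 + ε / 3 := by gcongr
    _ = ε := ENNReal.add_thirds ε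

/-- A bounded sequence in a separable Hilbert space has a weakly convergent subsequence. -/
theorem exists_subseq_tendsto_inner {H : Type*} [NormedAddCommGroup H] [InnerProductSpace ℝ H]
    [CompleteSpace H] [TopologicalSpace.SeparableSpace H] {x : ℕ → H} {C : ℝ}
    (hx : ∀ n, ‖x n‖ ≤ C) :
    ∃ w : H, ∃ φ : ℕ → ℕ, StrictMono φ ∧
      ∀ g : H, Tendsto (fun n => inner ℝ (x (φ n)) g) atTop (𝓝 (inner ℝ w g)) := by
  let D := InnerProductSpace.toDual ℝ H
  have hmem : ∀ n, StrongDual.toWeakDual (D (x n)) ∈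
      WeakDual.toStrongDual ⁻¹' Metric.closedBall (0 : StrongDual ℝ H) C := by
    intro n
    rw [Set.mem_preimage, mem_closedBall_zero_iff]
    exact (D.norm_map (x n)).trans_le (hx n)
  obtain ⟨a, -, φ, hφ, hlim⟩ := WeakDual.isSeqCompact_closedBall ℝ H 0 C hmem
  refine ⟨D.symm (WeakDual.toStrongDual a), φ, hφ, fun g => ?_⟩
  have := (WeakDual.eval_continuous g).tendsto a |>.comp hlim
  have e : inner ℝ (D.symm (WeakDual.toStrongDual a)) g = a g :=
    InnerProductSpace.toDual_symm_apply
  rw [e]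
  exact this

end WrinkledPlate

namespace WrinkledPlate

/-! ### Two-scale convergence -/

section Holder

variable {X : Type*} [MeasurableSpace X] {μ : Measure X}

theorem eLpNorm_one_mul_le {f g : X → ℝ} (hf : AEStronglyMeasurable f μ)
    (hg : AEStronglyMeasurable g μ) :
    eLpNorm (fun x => f x * g x) 1 μ ≤ eLpNorm f 2 μ * eLpNorm g 2 μ := by
  have h := eLpNorm_smul_le_mul_eLpNorm (p := 2) (q := 2) (r := 1) (μ := μ) hg hf
  exact h

theorem enorm_integral_le_eLpNorm_one (f : X → ℝ) : ‖∫ x, f x ∂μ‖ₑ ≤ eLpNorm f 1 μ := by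
  rw [eLpNorm_one_eq_lintegral_enorm]
  exact enorm_integral_le_lintegral_enorm _

theorem enorm_integral_mul_le {f g : X → ℝ} (hf : AEStronglyMeasurable f μ)
    (hg : AEStronglyMeasurable g μ) :
    ‖∫ x, f x * g x ∂μ‖ₑ ≤ eLpNorm f 2 μ * eLpNorm g 2 μ :=
  (enorm_integral_le_eLpNorm_one _).trans (eLpNorm_one_mul_le hf hg)

theorem tendsto_zero_of_enorm_le {a : ℕ → ℝ} {b : ℕ → ENNReal} (h : ∀ᶠ n in atTop, ‖a n‖ₑ ≤ b n)
    (hb : Tendsto b atTop (𝓝 0)) : Tendsto a atTop (𝓝 0) := by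
  rw [tendsto_zero_iff_enorm_tendsto_zero]
  exact tendsto_of_tendsto_of_tendsto_of_le_of_le' tendsto_const_nhds hb
    (Eventually.of_forall fun _ => zero_le) h

theorem tendsto_integral_mul_of_weak_of_strong {f : ℕ → X → ℝ} {f₀ : X → ℝ} {g : ℕ → X → ℝ}
    {g₀ : X → ℝ} {C : ENNReal} (hC : C ≠ ⊤) (hf : ∀ n, MemLp (f n) 2 μ)
    (hfC : ∀ n, eLpNorm (f n) 2 μ ≤ C)
    (hweak : ∀ g, MemLp g 2 μ →
      Tendsto (fun n => ∫ x, f n x * g x ∂μ) atTop (𝓝 (∫ x, f₀ x * g x ∂μ)))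
    (hg : ∀ n, MemLp (g n) 2 μ) (hg₀ : MemLp g₀ 2 μ)
    (hstrong : Tendsto (fun n => eLpNorm (fun x => g n x - g₀ x) 2 μ) atTop (𝓝 0)) :
    Tendsto (fun n => ∫ x, f n x * g n x ∂μ) atTop (𝓝 (∫ x, f₀ x * g₀ x ∂μ)) := by
  have h1 : Tendsto (fun n => ∫ x, f n x * (g n x - g₀ x) ∂μ) atTop (𝓝 0) := by
    refine tendsto_zero_of_enorm_le (b := fun n => C * eLpNorm (fun x => g n x - g₀ x) 2 μ)
      (Eventually.of_forall fun n => ?_) ?_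
    · refine (enorm_integral_mul_le (hf n).1 ((hg n).sub hg₀).1).trans ?_
      gcongr
      exacts [hfC n, le_rfl]
    · simpa using ENNReal.Tendsto.const_mul hstrong (Or.inr hC)
  have h2 := h1.add (hweak g₀ hg₀)
  rw [zero_add] at h2
  refine h2.congr fun n => ?_
  have h3 : Integrable (fun x => f n x * (g n x - g₀ x)) μ :=
    (hf n).integrable_mul ((hg n).sub hg₀)
  have h4 : Integrable (fun x => f n x * g₀ x) μ := (hf n).integrable_mul hg₀
  rw [← integral_add h3 h4]
  congr 1; ext x; ring

/-- A bounded sequence in `L²` has a weakly convergent subsequence. -/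
theorem exists_subseq_tendsto_integral_mul [MeasurableSpace.CountablyGenerated X] [SFinite μ]
    {f : ℕ → X → ℝ} (hf : ∀ n, MemLp (f n) 2 μ) {C : ENNReal} (hC : C ≠ ⊤)
    (hfC : ∀ n, eLpNorm (f n) 2 μ ≤ C) :
    ∃ ψ : ℕ → ℕ, StrictMono ψ ∧ ∃ w : X → ℝ, MemLp w 2 μ ∧ ∀ g, MemLp g 2 μ →
      Tendsto (fun n => ∫ x, f (ψ n) x * g x ∂μ) atTop (𝓝 (∫ x, w x * g x ∂μ)) := by
  have : Fact ((2 : ENNReal) ≠ ⊤) := ⟨by simp⟩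
  have hn : ∀ n, ‖(hf n).toLp‖ ≤ C.toReal := by
    intro n
    rw [Lp.norm_toLp]
    exact ENNReal.toReal_mono hC (hfC n)
  obtain ⟨w, ψ, hψ, hlim⟩ := exists_subseq_tendsto_inner hn
  refine ⟨ψ, hψ, w, Lp.memLp w, fun g hg => ?_⟩
  have h1 := hlim hg.toLp
  simp only [L2.inner_def] at h1
  have e : ∀ f : X → ℝ, ∀ F : Lp ℝ 2 μ, F =ᵐ[μ] f →
      ∫ z, inner ℝ (F z) (hg.toLp g z) ∂μ = ∫ z, f z * g z ∂μ := by
    intro f F hF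
    refine integral_congr_ae ?_
    filter_upwards [hF, hg.coeFn_toLp] with z h2 h3
    rw [h2, h3]; simp [mul_comm]
  rw [e w w EventuallyEq.rfl] at h1
  exact h1.congr fun n => e _ _ (hf (ψ n)).coeFn_toLp

theorem aestronglyMeasurable_eval {k : X → C(UnitAddTorus (Fin 2), ℝ)}
    (hk : AEStronglyMeasurable k μ) {t : X → UnitAddTorus (Fin 2)}
    (ht : AEStronglyMeasurable t μ) : AEStronglyMeasurable (fun x => k x (t x)) μ := by
  have heval : Continuous fun p : C(UnitAddTorus (Fin 2), ℝ) × UnitAddTorus (Fin 2) =>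
    p.1 p.2 := by fun_prop
  exact heval.comp_aestronglyMeasurable (hk.prodMk ht)

theorem memLp_eval {k : X → C(UnitAddTorus (Fin 2), ℝ)} (hk : MemLp k 2 μ)
    {t : X → UnitAddTorus (Fin 2)} (ht : AEStronglyMeasurable t μ) :
    MemLp (fun x => k x (t x)) 2 μ :=
  hk.mono (aestronglyMeasurable_eval hk.1 ht) (ae_of_all _ fun x => (k x).norm_coe_le_norm _)

theorem aestronglyMeasurable_toTorus {p : X → R2} (hp : AEMeasurable p μ) :
    AEStronglyMeasurable (fun x => toTorus (p x)) μ :=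
  continuous_toTorus.comp_aestronglyMeasurable hp.aestronglyMeasurable

theorem memLp_indicator {E : Type*} [NormedAddCommGroup E] {U : Set X} (hU : MeasurableSet U)
    {u : X → E} (hu : MemLp u 2 (μ.restrict U)) : MemLp (U.indicator u) 2 μ :=
  (memLp_indicator_iff_restrict hU).2 hu

end Holder

theorem memLp_restrict_prod_Y {U : Set R3} (w : R3 × R2 → ℝ)
    (hw : MemLp w 2 cellMeasure) :
    MemLp w 2 ((volume.restrict U).prod (volume.restrict Y)) := by
  have : (volume.restrict U).prod ((volume : Measure R2).restrict Y)
      = cellMeasure.restrict (U ×ˢ Set.univ) := by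
    rw [cellMeasure, ← Measure.prod_restrict, Measure.restrict_univ]
  rw [this]
  exact hw.restrict _

/-- Weak convergence of the unfolded functions implies two-scale convergence. -/
theorem twoScaleTendsto_of_unfold {U : Set R3} (hU : MeasurableSet U) {h : ℕ → ℝ}
    (h_pos : ∀ n, 0 < h n) (h_lim : Tendsto h atTop (𝓝 0)) {u : ℕ → R3 → ℝ}
    (hu : ∀ n, MemLp (u n) 2 (volume.restrict U)) {C : ENNReal} (hC : C ≠ ⊤)
    (huC : ∀ n, eLpNorm (u n) 2 (volume.restrict U) ≤ C) {w : R3 × R2 → ℝ}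
    (hw : MemLp w 2 cellMeasure)
    (hweak : ∀ g, MemLp g 2 cellMeasure →
      Tendsto (fun n => ∫ z, U.indicator (u n) (unfold (h n) z) * g z ∂cellMeasure) atTop
        (𝓝 (∫ z, w z * g z ∂cellMeasure))) :
    TwoScaleTendsto (volume.restrict U) Prod.fst h u (fun x y => w (x, y)) := by
  refine ⟨hu, memLp_restrict_prod_Y w hw, fun Ψ hΨ => ?_⟩
  have hu' : ∀ n, MemLp (U.indicator (u n)) 2 volume := fun n =>
    memLp_indicator hU (hu n)
  have hΨ' : MemLp (U.indicator Ψ) 2 volume := memLp_indicator hU hΨ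
  have hmp := fun n => measurePreserving_unfold (h n)
  have hmp1 := measurePreserving_fst (μ := (volume : Measure R3))
    (ν := (volume : Measure R2).restrict Y)
  have hev : ∀ k : R3 × R2 → C(UnitAddTorus (Fin 2), ℝ), MemLp k 2 cellMeasure →
      MemLp (fun z => k z (toTorus z.2)) 2 cellMeasure := fun k hk =>
    memLp_eval hk (aestronglyMeasurable_toTorus measurable_snd.aemeasurable)
  have hk₀ : MemLp (fun z : R3 × R2 => U.indicator Ψ z.1) 2 cellMeasure :=
    hΨ'.comp_measurePreserving hmp1
  have hk : ∀ n, MemLp (fun z : R3 × R2 => U.indicator Ψ (unfold (h n) z)) 2 cellMeasure :=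
    fun n => hΨ'.comp_measurePreserving (hmp n)
  -- Evaluation at a point of the torus is bounded by the supremum norm, so strong convergence of
  -- the Banach-valued unfolding controls the evaluated one.
  have hstrong : Tendsto (fun n => eLpNorm (fun z : R3 × R2 =>
      U.indicator Ψ (unfold (h n) z) (toTorus z.2) - U.indicator Ψ z.1 (toTorus z.2)) 2
      cellMeasure) atTop (𝓝 0) := by
    refine tendsto_of_tendsto_of_tendsto_of_le_of_le tendsto_const_nhds
      (tendsto_eLpNorm_unfold_sub h_pos h_lim hΨ') (fun _ => zero_le) fun n => ?_
    refine eLpNorm_mono fun z => ?_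
    exact ContinuousMap.norm_coe_le_norm
      (U.indicator Ψ (unfold (h n) z) - U.indicator Ψ z.1) (toTorus z.2)
  have key := tendsto_integral_mul_of_weak_of_strong (μ := cellMeasure)
    (f := fun n z => U.indicator (u n) (unfold (h n) z)) (f₀ := w)
    (g := fun n z => U.indicator Ψ (unfold (h n) z) (toTorus z.2))
    (g₀ := fun z => U.indicator Ψ z.1 (toTorus z.2)) hC
    (fun n => (hu' n).comp_measurePreserving (hmp n))
    (fun n => by
      have := eLpNorm_comp_measurePreserving (p := 2) (hu' n).1 (hmp n)
      rw [eLpNorm_indicator_eq_eLpNorm_restrict hU] at this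
      exact this.trans_le (huC n))
    hweak (fun n => hev _ (hk n)) (hev _ hk₀) hstrong
  -- After unfolding, the evaluation point depends on the cell variable only; by `toTorus_unfold` it
  -- is the class of the rescaled unfolded point, so measure preservation brings the integral back
  -- to the original oscillating one.
  have e1 : ∀ n, ∫ z, U.indicator (u n) (unfold (h n) z) *
      U.indicator Ψ (unfold (h n) z) (toTorus z.2) ∂cellMeasure =
      ∫ x in U, u n x * Ψ x (toTorus ((h n)⁻¹ • x.1)) := by
    intro n
    let q : R3 → ℝ := fun x =>
      U.indicator (u n) x * U.indicator Ψ x (toTorus ((h n)⁻¹ • x.1))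
    have hq : AEStronglyMeasurable q volume :=
      (hu' n).1.mul (aestronglyMeasurable_eval hΨ'.1
        (aestronglyMeasurable_toTorus (p := fun x : R3 => (h n)⁻¹ • x.1)
        (measurable_fst.const_smul (h n)⁻¹).aemeasurable))
    have h1 : ∫ z, q (unfold (h n) z) ∂cellMeasure = ∫ x, q x := by
      rw [← (hmp n).map_eq] at hq
      rw [← integral_map (hmp n).aemeasurable hq, (hmp n).map_eq]
    have h2 : ∫ x, q x = ∫ x in U, u n x * Ψ x (toTorus ((h n)⁻¹ • x.1)) := by
      rw [← integral_indicator hU]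
      congr 1; ext x
      by_cases hx : x ∈ U <;> simp [q, hx]
    rw [← h2, ← h1]
    congr 1; ext z
    simp only [q, toTorus_unfold (h_pos n).ne']
  have e2 : ∫ z, w z * U.indicator Ψ z.1 (toTorus z.2) ∂cellMeasure =
      ∫ x in U, (∫ y in Y, w (x, y) * Ψ x (toTorus y)) := by
    have h1 : Integrable (fun z => w z * U.indicator Ψ z.1 (toTorus z.2)) cellMeasure :=
      hw.integrable_mul (hev _ hk₀)
    rw [cellMeasure, integral_prod _ h1, ← integral_indicator hU]
    congr 1; ext x
    by_cases hx : x ∈ U <;> simp [hx]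
  rw [e2] at key
  exact key.congr e1

/-- Bounded sequences in `L²` are relatively compact for two-scale convergence. -/
theorem exists_subseq_twoScaleTendsto {U : Set R3} (hU : MeasurableSet U) {h : ℕ → ℝ}
    (h_pos : ∀ n, 0 < h n) (h_lim : Tendsto h atTop (𝓝 0)) {u : ℕ → R3 → ℝ}
    (hu : ∀ n, MemLp (u n) 2 (volume.restrict U)) {C : ENNReal} (hC : C ≠ ⊤)
    (huC : ∀ n, eLpNorm (u n) 2 (volume.restrict U) ≤ C) :
    ∃ ψ : ℕ → ℕ, StrictMono ψ ∧ ∃ w : R3 → R2 → ℝ,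
      TwoScaleTendsto (volume.restrict U) Prod.fst (h ∘ ψ) (fun n => u (ψ n)) w := by
  have hu' : ∀ n, MemLp (U.indicator (u n)) 2 volume := fun n =>
    memLp_indicator hU (hu n)
  have hm : ∀ n, MemLp (U.indicator (u n) ∘ unfold (h n)) 2 cellMeasure := fun n =>
    (hu' n).comp_measurePreserving (measurePreserving_unfold (h n))
  have hn : ∀ n, eLpNorm (U.indicator (u n) ∘ unfold (h n)) 2 cellMeasure ≤ C := by
    intro n
    rw [eLpNorm_comp_measurePreserving (hu' n).1 (measurePreserving_unfold (h n)),
      eLpNorm_indicator_eq_eLpNorm_restrict hU]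
    exact huC n
  obtain ⟨ψ, hψ, w, hw, hlim⟩ := exists_subseq_tendsto_integral_mul hm hC hn
  exact ⟨ψ, hψ, fun x y => w (x, y), twoScaleTendsto_of_unfold hU (fun n => h_pos _)
    (h_lim.comp hψ.tendsto_atTop) (fun n => hu _) hC (fun n => huC _) hw hlim⟩

/-- A constant sequence two-scale converges. -/
theorem twoScaleTendsto_const {U : Set R3} (hU : MeasurableSet U) {h : ℕ → ℝ}
    (h_pos : ∀ n, 0 < h n) (h_lim : Tendsto h atTop (𝓝 0)) {u : R3 → ℝ}
    (hu : MemLp u 2 (volume.restrict U)) :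
    TwoScaleTendsto (volume.restrict U) Prod.fst h (fun _ => u)
      (fun x _ => U.indicator u x) := by
  have hu' : MemLp (U.indicator u) 2 volume := memLp_indicator hU hu
  have hmp1 := measurePreserving_fst (μ := (volume : Measure R3))
    (ν := (volume : Measure R2).restrict Y)
  refine twoScaleTendsto_of_unfold hU h_pos h_lim (fun _ => hu) hu.2.ne (fun _ => le_rfl)
    (w := fun z => U.indicator u z.1) (hu'.comp_measurePreserving hmp1) fun g hg => ?_
  -- The roles are exchanged here: the constant sequence `g` is the weak factor, the unfolding of
  -- `u` the strong one.
  have := tendsto_integral_mul_of_weak_of_strong (μ := cellMeasure) (f := fun _ => g) (f₀ := g)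
    hg.2.ne (fun _ => hg) (fun _ => le_rfl) (fun _ _ => tendsto_const_nhds)
    (g := fun n z => U.indicator u (unfold (h n) z)) (g₀ := fun z => U.indicator u z.1)
    (fun n => hu'.comp_measurePreserving (measurePreserving_unfold (h n)))
    (hu'.comp_measurePreserving hmp1) (tendsto_eLpNorm_unfold_sub h_pos h_lim hu')
  simpa only [mul_comm] using this

/-- Products φ(x) g(y) are the only test functions used to identify limits, because they already
separate functions on the product. -/
theorem TwoScaleTendsto.test {X : Type*} [MeasurableSpace X] {μ : Measure X}
    [IsFiniteMeasure μ] {p : X → R2} {h : ℕ → ℝ} {u : ℕ → X → ℝ} {u₀ : X → R2 → ℝ}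
    (hu : TwoScaleTendsto μ p h u u₀) {ϕ : X → ℝ} (hϕ : AEStronglyMeasurable ϕ μ) {C : ℝ}
    (hϕC : ∀ x, |ϕ x| ≤ C) {g : R2 → ℝ} (hg : IsYPeriodic g) (hgc : Continuous g) :
    Tendsto (fun n => ∫ x, u n x * (ϕ x * g ((h n)⁻¹ • p x)) ∂μ) atTop
      (𝓝 (∫ x, (∫ y in Y, u₀ x y * g y) * ϕ x ∂μ)) := by
  obtain ⟨G, hG⟩ := hg.exists_lift hgc
  have hΨ : MemLp (fun x => ϕ x • G) 2 μ := by
    refine MemLp.of_bound (hϕ.smul_const G) (C * ‖G‖) (ae_of_all _ fun x => ?_)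
    rw [norm_smul]
    exact mul_le_mul_of_nonneg_right (hϕC x) (norm_nonneg _)
  have h1 := hu.tendsto _ hΨ
  simp only [ContinuousMap.smul_apply, hG, smul_eq_mul] at h1
  convert h1 using 4 with x
  rw [← integral_mul_const]
  congr 1; ext y; ring

theorem TwoScaleTendsto.subseq {X : Type*} [MeasurableSpace X] {μ : Measure X}
    {p : X → R2} {h : ℕ → ℝ} {u : ℕ → X → ℝ} {u₀ : X → R2 → ℝ}
    (hu : TwoScaleTendsto μ p h u u₀) {φ : ℕ → ℕ} (hφ : StrictMono φ) :
    TwoScaleTendsto μ p (h ∘ φ) (fun n => u (φ n)) u₀ :=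
  ⟨fun _ => hu.memLp _, hu.memLp_lim, fun Ψ hΨ => (hu.tendsto Ψ hΨ).comp hφ.tendsto_atTop⟩

end WrinkledPlate

namespace WrinkledPlate

/-! ### Mollification and the chain rule for weak derivatives -/

section ChainRule

variable {E : Type*} [NormedAddCommGroup E] [NormedSpace ℝ E] [FiniteDimensional ℝ E]
  [MeasureSpace E] [BorelSpace E] [(volume : Measure E).IsAddHaarMeasure]

/-- Continuity of translations in L¹, obtained from the continuity of composition with measure
preserving maps: by currying, the translations form a continuous family in C(E, E). -/
theorem tendsto_lintegral_translate_sub {f : E → ℝ} (hf : Integrable f) :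
    Tendsto (fun t : E => ∫⁻ x, ‖f (x - t) - f x‖ₑ) (𝓝 0) (𝓝 0) := by
  let F : Lp ℝ 1 (volume : Measure E) := (memLp_one_iff_integrable.2 hf).toLp
  let g : E → C(E, E) :=
    (⟨fun p : E × E => p.2 - p.1, by fun_prop⟩ : C(E × E, E)).curry
  have hg : Continuous g := ContinuousMap.continuous _
  have hgm : ∀ t, MeasurePreserving (g t) (volume : Measure E) volume := fun t =>
    measurePreserving_sub_right volume t
  have h1 := (tendsto_const_nhds (x := F) (f := 𝓝 (0 : E))).compMeasurePreservingLp
    (hg.tendsto 0) hgm (hgm 0) ENNReal.one_ne_top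
  have h2 := tendsto_iff_edist_tendsto_0.1 h1
  refine h2.congr fun t => ?_
  rw [Lp.edist_def, eLpNorm_one_eq_lintegral_enorm]
  refine lintegral_congr_ae ?_
  have hF : F =ᵐ[volume] f := MemLp.coeFn_toLp _
  filter_upwards [Lp.coeFn_compMeasurePreserving F (hgm t),
    Lp.coeFn_compMeasurePreserving F (hgm 0), (hgm t).quasiMeasurePreserving.ae hF,
    (hgm 0).quasiMeasurePreserving.ae hF] with x h3 h4 h5 h6
  simp only [Pi.sub_apply, h3, h4, Function.comp_apply, h5, h6]
  simp [g]

open ContinuousLinearMap in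
/-- The mollification of `f` by a normalized bump function. -/
noncomputable def mollify (ρ : ContDiffBump (0 : E)) (f : E → ℝ) : E → ℝ :=
  convolution f (ρ.normed volume) (ContinuousLinearMap.mul ℝ ℝ) volume

theorem contDiff_mollify (ρ : ContDiffBump (0 : E)) {f : E → ℝ} (hf : Integrable f) :
    ContDiff ℝ 1 (mollify ρ f) :=
  ρ.hasCompactSupport_normed.contDiff_convolution_right (n := 1) _ hf.locallyIntegrable
    ρ.contDiff_normed

/-- Mollification averages translates with a nonnegative weight of total mass one, so its L¹ error
is at most the worst error of a translate by a vector in the support of the weight. -/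
theorem lintegral_mollify_sub_le (ρ : ContDiffBump (0 : E)) {f : E → ℝ} (hf : Integrable f)
    {ε : ENNReal} (hε : ∀ t, ‖t‖ ≤ ρ.rOut → ∫⁻ x, ‖f (x - t) - f x‖ₑ ≤ ε) :
    ∫⁻ x, ‖mollify ρ f x - f x‖ₑ ≤ ε := by
  set r : E → ℝ := ρ.normed volume with hr
  have hr0 : ∀ t, 0 ≤ r t := ρ.nonneg_normed
  have hrc : Continuous r := ρ.continuous_normed
  have hri : Integrable r volume := ρ.integrable_normed
  have hr1 : ∫ t, r t = 1 := ρ.integral_normed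
  obtain ⟨M, hM⟩ := ρ.hasCompactSupport_normed (μ := volume) |>.exists_bound_of_continuous hrc
  have h1 : ∀ x, ‖mollify ρ f x - f x‖ₑ ≤ ∫⁻ t, ‖r t * (f (x - t) - f x)‖ₑ := by
    intro x
    have e : mollify ρ f x - f x = ∫ t, r t * (f (x - t) - f x) := by
      have e1 : mollify ρ f x = ∫ t, f (x - t) * r t := convolution_mul_swap
      have i1 : Integrable (fun t => f (x - t) * r t) volume :=
        (hf.comp_sub_left x).mul_bdd (c := M) hrc.aestronglyMeasurable (ae_of_all _ hM)
      have i2 : Integrable (fun t => r t * f x) volume := hri.mul_const _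
      have e2 : f x = ∫ t, r t * f x := by rw [integral_mul_const, hr1, one_mul]
      rw [e1]
      conv_lhs => rw [e2]
      rw [← integral_sub i1 i2]
      congr 1; ext t; ring
    rw [e]
    exact enorm_integral_le_lintegral_enorm _
  refine (lintegral_mono h1).trans ?_
  have hm : AEMeasurable (Function.uncurry fun x t => ‖r t * (f (x - t) - f x)‖ₑ)
      ((volume : Measure E).prod volume) := by
    have a1 : AEStronglyMeasurable (fun p : E × E => f (p.1 - p.2))
        ((volume : Measure E).prod volume) :=
      hf.1.comp_quasiMeasurePreserving (quasiMeasurePreserving_sub _ _)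
    have a2 : AEStronglyMeasurable (fun p : E × E => f p.1)
        ((volume : Measure E).prod volume) := hf.1.comp_fst
    have a3 : AEStronglyMeasurable (fun p : E × E => r p.2)
        ((volume : Measure E).prod volume) := hrc.aestronglyMeasurable.comp_snd
    exact (a3.mul (a1.sub a2)).enorm
  rw [lintegral_lintegral_swap hm]
  have h2 : ∀ t, ∫⁻ x, ‖r t * (f (x - t) - f x)‖ₑ ≤ ‖r t‖ₑ * ε := by
    intro t
    simp only [enorm_mul]
    rw [lintegral_const_mul' _ _ enorm_ne_top]
    by_cases ht : ‖t‖ ≤ ρ.rOut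
    · gcongr; exact hε t ht
    · have : r t = 0 := by
        by_contra h0
        have : t ∈ Function.support r := h0
        rw [hr, ρ.support_normed_eq, mem_ball_zero_iff] at this
        exact ht this.le
      simp [this]
  refine (lintegral_mono h2).trans ?_
  rw [lintegral_mul_const'' _ hri.1.enorm]
  have h3 : ∫⁻ t, ‖r t‖ₑ = 1 := by
    rw [← ENNReal.ofReal_one, ← hr1, ofReal_integral_eq_lintegral_ofReal hri (ae_of_all _ hr0)]
    exact lintegral_congr fun t => Real.enorm_of_nonneg (hr0 t)
  rw [h3, one_mul]

/-- Away from the boundary, mollification commutes with weak derivatives. -/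
theorem fderiv_mollify_indicator {U : Set E} (hU : MeasurableSet U) {e : E} {u g : E → ℝ}
    (hu : IntegrableOn u U) (hw : IsWeakDeriv U e u g)
    (ρ : ContDiffBump (0 : E)) {x : E} (hx : Metric.closedBall x ρ.rOut ⊆ U) :
    fderiv ℝ (mollify ρ (U.indicator u)) x e = mollify ρ (U.indicator g) x := by
  have hρ : ContDiff ℝ (⊤ : ℕ∞) (ρ.normed (volume : Measure E)) := ρ.contDiff_normed
  have hρ1 : ContDiff ℝ 1 (ρ.normed (volume : Measure E)) := ρ.contDiff_normed
  have hρc := ρ.hasCompactSupport_normed (μ := (volume : Measure E))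
  have hul : LocallyIntegrable (U.indicator u) volume :=
    ((integrable_indicator_iff hU).2 hu).locallyIntegrable
  have h1 := hρc.hasFDerivAt_convolution_right (ContinuousLinearMap.mul ℝ ℝ) hul hρ1 x
  have h2 : fderiv ℝ (mollify ρ (U.indicator u)) x e =
      ∫ t, U.indicator u t * fderiv ℝ (ρ.normed (volume : Measure E)) (x - t) e := by
    rw [mollify, h1.fderiv, convolution_precompR_apply _ hul (hρc.fderiv ℝ)
      (hρ1.continuous_fderiv one_ne_zero)]
    rfl
  -- The reflected kernel is supported in the closed ball about `x`, hence in U, so it is itself an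
  -- admissible test function for the weak derivative.
  let φ : E → ℝ := fun t => ρ.normed volume (x - t)
  have hφd : ∀ t, fderiv ℝ φ t e = - fderiv ℝ (ρ.normed (volume : Measure E)) (x - t) e := by
    intro t
    have h3 : HasFDerivAt (fun t : E => x - t) (-ContinuousLinearMap.id ℝ E) t :=
      (hasFDerivAt_id t).const_sub x
    have h4 := ((hρ1.differentiable one_ne_zero (x - t)).hasFDerivAt).comp t h3
    have h5 : fderiv ℝ φ t = _ := h4.fderiv
    rw [h5]; simp
  have hφs : tsupport φ ⊆ Metric.closedBall x ρ.rOut := by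
    refine closure_minimal ?_ Metric.isClosed_closedBall
    intro t ht
    have h6 : x - t ∈ Function.support (ρ.normed (volume : Measure E)) := ht
    rw [ρ.support_normed_eq, mem_ball_zero_iff] at h6
    rw [mem_closedBall_iff_norm, norm_sub_rev]
    exact h6.le
  have hφc : HasCompactSupport φ :=
    HasCompactSupport.of_support_subset_isCompact (isCompact_closedBall x ρ.rOut)
      ((subset_tsupport φ).trans hφs)
  have h7 := hw φ (hρ.comp (contDiff_const.sub contDiff_id)) hφc (hφs.trans hx)
  have h8 : mollify ρ (U.indicator g) x = ∫ t in U, g t * φ t := by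
    rw [← integral_indicator hU]
    change ∫ t, U.indicator g t * ρ.normed volume (x - t) = _
    congr 1; ext t
    by_cases ht : t ∈ U <;> simp [ht, φ]
  rw [h2, h8, ← neg_eq_iff_eq_neg.2 h7, ← integral_neg, ← integral_indicator hU]
  congr 1; ext t
  by_cases ht : t ∈ U
  · simp [ht, hφd]
  · simp [ht]

section ChangeOfVariables

variable {V : Set E} {Ξ : E → E} {c : ℝ}

/-- A lower bound for the Jacobian makes composition with Ξ a bounded operation in L¹; this carries
the convergence of mollifications from the image back to V. -/
theorem lintegral_comp_le_of_det (hV : IsOpen V) (hΞ : ContDiff ℝ 1 Ξ) (hinj : Set.InjOn Ξ V)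
    (hc : 0 < c) (hdet : ∀ x ∈ V, c ≤ |(fderiv ℝ Ξ x).det|) (F : E → ENNReal) :
    ∫⁻ x in V, F (Ξ x) ≤ (ENNReal.ofReal c)⁻¹ * ∫⁻ x in Ξ '' V, F x := by
  have hd : ∀ x ∈ V, HasFDerivWithinAt Ξ (fderiv ℝ Ξ x) V x := fun x _ =>
    (hΞ.differentiable one_ne_zero x).hasFDerivAt.hasFDerivWithinAt
  rw [lintegral_image_eq_lintegral_abs_det_fderiv_mul volume hV.measurableSet hd hinj,
    ← lintegral_const_mul' _ _ (ENNReal.inv_ne_top.2 (ENNReal.ofReal_pos.2 hc).ne')]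
  refine setLIntegral_mono' hV.measurableSet fun x hx => ?_
  rw [← mul_assoc]
  have h1 : (1 : ENNReal) ≤ (ENNReal.ofReal c)⁻¹ * ENNReal.ofReal |(fderiv ℝ Ξ x).det| := by
    rw [← ENNReal.inv_mul_cancel (ENNReal.ofReal_pos.2 hc).ne' ENNReal.ofReal_ne_top]
    gcongr
    exact hdet x hx
  calc F (Ξ x) = 1 * F (Ξ x) := (one_mul _).symm
    _ ≤ _ := by gcongr

theorem integrableOn_comp_of_det (hV : IsOpen V) (hΞ : ContDiff ℝ 1 Ξ) (hinj : Set.InjOn Ξ V)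
    (hc : 0 < c) (hdet : ∀ x ∈ V, c ≤ |(fderiv ℝ Ξ x).det|) {f : E → ℝ}
    (hf : IntegrableOn f (Ξ '' V)) : IntegrableOn (fun x => f (Ξ x)) V := by
  have hd : ∀ x ∈ V, HasFDerivWithinAt Ξ (fderiv ℝ Ξ x) V x := fun x _ =>
    (hΞ.differentiable one_ne_zero x).hasFDerivAt.hasFDerivWithinAt
  have h1 := (integrableOn_image_iff_integrableOn_abs_det_fderiv_smul volume hV.measurableSet
    hd hinj f).1 hf
  have hcont : Continuous fun x => |(fderiv ℝ Ξ x).det| :=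
    (ContinuousLinearMap.continuous_det.comp (hΞ.continuous_fderiv one_ne_zero)).abs
  have h2 : Integrable (fun x => (|(fderiv ℝ Ξ x).det|)⁻¹ * (|(fderiv ℝ Ξ x).det| * f (Ξ x)))
      (volume.restrict V) := by
    refine Integrable.bdd_mul (c := c⁻¹) h1 hcont.measurable.inv.aestronglyMeasurable ?_
    filter_upwards [ae_restrict_mem hV.measurableSet] with x hx
    rw [norm_inv, Real.norm_eq_abs, abs_abs]
    exact inv_anti₀ hc (hdet x hx)
  refine h2.congr ?_
  filter_upwards [ae_restrict_mem hV.measurableSet] with x hx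
  have : |(fderiv ℝ Ξ x).det| ≠ 0 := (hc.trans_le (hdet x hx)).ne'
  field_simp

/-- Convergence of the mollifications under a change of variables. -/
theorem tendsto_integral_mollify_comp_mul (hV : IsOpen V) (hΞ : ContDiff ℝ 1 Ξ)
    (hinj : Set.InjOn Ξ V) (hU : MeasurableSet (Ξ '' V)) (hc : 0 < c)
    (hdet : ∀ x ∈ V, c ≤ |(fderiv ℝ Ξ x).det|)
    {f : E → ℝ} (hf : IntegrableOn f (Ξ '' V)) {B : E → ℝ} (hB : Continuous B) {M : ℝ}
    (hM : ∀ x, ‖B x‖ ≤ M) {ρ : ℕ → ContDiffBump (0 : E)}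
    (hρ : Tendsto (fun n => (ρ n).rOut) atTop (𝓝 0)) :
    Tendsto (fun n => ∫ x in V, mollify (ρ n) ((Ξ '' V).indicator f) (Ξ x) * B x) atTop
      (𝓝 (∫ x in V, f (Ξ x) * B x)) := by
  set F := (Ξ '' V).indicator f with hF
  have hFi : Integrable F volume := (integrable_indicator_iff hU).2 hf
  have hL1 : Tendsto (fun n => ∫⁻ x, ‖mollify (ρ n) F x - F x‖ₑ) atTop (𝓝 0) := by
    rw [ENNReal.tendsto_nhds_zero]
    intro ε hε
    have h1 := (ENNReal.tendsto_nhds_zero.1 (tendsto_lintegral_translate_sub hFi)) ε hε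
    obtain ⟨δ, hδ, hball⟩ := Metric.eventually_nhds_iff_ball.1 h1
    filter_upwards [hρ.eventually (gt_mem_nhds hδ)] with n hn
    exact lintegral_mollify_sub_le (ρ n) hFi fun t ht =>
      hball t (mem_ball_zero_iff.2 (ht.trans_lt hn))
  have i1 : IntegrableOn (fun x => f (Ξ x) * B x) V :=
    (integrableOn_comp_of_det hV hΞ hinj hc hdet hf).mul_bdd (c := M)
      hB.aestronglyMeasurable (ae_of_all _ hM)
  have i2 : ∀ n, IntegrableOn (fun x => mollify (ρ n) F (Ξ x) * B x) V := by
    intro n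
    have h3 : Integrable (mollify (ρ n) F) volume :=
      hFi.integrable_convolution _ (ρ n).integrable_normed
    exact (integrableOn_comp_of_det hV hΞ hinj hc hdet h3.integrableOn).mul_bdd (c := M)
      hB.aestronglyMeasurable (ae_of_all _ hM)
  rw [← tendsto_sub_nhds_zero_iff]
  refine tendsto_zero_of_enorm_le (b := fun n => ENNReal.ofReal M *
    ((ENNReal.ofReal c)⁻¹ * ∫⁻ x, ‖mollify (ρ n) F x - F x‖ₑ))
    (Eventually.of_forall fun n => ?_) ?_
  · rw [← integral_sub (i2 n) i1]
    refine (enorm_integral_le_lintegral_enorm _).trans ?_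
    have h4 : ∀ x ∈ V, ‖mollify (ρ n) F (Ξ x) * B x - f (Ξ x) * B x‖ₑ ≤
        ENNReal.ofReal M * ‖mollify (ρ n) F (Ξ x) - F (Ξ x)‖ₑ := by
      intro x hx
      have : F (Ξ x) = f (Ξ x) := Set.indicator_of_mem (Set.mem_image_of_mem _ hx) _
      rw [this, ← sub_mul, enorm_mul, mul_comm]
      gcongr
      rw [← ofReal_norm]
      exact ENNReal.ofReal_le_ofReal (hM x)
    refine (setLIntegral_mono' hV.measurableSet h4).trans ?_
    rw [lintegral_const_mul' _ _ ENNReal.ofReal_ne_top]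
    gcongr
    refine (lintegral_comp_le_of_det hV hΞ hinj hc hdet
      (fun z => ‖mollify (ρ n) F z - F z‖ₑ)).trans ?_
    gcongr
    exact Measure.restrict_le_self
  · have h5 := ENNReal.Tendsto.const_mul (a := (ENNReal.ofReal c)⁻¹) hL1
      (Or.inr (ENNReal.inv_ne_top.2 (ENNReal.ofReal_pos.2 hc).ne'))
    have h6 := ENNReal.Tendsto.const_mul (a := ENNReal.ofReal M) h5
      (Or.inr ENNReal.ofReal_ne_top)
    simpa using h6

/-- Chain rule for weakly differentiable functions under a `C¹` diffeomorphism, tested with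
`C¹` functions of compact support. The family `co` gives the coordinates in the basis `b`. -/
theorem integral_comp_mul_fderiv_eq {d : ℕ} {b : Fin d → E} {co : Fin d → E →L[ℝ] ℝ}
    (hco : ∀ v, v = ∑ i, co i v • b i)
    (hV : IsOpen V) (hΞ : ContDiff ℝ 1 Ξ)
    (hinj : Set.InjOn Ξ V) (hU : IsOpen (Ξ '' V)) (hc : 0 < c)
    (hdet : ∀ x ∈ V, c ≤ |(fderiv ℝ Ξ x).det|)
    {u : E → ℝ} {g : E → Fin d → ℝ} (hu : IntegrableOn u (Ξ '' V))
    (hg : ∀ i, IntegrableOn (fun x => g x i) (Ξ '' V))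
    (hw : ∀ i, IsWeakDeriv (Ξ '' V) (b i) u (fun x => g x i))
    {Φ : E → ℝ} (hΦ : ContDiff ℝ 1 Φ) (hΦc : HasCompactSupport Φ) (hΦV : tsupport Φ ⊆ V)
    (e : E) :
    ∫ x in V, u (Ξ x) * fderiv ℝ Φ x e =
      - ∫ x in V, (∑ i, g (Ξ x) i * co i (fderiv ℝ Ξ x e)) * Φ x := by
  set U := Ξ '' V with hUdef
  have hK : IsCompact (Ξ '' tsupport Φ) := hΦc.isCompact.image hΞ.continuous
  -- The diffeomorphism is only C¹, so Φ cannot be moved to the image as a smooth test function; `u`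
  -- is mollified on the image instead. Within distance δ of the image of the support of Φ one stays
  -- in U, so radii up to δ are harmless.
  obtain ⟨δ, hδ, hδU⟩ := hK.exists_cthickening_subset_open hU (Set.image_mono hΦV)
  let ρ : ℕ → ContDiffBump (0 : E) := fun n =>
    ⟨δ / (n + 2) / 2, δ / (n + 2), by positivity, by
      have : 0 < δ / (n + 2) := by positivity
      linarith⟩
  have hρ : Tendsto (fun n => (ρ n).rOut) atTop (𝓝 0) := by
    have := (tendsto_const_div_atTop_nhds_zero_nat δ).comp (tendsto_add_atTop_nat 2)
    refine this.congr fun n => ?_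
    simp [ρ]
  have hρδ : ∀ n, (ρ n).rOut ≤ δ := fun n =>
    div_le_self hδ.le (by have : (0:ℝ) ≤ n := n.cast_nonneg; linarith)
  have hdΦ : Continuous fun x => fderiv ℝ Φ x e :=
    (hΦ.continuous_fderiv one_ne_zero).clm_apply continuous_const
  have hdΦc : HasCompactSupport fun x => fderiv ℝ Φ x e := hΦc.fderiv_apply ℝ e
  have hdΞ : ∀ i, Continuous fun x => co i (fderiv ℝ Ξ x e) * Φ x := fun i =>
    ((co i).continuous.comp ((hΞ.continuous_fderiv one_ne_zero).clm_apply
      continuous_const)).mul hΦ.continuous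
  have hdΞc : ∀ i, HasCompactSupport fun x => co i (fderiv ℝ Ξ x e) * Φ x := fun i =>
    hΦc.mul_left
  obtain ⟨M, hM⟩ := hdΦc.exists_bound_of_continuous hdΦ
  choose N hN using fun i => (hdΞc i).exists_bound_of_continuous (hdΞ i)
  have lim1 := tendsto_integral_mollify_comp_mul hV hΞ hinj hU.measurableSet hc hdet hu hdΦ
    hM hρ
  have lim2 := fun i => tendsto_integral_mollify_comp_mul hV hΞ hinj hU.measurableSet hc hdet
    (hg i) (hdΞ i) (hN i) hρ
  have lim3 := (tendsto_finsetSum Finset.univ fun i _ => lim2 i).neg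
  have key : ∀ n, ∫ x in V, mollify (ρ n) (U.indicator u) (Ξ x) * fderiv ℝ Φ x e =
      - ∑ i, ∫ x in V, mollify (ρ n) (U.indicator fun z => g z i) (Ξ x) *
        (co i (fderiv ℝ Ξ x e) * Φ x) := by
    intro n
    have hui : Integrable (U.indicator u) volume := (integrable_indicator_iff hU.measurableSet).2 hu
    have hgi : ∀ i, Integrable (U.indicator fun z => g z i) volume := fun i =>
      (integrable_indicator_iff hU.measurableSet).2 (hg i)
    have hm := contDiff_mollify (ρ n) hui
    have hmg := fun i => contDiff_mollify (ρ n) (hgi i)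
    set w := fun x => mollify (ρ n) (U.indicator u) (Ξ x) with hw_def
    have hwC : ContDiff ℝ 1 w := hm.comp hΞ
    have hzero : ∀ x ∉ V, Φ x = 0 := fun x hx =>
      image_eq_zero_of_notMem_tsupport fun h => hx (hΦV h)
    have hzero' : ∀ x ∉ V, fderiv ℝ Φ x e = 0 := fun x hx => by
      rw [fderiv_of_notMem_tsupport (𝕜 := ℝ) (fun h => hx (hΦV h))]; simp
    -- On the support of Φ this is the classical chain rule for the mollified function, whose
    -- derivatives there are the mollified weak derivatives. Elsewhere both sides are zero.
    have hdw : ∀ x, fderiv ℝ w x e * Φ x =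
        ∑ i, mollify (ρ n) (U.indicator fun z => g z i) (Ξ x) *
          (co i (fderiv ℝ Ξ x e) * Φ x) := by
      intro x
      by_cases hx : x ∈ tsupport Φ
      · have h1 : Metric.closedBall (Ξ x) (ρ n).rOut ⊆ U := by
          refine (Metric.closedBall_subset_closedBall (hρδ n)).trans (subset_trans ?_ hδU)
          exact Metric.closedBall_subset_cthickening (Set.mem_image_of_mem _ hx) δ
        have h2 : fderiv ℝ w x = (fderiv ℝ (mollify (ρ n) (U.indicator u)) (Ξ x)).comp
            (fderiv ℝ Ξ x) :=
          fderiv_comp x (hm.differentiable one_ne_zero _) (hΞ.differentiable one_ne_zero _)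
        rw [h2, ContinuousLinearMap.comp_apply]
        conv_lhs => rw [hco (fderiv ℝ Ξ x e)]
        rw [map_sum, Finset.sum_mul]
        refine Finset.sum_congr rfl fun i _ => ?_
        rw [map_smul, fderiv_mollify_indicator hU.measurableSet hu (hw i) (ρ n) h1, smul_eq_mul]
        ring
      · simp [image_eq_zero_of_notMem_tsupport hx]
    have hwc : Continuous w := hwC.continuous
    have hdwc : Continuous fun x => fderiv ℝ w x e :=
      (hwC.continuous_fderiv one_ne_zero).clm_apply continuous_const
    have h3 : ∫ x, w x * fderiv ℝ Φ x e = - ∫ x, fderiv ℝ w x e * Φ x := by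
      refine integral_mul_fderiv_eq_neg_fderiv_mul_of_integrable ?_ ?_ ?_ ?_ ?_
      · exact (hdwc.mul hΦ.continuous).integrable_of_hasCompactSupport hΦc.mul_left
      · exact (hwc.mul hdΦ).integrable_of_hasCompactSupport hdΦc.mul_left
      · exact (hwc.mul hΦ.continuous).integrable_of_hasCompactSupport hΦc.mul_left
      · exact fun x _ => hwC.differentiable one_ne_zero x
      · exact fun x _ => hΦ.differentiable one_ne_zero x
    rw [setIntegral_eq_integral_of_forall_compl_eq_zero
      (fun x hx => by rw [hzero' x hx, mul_zero]), h3]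
    simp_rw [hdw]
    rw [integral_finsetSum]
    · congr 1
      refine Finset.sum_congr rfl fun i _ => ?_
      rw [setIntegral_eq_integral_of_forall_compl_eq_zero
        (fun x hx => by rw [hzero x hx, mul_zero, mul_zero])]
    · intro i _
      exact (((hmg i).continuous.comp hΞ.continuous).mul
        (hdΞ i)).integrable_of_hasCompactSupport (hdΞc i).mul_left
  have h4 := tendsto_nhds_unique (lim1.congr key) lim3
  rw [h4, ← integral_finsetSum]
  · congr 2; ext x
    rw [Finset.sum_mul]
    exact Finset.sum_congr rfl fun i _ => by ring
  · intro i _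
    exact (integrableOn_comp_of_det hV hΞ hinj hc hdet (hg i)).mul_bdd (c := N i)
      (hdΞ i).aestronglyMeasurable (ae_of_all _ (hN i))

end ChangeOfVariables

end ChainRule

end WrinkledPlate

namespace WrinkledPlate

/-! ### Geometry of the wrinkled plate -/

theorem isOpen_image_of_det_ne_zero {E : Type*} [NormedAddCommGroup E] [NormedSpace ℝ E]
    [FiniteDimensional ℝ E] {V : Set E} (hV : IsOpen V) {Ξ : E → E} (hΞ : ContDiff ℝ 1 Ξ)
    (hdet : ∀ x ∈ V, (fderiv ℝ Ξ x).det ≠ 0) : IsOpen (Ξ '' V) := by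
  have : CompleteSpace E := FiniteDimensional.complete ℝ E
  rw [isOpen_iff_mem_nhds]
  rintro _ ⟨x, hx, rfl⟩
  have h1 : HasStrictFDerivAt Ξ (fderiv ℝ Ξ x) x := hΞ.contDiffAt.hasStrictFDerivAt one_ne_zero
  have h2 : HasStrictFDerivAt Ξ
      (((fderiv ℝ Ξ x).toContinuousLinearEquivOfDetNeZero (hdet x hx) : E ≃L[ℝ] E) : E →L[ℝ] E) x :=
    by simpa using h1
  rw [← h2.map_nhds_eq_of_equiv]
  exact image_mem_map (hV.mem_nhds hx)

theorem det_ne_zero_of_injective {E : Type*} [NormedAddCommGroup E] [NormedSpace ℝ E]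
    [FiniteDimensional ℝ E] (A : E →L[ℝ] E) (hA : ∀ v, A v = 0 → v = 0) : A.det ≠ 0 := by
  intro h0
  have h1 := LinearMap.bot_lt_ker_of_det_eq_zero (f := (A : E →ₗ[ℝ] E)) h0
  obtain ⟨v, hv, hv0⟩ := (Submodule.ne_bot_iff _).1 h1.ne'
  exact hv0 (hA v (LinearMap.mem_ker.1 hv))

theorem eq_zero_of_norm_sub_le {E : Type*} [NormedAddCommGroup E] [NormedSpace ℝ E]
    {A : E →L[ℝ] E} (hA : ‖A - ContinuousLinearMap.id ℝ E‖ ≤ 1 / 2) {v : E} (hv : A v = 0) :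
    v = 0 := by
  have h1 := (A - ContinuousLinearMap.id ℝ E).le_of_opNorm_le hA v
  simp only [sub_apply, hv, ContinuousLinearMap.id_apply, zero_sub,
    norm_neg] at h1
  have := norm_nonneg v
  exact norm_eq_zero.1 (by linarith)

/-- The closed ball of radius 1/2 about the identity is compact and consists of injective maps, so
|det| has a positive minimum on it. This bounds the Jacobian of Θ without computing it. -/
theorem exists_det_lower_bound (E : Type*) [NormedAddCommGroup E] [NormedSpace ℝ E]
    [FiniteDimensional ℝ E] : ∃ c : ℝ, 0 < c ∧
      ∀ A : E →L[ℝ] E, ‖A - ContinuousLinearMap.id ℝ E‖ ≤ 1 / 2 → c ≤ |A.det| := by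
  have : ProperSpace (E →L[ℝ] E) := FiniteDimensional.proper ℝ _
  have hK : IsCompact (Metric.closedBall (ContinuousLinearMap.id ℝ E) (1 / 2)) :=
    isCompact_closedBall _ _
  obtain ⟨A₀, hA₀, hmin⟩ := hK.exists_isMinOn (f := fun A : E →L[ℝ] E => |A.det|)
    ⟨_, Metric.mem_closedBall_self (by norm_num)⟩ ContinuousLinearMap.continuous_det.abs.continuousOn
  refine ⟨|A₀.det|, abs_pos.2 (det_ne_zero_of_injective A₀ fun v hv => ?_), fun A hA => ?_⟩
  · exact eq_zero_of_norm_sub_le (mem_closedBall_iff_norm.1 hA₀) hv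
  · exact hmin (mem_closedBall_iff_norm.2 hA)

/-- The unit normal to a graph with gradient `p`. -/
noncomputable def graphNormal (p : R2) : R3 :=
  (Real.sqrt (p 0 ^ 2 + p 1 ^ 2 + 1))⁻¹ • ((-p, 1) : R3)

theorem contDiff_graphNormal : ContDiff ℝ 1 graphNormal := by
  have h1 : ContDiff ℝ 1 fun p : R2 => p 0 ^ 2 + p 1 ^ 2 + 1 := by fun_prop
  have h2 : ∀ p : R2, p 0 ^ 2 + p 1 ^ 2 + 1 ≠ 0 := fun p => by positivity
  exact ((h1.sqrt h2).inv fun p => (Real.sqrt_pos.2 (by positivity)).ne').smul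
    (contDiff_neg.prodMk contDiff_const)

/-- The gradient of a function on the plane. -/
noncomputable def grad2 (θ : R2 → ℝ) (z : R2) : R2 := fun α => fderiv ℝ θ z (e2 α)

variable {θ : R2 → ℝ}

theorem contDiff_grad2 (hθ : ContDiff ℝ 2 θ) : ContDiff ℝ 1 (grad2 θ) :=
  contDiff_pi.2 fun _ => (hθ.fderiv_right (by norm_num)).clm_apply contDiff_const

/-- Factors the normal through one fixed smooth map, applied to h∇θ(x'/h). All dependence on h then
sits in a periodic argument, which makes uniform bounds available. -/
theorem normal_eq (θ : R2 → ℝ) (h : ℝ) (x : R2) :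
    normal θ h x = graphNormal (h • grad2 θ (h⁻¹ • x)) := by
  simp only [normal, graphNormal, grad2, dθ, Pi.smul_apply, smul_eq_mul, mul_pow]
  congr 2
  ext α
  simp [grad2]

theorem contDiff_normal (hθ : ContDiff ℝ 2 θ) (h : ℝ) : ContDiff ℝ 1 (normal θ h) := by
  have : normal θ h = fun x => graphNormal (h • grad2 θ (h⁻¹ • x)) := funext (normal_eq θ h)
  rw [this]
  exact contDiff_graphNormal.comp (((contDiff_grad2 hθ).comp (contDiff_id.const_smul _)).const_smul _)

theorem norm_e2 (β : Fin 2) : ‖e2 β‖ ≤ 1 := by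
  refine (pi_norm_le_iff_of_nonneg zero_le_one).2 fun i => ?_
  by_cases hi : i = β
  · subst hi; simp [e2]
  · simp [e2, hi]

theorem fderiv_periodic {F : Type*} [NormedAddCommGroup F] [NormedSpace ℝ F] {f : R2 → F}
    {e : R2} (hf : ∀ x, f (x + e) = f x) (x : R2) : fderiv ℝ f (x + e) = fderiv ℝ f x := by
  rw [← fderiv_comp_add_right]
  congr 1
  exact funext hf

/-- Uniform bounds for the geometry of the mid-surface. -/
theorem exists_geometry_bound (hθ : ContDiff ℝ 2 θ) (hper : IsYPeriodic θ) :
    ∃ M : ℝ, 0 ≤ M ∧ (∀ z, |θ z| ≤ M) ∧ (∀ z, ‖fderiv ℝ θ z‖ ≤ M) ∧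
      ∀ h : ℝ, 0 < h → h ≤ 1 → ∀ x,
        ‖fderiv ℝ (normal θ h) x‖ ≤ M ∧ ‖normal θ h x - (0, 1)‖ ≤ M * h := by
  have hθ1 : ContDiff ℝ 1 θ := hθ.of_le (by norm_num)
  have hg := contDiff_grad2 hθ
  have hgp : ∀ (i : Fin 2) x, grad2 θ (x + e2 i) = grad2 θ x := fun i x => by
    ext α; simp only [grad2, fderiv_periodic (hper i)]
  obtain ⟨M₀, hM₀⟩ := hper.bounded hθ.continuous
  obtain ⟨M₁, hM₁⟩ := IsYPeriodic.bounded (g := fun z => ‖fderiv ℝ θ z‖)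
    (fun i x => by simp only [fderiv_periodic (hper i)])
    (hθ1.continuous_fderiv one_ne_zero).norm
  obtain ⟨M₂, hM₂⟩ := IsYPeriodic.bounded (g := fun z => ‖grad2 θ z‖)
    (fun i x => by simp only [hgp]) hg.continuous.norm
  obtain ⟨M₃, hM₃⟩ := IsYPeriodic.bounded (g := fun z => ‖fderiv ℝ (grad2 θ) z‖)
    (fun i x => by simp only [fderiv_periodic (hgp i)])
    (hg.continuous_fderiv one_ne_zero).norm
  simp only [abs_norm] at hM₁ hM₂ hM₃
  -- For h ≤ 1 the argument h∇θ(x'/h) stays in this ball, so L bounds the derivative of the fixed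
  -- map wherever it is needed.
  obtain ⟨L, hL⟩ := (isCompact_closedBall (0 : R2) M₂).exists_bound_of_continuousOn
    (contDiff_graphNormal.continuous_fderiv one_ne_zero).continuousOn
  have h0 : 0 ≤ M₂ := (norm_nonneg _).trans (hM₂ 0)
  have hL0 : 0 ≤ L := (norm_nonneg _).trans (hL 0 (Metric.mem_closedBall_self h0))
  have hM₀0 : 0 ≤ M₀ := (abs_nonneg _).trans (hM₀ 0)
  have hM₁0 : 0 ≤ M₁ := (norm_nonneg _).trans (hM₁ 0)
  have hM₃0 : 0 ≤ M₃ := (norm_nonneg _).trans (hM₃ 0)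
  refine ⟨M₀ + M₁ + L * M₃ + L * M₂, by positivity, fun z => ?_, fun z => ?_,
    fun h hh h1 x => ⟨?_, ?_⟩⟩
  · refine (hM₀ z).trans ?_
    nlinarith [mul_nonneg hL0 hM₃0, mul_nonneg hL0 h0]
  · refine (hM₁ z).trans ?_
    nlinarith [mul_nonneg hL0 hM₃0, mul_nonneg hL0 h0]
  all_goals
    have hball : h • grad2 θ (h⁻¹ • x) ∈ Metric.closedBall (0 : R2) M₂ := by
      rw [mem_closedBall_zero_iff, norm_smul, Real.norm_of_nonneg hh.le]
      nlinarith [hM₂ (h⁻¹ • x), norm_nonneg (grad2 θ (h⁻¹ • x))]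
  · have e1 : normal θ h = fun x => graphNormal (h • grad2 θ (h⁻¹ • x)) := funext (normal_eq θ h)
    have d1 : HasFDerivAt (fun x : R2 => h⁻¹ • x) (h⁻¹ • ContinuousLinearMap.id ℝ R2) x :=
      (hasFDerivAt_id x).const_smul h⁻¹
    have d2 := (((hg.differentiable one_ne_zero (h⁻¹ • x)).hasFDerivAt.comp x d1).const_smul h)
    have d3 := ((contDiff_graphNormal.differentiable one_ne_zero
      (h • grad2 θ (h⁻¹ • x))).hasFDerivAt).comp x d2
    -- The factor h of the scaled gradient cancels the h⁻¹ from differentiating x'/h: the normal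
    -- varies at rate O(1), although it deviates from e₃ only by O(h).
    have d5 : fderiv ℝ (normal θ h) x =
        (fderiv ℝ graphNormal (h • grad2 θ (h⁻¹ • x))).comp (fderiv ℝ (grad2 θ) (h⁻¹ • x)) := by
      rw [e1]
      refine d3.fderiv.trans ?_
      ext1 v
      simp [smul_smul, mul_inv_cancel₀ hh.ne']
    rw [d5]
    refine (ContinuousLinearMap.opNorm_comp_le _ _).trans ?_
    have : ‖fderiv ℝ graphNormal (h • grad2 θ (h⁻¹ • x))‖ * ‖fderiv ℝ (grad2 θ) (h⁻¹ • x)‖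
        ≤ L * M₃ := mul_le_mul (hL _ hball) (hM₃ _) (norm_nonneg _) hL0
    nlinarith [mul_nonneg hL0 h0]
  · rw [normal_eq]
    have e0 : graphNormal 0 = (0, 1) := by simp [graphNormal]
    rw [← e0]
    have := (convex_closedBall (0 : R2) M₂).norm_image_sub_le_of_norm_fderiv_le (𝕜 := ℝ)
      (fun z _ => contDiff_graphNormal.differentiable one_ne_zero z) hL
      (Metric.mem_closedBall_self h0) hball
    refine this.trans ?_
    rw [sub_zero, norm_smul, Real.norm_of_nonneg hh.le]
    have h2 : L * (h * ‖grad2 θ (h⁻¹ • x)‖) ≤ L * M₂ * h := by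
      have := mul_le_mul_of_nonneg_left (hM₂ (h⁻¹ • x)) (mul_nonneg hL0 hh.le)
      nlinarith
    nlinarith [mul_nonneg (mul_nonneg hL0 hM₃0) hh.le, mul_nonneg hM₀0 hh.le,
      mul_nonneg hM₁0 hh.le]

theorem contDiff_Theta (hθ : ContDiff ℝ 2 θ) (h : ℝ) : ContDiff ℝ 1 (Θ θ h) := by
  have hθ1 : ContDiff ℝ 1 θ := hθ.of_le (by norm_num)
  have h1 : ContDiff ℝ 1 fun x : R3 => θ (h⁻¹ • x.1) := hθ1.comp (contDiff_fst.const_smul h⁻¹)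
  have h2 : ContDiff ℝ 1 fun x : R3 => normal θ h x.1 := (contDiff_normal hθ h).comp contDiff_fst
  exact (contDiff_fst.prodMk (contDiff_const.mul h1)).add (contDiff_snd.smul h2)

theorem fderiv_Theta_apply (hθ : ContDiff ℝ 2 θ) {h : ℝ} (hh : h ≠ 0) (x v : R3) :
    fderiv ℝ (Θ θ h) x v = ((v.1, h * fderiv ℝ θ (h⁻¹ • x.1) v.1) : R3) +
      (x.2 • fderiv ℝ (normal θ h) x.1 v.1 + v.2 • normal θ h x.1) := by
  have hθ1 : ContDiff ℝ 1 θ := hθ.of_le (by norm_num)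
  have d1 : HasFDerivAt (fun x : R3 => h⁻¹ • x.1) (h⁻¹ • ContinuousLinearMap.fst ℝ R2 ℝ) x :=
    hasFDerivAt_fst.const_smul h⁻¹
  have d2 := ((hθ1.differentiable one_ne_zero (h⁻¹ • x.1)).hasFDerivAt.comp x d1).const_mul (h ^ 2)
  have d3 : HasFDerivAt (fun x : R3 => normal θ h x.1) _ x :=
    ((contDiff_normal hθ h).differentiable one_ne_zero x.1).hasFDerivAt.comp x hasFDerivAt_fst
  have d4 : HasFDerivAt (fun x : R3 => x.2) (ContinuousLinearMap.snd ℝ R2 ℝ) x := hasFDerivAt_snd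
  have d5 := ((hasFDerivAt_fst (𝕜 := ℝ) (p := x)).prodMk d2).add (d4.smul d3)
  have d6 : fderiv ℝ (Θ θ h) x = _ := d5.fderiv
  rw [d6]
  have e : h ^ 2 * (h⁻¹ * fderiv ℝ θ (h⁻¹ • x.1) v.1) = h * fderiv ℝ θ (h⁻¹ • x.1) v.1 := by
    field_simp
  simp [e]

end WrinkledPlate

namespace WrinkledPlate

/-! ### The chain rule on the wrinkled plate -/

/-- The coordinates on `R3`. -/
noncomputable def co3 : Fin 3 → R3 →L[ℝ] ℝ :=
  ![(ContinuousLinearMap.proj 0).comp (ContinuousLinearMap.fst ℝ R2 ℝ),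
    (ContinuousLinearMap.proj 1).comp (ContinuousLinearMap.fst ℝ R2 ℝ),
    ContinuousLinearMap.snd ℝ R2 ℝ]

theorem eq_sum_co3 (v : R3) : v = ∑ i, co3 i v • e3 i := by
  rw [Fin.sum_univ_three]
  simp only [co3, e3, e2]
  ext i
  · fin_cases i <;> simp
  · simp

theorem abs_co3_le (k : Fin 3) (v : R3) : |co3 k v| ≤ ‖v‖ := by
  have h1 : ∀ i, |v.1 i| ≤ ‖v‖ := fun i => (norm_le_pi_norm v.1 i).trans (norm_fst_le v)
  fin_cases k
  · exact h1 0
  · exact h1 1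
  · exact norm_snd_le v

/-- The horizontal tangent vector `∂_β (Θ^h ∘ P^h)`. -/
noncomputable def tangent (θ : R2 → ℝ) (h : ℝ) (β : Fin 2) (x : R3) : R3 :=
  (e2 β, h * dθ θ h β x.1) + (h ^ 2 * x.2) • fderiv ℝ (normal θ h) x.1 (e2 β)

/-- The rescaling as a continuous linear map. -/
noncomputable def Plin (h : ℝ) : R3 →L[ℝ] R3 :=
  (ContinuousLinearMap.fst ℝ R2 ℝ).prod ((h ^ 2) • ContinuousLinearMap.snd ℝ R2 ℝ)

theorem Plin_apply (h : ℝ) (x : R3) : Plin h x = P h x := by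
  simp [Plin, P]

variable {θ : R2 → ℝ}

theorem contDiff_Theta_P (hθ : ContDiff ℝ 2 θ) (h : ℝ) :
    ContDiff ℝ 1 fun x => Θ θ h (P h x) := by
  have : (fun x => Θ θ h (P h x)) = Θ θ h ∘ Plin h := by
    ext1 x; rw [Function.comp_apply, Plin_apply]
  rw [this]
  exact (contDiff_Theta hθ h).comp (Plin h).contDiff

theorem fderiv_Theta_P (hθ : ContDiff ℝ 2 θ) (h : ℝ) (x : R3) :
    fderiv ℝ (fun x => Θ θ h (P h x)) x = (fderiv ℝ (Θ θ h) (P h x)).comp (Plin h) := by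
  have : (fun x => Θ θ h (P h x)) = Θ θ h ∘ Plin h := by
    ext1 x; rw [Function.comp_apply, Plin_apply]
  rw [this, ← Plin_apply]
  exact (((contDiff_Theta hθ h).differentiable one_ne_zero _).hasFDerivAt.comp x
    (Plin h).hasFDerivAt).fderiv

theorem fderiv_Theta_P_horizontal (hθ : ContDiff ℝ 2 θ) {h : ℝ} (hh : h ≠ 0) (β : Fin 2)
    (x : R3) : fderiv ℝ (fun x => Θ θ h (P h x)) x (e2 β, 0) = tangent θ h β x := by
  rw [fderiv_Theta_P hθ, ContinuousLinearMap.comp_apply, Plin_apply, fderiv_Theta_apply hθ hh]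
  simp [P, tangent, dθ]

theorem fderiv_Theta_P_vertical (hθ : ContDiff ℝ 2 θ) {h : ℝ} (hh : h ≠ 0) (x : R3) :
    fderiv ℝ (fun x => Θ θ h (P h x)) x (0, 1) = h ^ 2 • normal θ h x.1 := by
  rw [fderiv_Theta_P hθ, ContinuousLinearMap.comp_apply, Plin_apply, fderiv_Theta_apply hθ hh]
  simp [P]

/-- Three contributions of size M h each: the slope of the mid-surface, the curvature term x₃∇n with
|x₃| ≤ h² ≤ h, and the tilt of the normal. -/
theorem norm_fderiv_Theta_sub_id_le (hθ : ContDiff ℝ 2 θ) {h M : ℝ} (hh : 0 < h) (h1 : h ≤ 1)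
    (hM : 0 ≤ M) (hMθ : ∀ z, ‖fderiv ℝ θ z‖ ≤ M)
    (hMn : ∀ x, ‖fderiv ℝ (normal θ h) x‖ ≤ M ∧ ‖normal θ h x - (0, 1)‖ ≤ M * h)
    {x : R3} (hx : |x.2| ≤ h ^ 2) :
    ‖fderiv ℝ (Θ θ h) x - ContinuousLinearMap.id ℝ R3‖ ≤ 3 * M * h := by
  refine ContinuousLinearMap.opNorm_le_bound _ (by positivity) fun v => ?_
  have e : (fderiv ℝ (Θ θ h) x - ContinuousLinearMap.id ℝ R3) v =
      ((0, h * fderiv ℝ θ (h⁻¹ • x.1) v.1) : R3) + x.2 • fderiv ℝ (normal θ h) x.1 v.1 +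
        v.2 • (normal θ h x.1 - (0, 1)) := by
    rw [sub_apply, fderiv_Theta_apply hθ hh.ne']
    ext i
    · simp
    · simp; ring
  rw [e]
  have hv1 := norm_fst_le v
  have hv2 := norm_snd_le v
  have hv0 := norm_nonneg v
  have a1 : ‖((0, h * fderiv ℝ θ (h⁻¹ • x.1) v.1) : R3)‖ ≤ M * h * ‖v‖ := by
    rw [Prod.norm_mk, norm_zero, max_eq_right (norm_nonneg _), norm_mul, Real.norm_of_nonneg hh.le]
    have := (fderiv ℝ θ (h⁻¹ • x.1)).le_of_opNorm_le (hMθ _) v.1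
    have h3 : M * ‖v.1‖ ≤ M * ‖v‖ := mul_le_mul_of_nonneg_left hv1 hM
    calc _ ≤ h * (M * ‖v‖) := mul_le_mul_of_nonneg_left (this.trans h3) hh.le
      _ = _ := by ring
  have a2 : ‖x.2 • fderiv ℝ (normal θ h) x.1 v.1‖ ≤ M * h * ‖v‖ := by
    rw [norm_smul]
    have := (fderiv ℝ (normal θ h) x.1).le_of_opNorm_le (hMn x.1).1 v.1
    have h3 : M * ‖v.1‖ ≤ M * ‖v‖ := mul_le_mul_of_nonneg_left hv1 hM
    have h4 : ‖x.2‖ ≤ h := hx.trans (by nlinarith)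
    calc _ ≤ h * (M * ‖v‖) := mul_le_mul h4 (this.trans h3) (norm_nonneg _) hh.le
      _ = _ := by ring
  have a3 : ‖v.2 • (normal θ h x.1 - (0, 1))‖ ≤ M * h * ‖v‖ := by
    rw [norm_smul]
    calc _ ≤ ‖v‖ * (M * h) := mul_le_mul hv2 (hMn x.1).2 (norm_nonneg _) hv0
      _ = _ := by ring
  calc _ ≤ M * h * ‖v‖ + M * h * ‖v‖ + M * h * ‖v‖ :=
        (norm_add_le _ _).trans (add_le_add ((norm_add_le _ _).trans (add_le_add a1 a2)) a3)
    _ = _ := by ring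

theorem isOpen_plate {ω : Set R2} (hω : IsOpen ω) (h : ℝ) : IsOpen (plate ω h) :=
  hω.prod isOpen_Ioo

theorem image_plate₁ {ω : Set R2} {h : ℝ} (hh : 0 < h) :
    (fun x => Θ θ h (P h x)) '' plate₁ ω = wrinkledPlate ω θ h := by
  have : P h '' plate₁ ω = plate ω h := by
    have h2 : 0 < h ^ 2 := by positivity
    ext x
    constructor
    · rintro ⟨z, ⟨hz1, hz2, hz3⟩, rfl⟩
      refine ⟨hz1, ?_, ?_⟩ <;> simp only [P] <;> nlinarith
    · rintro ⟨hx1, hx2, hx3⟩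
      refine ⟨(x.1, x.2 / h ^ 2), ⟨hx1, ?_, ?_⟩, ?_⟩
      · change -((1:ℝ) ^ 2 / 2) < x.2 / h ^ 2
        rw [lt_div_iff₀ h2]; linarith
      · change x.2 / h ^ 2 < (1:ℝ) ^ 2 / 2
        rw [div_lt_iff₀ h2]; linarith
      · simp only [P]
        rw [mul_div_cancel₀ _ h2.ne']
  rw [wrinkledPlate, ← this, Set.image_image]

theorem measure_wrinkledPlate_lt_top {ω : Set R2} (hω : Bornology.IsBounded ω)
    (hθ : ContDiff ℝ 2 θ) (h : ℝ) : volume (wrinkledPlate ω θ h) < ⊤ := by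
  have hb : Bornology.IsBounded (plate ω h) := hω.prod (Metric.isBounded_Ioo _ _)
  have hK : IsCompact (Θ θ h '' closure (plate ω h)) :=
    hb.isCompact_closure.image (contDiff_Theta hθ h).continuous
  exact (measure_mono (Set.image_mono subset_closure)).trans_lt hK.measure_lt_top

/-- Θ minus the identity is ½-Lipschitz on the slab |x₃| ≤ h², so Θ is injective there. The slab is
convex, whereas the plate over ω need not be. -/
theorem injOn_Theta_P {ω : Set R2} {h : ℝ} (hh : 0 < h) (hθ : ContDiff ℝ 2 θ)
    (hD : ∀ x : R3, |x.2| ≤ h ^ 2 →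
      ‖fderiv ℝ (Θ θ h) x - ContinuousLinearMap.id ℝ R3‖ ≤ 1 / 2) :
    Set.InjOn (fun x => Θ θ h (P h x)) (plate₁ ω) := by
  have h2 : 0 < h ^ 2 := by positivity
  let S : Set R3 := {x | |x.2| ≤ h ^ 2}
  have hS : Convex ℝ S := by
    have : S = (ContinuousLinearMap.snd ℝ R2 ℝ : R3 →ₗ[ℝ] ℝ) ⁻¹' Set.Icc (-h ^ 2) (h ^ 2) := by
      ext x; simp [S, abs_le]
    rw [this]
    exact (convex_Icc _ _).linear_preimage _
  have hinj : ∀ a ∈ S, ∀ b ∈ S, Θ θ h a = Θ θ h b → a = b := by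
    intro a ha b hb hab
    have h3 := hS.norm_image_sub_le_of_norm_hasFDerivWithin_le (f := fun x => Θ θ h x - x)
      (f' := fun x => fderiv ℝ (Θ θ h) x - ContinuousLinearMap.id ℝ R3) (C := 1 / 2)
      (fun x _ => (((contDiff_Theta hθ h).differentiable one_ne_zero x).hasFDerivAt.sub
        (hasFDerivAt_id x)).hasFDerivWithinAt) (fun x hx => hD x hx) hb ha
    rw [hab] at h3
    have h4 : Θ θ h b - a - (Θ θ h b - b) = -(a - b) := by abel
    rw [h4, norm_neg] at h3
    have := norm_nonneg (a - b)
    exact sub_eq_zero.1 (norm_eq_zero.1 (by linarith))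
  have hPS : ∀ x ∈ plate₁ ω, P h x ∈ S := by
    rintro x ⟨-, hx2, hx3⟩
    change |h ^ 2 * x.2| ≤ h ^ 2
    have h5 : |x.2| ≤ 1 := abs_le.2 ⟨by norm_num at hx2; linarith, by norm_num at hx3; linarith⟩
    rw [abs_mul, abs_of_pos h2]
    nlinarith
  intro a ha b hb hab
  have h6 := hinj _ (hPS a ha) _ (hPS b hb) hab
  simp only [P, Prod.mk.injEq] at h6
  exact Prod.ext h6.1 (mul_left_cancel₀ h2.ne' h6.2)

/-- The chain rule for the pulled back deformations, for small thickness. -/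
theorem exists_chain_rule {ω : Set R2} (hω : IsOpen ω) (hωb : Bornology.IsBounded ω)
    (hθ : ContDiff ℝ 2 θ) (hper : IsYPeriodic θ) :
    ∃ h₀ : ℝ, 0 < h₀ ∧ ∀ h, 0 < h → h < h₀ → ∀ (y : R3 → ℝ) (Dy : R3 → Fin 3 → ℝ),
      HasW12Grad e3 (wrinkledPlate ω θ h) y Dy →
      IntegrableOn (fun x => y (Θ θ h (P h x))) (plate₁ ω) ∧
      ∀ Φ : R3 → ℝ, ContDiff ℝ 1 Φ → HasCompactSupport Φ → tsupport Φ ⊆ plate₁ ω →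
        (∀ β, ∫ x in plate₁ ω, y (Θ θ h (P h x)) * fderiv ℝ Φ x (e2 β, 0) =
          - ∫ x in plate₁ ω, (∑ k, Dy (Θ θ h (P h x)) k * co3 k (tangent θ h β x)) * Φ x) ∧
        ∫ x in plate₁ ω, y (Θ θ h (P h x)) * fderiv ℝ Φ x (0, 1) =
          - ∫ x in plate₁ ω,
            (∑ k, Dy (Θ θ h (P h x)) k * co3 k (h ^ 2 • normal θ h x.1)) * Φ x := by
  obtain ⟨M, hM, -, hMθ, hMn⟩ := exists_geometry_bound hθ hper
  obtain ⟨c₀, hc₀, hdet₀⟩ := exists_det_lower_bound R3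
  -- Chosen so that 3Mh ≤ 1/2; the added 1 keeps the denominator positive when M = 0.
  refine ⟨min 1 (1 / (6 * M + 1)), by positivity, fun h hh hh0 y Dy hy => ?_⟩
  have h1 : h ≤ 1 := (hh0.trans_le (min_le_left _ _)).le
  have h2 : 3 * M * h ≤ 1 / 2 := by
    have h3 : h < 1 / (6 * M + 1) := hh0.trans_le (min_le_right _ _)
    rw [lt_div_iff₀ (by positivity)] at h3
    linarith
  have hD : ∀ x : R3, |x.2| ≤ h ^ 2 →
      ‖fderiv ℝ (Θ θ h) x - ContinuousLinearMap.id ℝ R3‖ ≤ 1 / 2 := fun x hx =>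
    (norm_fderiv_Theta_sub_id_le hθ hh h1 hM hMθ (hMn h hh h1) hx).trans h2
  have hinj := injOn_Theta_P (ω := ω) hh hθ hD
  have hV : IsOpen (plate₁ ω) := isOpen_plate hω 1
  have hPdet : (Plin h).det ≠ 0 := det_ne_zero_of_injective _ fun v hv => by
    rw [Plin_apply, P, Prod.mk_eq_zero] at hv
    exact Prod.ext hv.1 ((mul_eq_zero.1 hv.2).resolve_left (by positivity))
  -- The determinant of the rescaling degenerates as h tends to zero, but the chain rule is used for
  -- one h at a time and needs only a positive bound.
  have hdet : ∀ x ∈ plate₁ ω,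
      c₀ * |(Plin h).det| ≤ |(fderiv ℝ (fun x => Θ θ h (P h x)) x).det| := by
    rintro x ⟨-, hx2, hx3⟩
    have h5 : |x.2| ≤ 1 := abs_le.2 ⟨by norm_num at hx2; linarith, by norm_num at hx3; linarith⟩
    have h6 : |(P h x).2| ≤ h ^ 2 := by
      simp only [P]
      rw [abs_mul, abs_of_pos (by positivity : 0 < h ^ 2)]
      nlinarith [sq_nonneg h]
    have h7 : (fderiv ℝ (fun x => Θ θ h (P h x)) x).det =
        (fderiv ℝ (Θ θ h) (P h x)).det * (Plin h).det := by
      rw [fderiv_Theta_P hθ]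
      exact LinearMap.det_comp _ _
    rw [h7, abs_mul]
    exact mul_le_mul_of_nonneg_right (hdet₀ _ (hD _ h6)) (abs_nonneg _)
  have hc : 0 < c₀ * |(Plin h).det| := mul_pos hc₀ (abs_pos.2 hPdet)
  have hΞ := contDiff_Theta_P hθ h
  have hU := isOpen_image_of_det_ne_zero hV hΞ fun x hx h0 => by
    have := hdet x hx
    rw [h0, abs_zero] at this
    linarith
  have himg : (fun x => Θ θ h (P h x)) '' plate₁ ω = wrinkledPlate ω θ h := image_plate₁ hh
  have hfin : IsFiniteMeasure (volume.restrict (wrinkledPlate ω θ h)) :=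
    ⟨by rw [Measure.restrict_apply_univ]; exact measure_wrinkledPlate_lt_top hωb hθ h⟩
  have hui : IntegrableOn y (wrinkledPlate ω θ h) := hy.memLp.integrable (by norm_num)
  have hgi : ∀ i, IntegrableOn (fun x => Dy x i) (wrinkledPlate ω θ h) := fun i =>
    (hy.grad_memLp i).integrable (by norm_num)
  refine ⟨integrableOn_comp_of_det hV hΞ hinj hc hdet (by rw [himg]; exact hui),
    fun Φ hΦ hΦc hΦV => ?_⟩
  have key := fun e => integral_comp_mul_fderiv_eq eq_sum_co3 hV hΞ hinj hU hc hdet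
    (u := y) (g := Dy) (by rw [himg]; exact hui) (by rw [himg]; exact hgi)
    (by rw [himg]; exact hy.weakDeriv) hΦ hΦc hΦV e
  refine ⟨fun β => ?_, ?_⟩
  · rw [key]
    simp only [fderiv_Theta_P_horizontal hθ hh.ne']
  · rw [key]
    simp only [fderiv_Theta_P_vertical hθ hh.ne']

end WrinkledPlate

namespace WrinkledPlate

/-! ### Integral identities on the rescaled plate -/

/-- The interval of the rescaled thickness variable. -/
abbrev thick : Set ℝ := Set.Ioo (-(1 ^ 2 / 2)) (1 ^ 2 / 2)

theorem restrict_plate₁ (ω : Set R2) : (volume : Measure R3).restrict (plate₁ ω) =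
    (volume.restrict ω).prod (volume.restrict thick) :=
  (Measure.prod_restrict ω thick).symm

instance : IsProbabilityMeasure ((volume : Measure ℝ).restrict thick) :=
  ⟨by rw [Measure.restrict_apply_univ, Real.volume_Ioo]; norm_num⟩

theorem isBounded_plate₁ {ω : Set R2} (hω : Bornology.IsBounded ω) :
    Bornology.IsBounded (plate₁ ω) := hω.prod (Metric.isBounded_Ioo _ _)

theorem isFiniteMeasure_restrict_of_isBounded {E : Type*} [PseudoMetricSpace E] [ProperSpace E]
    [MeasurableSpace E] {μ : Measure E} [IsFiniteMeasureOnCompacts μ] {S : Set E}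
    (hS : Bornology.IsBounded S) : IsFiniteMeasure (μ.restrict S) :=
  ⟨by rw [Measure.restrict_apply_univ]; exact hS.measure_lt_top⟩

theorem exists_bound_of_isBounded {E : Type*} [PseudoMetricSpace E] [ProperSpace E] {S : Set E}
    (hS : Bornology.IsBounded S) {w : E → ℝ} (hw : Continuous w) : ∃ C, ∀ x ∈ S, ‖w x‖ ≤ C := by
  obtain ⟨C, hC⟩ := hS.isCompact_closure.exists_bound_of_continuousOn hw.continuousOn
  exact ⟨C, fun x hx => hC x (subset_closure hx)⟩

theorem IntegrableOn.mul_continuous_of_isBounded {E : Type*} [PseudoMetricSpace E] [ProperSpace E]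
    [MeasurableSpace E] [OpensMeasurableSpace E] {μ : Measure E} {S : Set E}
    (hSm : MeasurableSet S) (hS : Bornology.IsBounded S) {f w : E → ℝ}
    (hf : IntegrableOn f S μ) (hw : Continuous w) : IntegrableOn (fun x => f x * w x) S μ := by
  obtain ⟨C, hC⟩ := exists_bound_of_isBounded hS hw
  refine Integrable.mul_bdd (c := C) hf hw.aestronglyMeasurable ?_
  filter_upwards [ae_restrict_mem hSm] with x hx using hC x hx

theorem integrable_fst_plate₁ {ω : Set R2} {f : R2 → ℝ} (hf : IntegrableOn f ω) :
    IntegrableOn (fun x : R3 => f x.1) (plate₁ ω) := by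
  rw [IntegrableOn, restrict_plate₁]
  exact hf.comp_fst _

theorem integral_plate₁_mul (ω : Set R2) (f : R2 → ℝ) (g : ℝ → ℝ) :
    ∫ x in plate₁ ω, f x.1 * g x.2 = (∫ x in ω, f x) * ∫ t in thick, g t := by
  rw [restrict_plate₁]
  exact integral_prod_mul f g

theorem integral_plate₁_fst (ω : Set R2) (f : R2 → ℝ) :
    ∫ x in plate₁ ω, f x.1 = ∫ x in ω, f x := by
  have := integral_plate₁_mul ω f fun _ => 1
  simpa using this

theorem integral_thick_id : ∫ t in thick, t = 0 := by
  rw [← integral_Ioc_eq_integral_Ioo, ← intervalIntegral.integral_of_le (by norm_num), integral_id]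
  norm_num

theorem integral_thick_deriv {η : ℝ → ℝ} (hη : η ∈ testFunctions thick) :
    ∫ t in thick, deriv η t = 0 := by
  have h0 : ∀ t ∉ thick, η t = 0 := fun t ht =>
    image_eq_zero_of_notMem_tsupport fun h => ht (hη.2.2 h)
  have hη1 : ContDiff ℝ 1 η := hη.1.of_le (by norm_num)
  rw [← integral_Ioc_eq_integral_Ioo, ← intervalIntegral.integral_of_le (by norm_num),
    intervalIntegral.integral_deriv_eq_sub (fun t _ => hη1.differentiable one_ne_zero t)
      ((hη1.continuous_deriv le_rfl).intervalIntegrable _ _), h0 _ (by simp), h0 _ (by simp),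
    sub_zero]

theorem integral_thick_id_mul_deriv {η : ℝ → ℝ} (hη : η ∈ testFunctions thick) :
    ∫ t in thick, t * deriv η t = - ∫ t in thick, η t := by
  have h0 : ∀ t ∉ thick, η t = 0 := fun t ht =>
    image_eq_zero_of_notMem_tsupport fun h => ht (hη.2.2 h)
  have hη1 : ContDiff ℝ 1 η := hη.1.of_le (by norm_num)
  rw [← integral_Ioc_eq_integral_Ioo, ← integral_Ioc_eq_integral_Ioo,
    ← intervalIntegral.integral_of_le (by norm_num),
    ← intervalIntegral.integral_of_le (by norm_num),
    intervalIntegral.integral_mul_deriv_eq_deriv_mul (u := fun t => t) (u' := fun _ => 1)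
      (fun t _ => hasDerivAt_id t) (fun t _ => (hη1.differentiable one_ne_zero t).hasDerivAt)
      (by simp) ((hη1.continuous_deriv le_rfl).intervalIntegrable _ _),
    h0 _ (by simp), h0 _ (by simp)]
  simp

theorem fderiv_tensor {φ : R2 → ℝ} {η : ℝ → ℝ} (hφ : ContDiff ℝ 1 φ) (hη : ContDiff ℝ 1 η)
    (x v : R3) : fderiv ℝ (fun x : R3 => φ x.1 * η x.2) x v =
      fderiv ℝ φ x.1 v.1 * η x.2 + φ x.1 * (v.2 * deriv η x.2) := by
  have d1 : HasFDerivAt (fun x : R3 => φ x.1) _ x :=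
    (hφ.differentiable one_ne_zero x.1).hasFDerivAt.comp x hasFDerivAt_fst
  have d2 : HasFDerivAt (fun x : R3 => η x.2) _ x :=
    (hη.differentiable one_ne_zero x.2).hasDerivAt.hasFDerivAt.comp x hasFDerivAt_snd
  have d3 := (d1.mul d2).fderiv
  have d4 : fderiv ℝ (fun x : R3 => φ x.1 * η x.2) x = _ := d3
  rw [d4]
  simp; ring

theorem tensor_compact {ω : Set R2} {φ : R2 → ℝ} {η : ℝ → ℝ} (hφ : HasCompactSupport φ)
    (hφω : tsupport φ ⊆ ω) (hη : HasCompactSupport η) (hηI : tsupport η ⊆ thick) :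
    HasCompactSupport (fun x : R3 => φ x.1 * η x.2) ∧
      tsupport (fun x : R3 => φ x.1 * η x.2) ⊆ plate₁ ω := by
  have hK : IsCompact (tsupport φ ×ˢ tsupport η) := hφ.isCompact.prod hη.isCompact
  have hs : tsupport (fun x : R3 => φ x.1 * η x.2) ⊆ tsupport φ ×ˢ tsupport η := by
    refine closure_minimal (fun x hx => ?_) hK.isClosed
    have hx' : φ x.1 * η x.2 ≠ 0 := hx
    exact ⟨subset_tsupport _ (left_ne_zero_of_mul hx'),
      subset_tsupport _ (right_ne_zero_of_mul hx')⟩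
  exact ⟨hK.of_isClosed_subset (isClosed_tsupport _) hs,
    hs.trans (Set.prod_mono hφω hηI)⟩

theorem eq_sum_e2 (v : R2) : v = ∑ i, v i • e2 i := by
  ext i; fin_cases i <;> simp [e2]

/-- Weak derivatives may be tested with `C¹` functions. -/
theorem integral_mul_fderiv_of_contDiff_one {ω : Set R2} (hω : IsOpen ω) {u : R2 → ℝ}
    {g : R2 → Fin 2 → ℝ} (hu : IntegrableOn u ω) (hg : ∀ i, IntegrableOn (fun x => g x i) ω)
    (hw : ∀ i, IsWeakDeriv ω (e2 i) u (fun x => g x i)) {φ : R2 → ℝ} (hφ : ContDiff ℝ 1 φ)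
    (hφc : HasCompactSupport φ) (hφω : tsupport φ ⊆ ω) (β : Fin 2) :
    ∫ x in ω, u x * fderiv ℝ φ x (e2 β) = - ∫ x in ω, g x β * φ x := by
  have himg : (fun x : R2 => x) '' ω = ω := Set.image_id ω
  -- The chain rule for the identity map: the mollification inside it is what lowers the regularity
  -- required of the test function.
  have h1 := integral_comp_mul_fderiv_eq (E := R2) (b := e2) (Ξ := fun x => x)
    (co := fun i => ContinuousLinearMap.proj i) (u := u) (g := g) (c := 1)
    eq_sum_e2 hω contDiff_id Function.injective_id.injOn (by rw [himg]; exact hω) one_pos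
    (fun x _ => by
      rw [fderiv_fun_id]
      have : (ContinuousLinearMap.id ℝ R2).det = 1 := LinearMap.det_id
      rw [this, abs_one])
    (by rw [himg]; exact hu) (by rw [himg]; exact hg) (by rw [himg]; exact hw) hφ hφc hφω (e2 β)
  rw [h1]
  congr 2; ext x
  rw [fderiv_fun_id]
  congr 1
  simp [e2, Pi.single_apply]

variable {θ : R2 → ℝ}

theorem continuous_dθ (hθ : ContDiff ℝ 2 θ) (h : ℝ) (β : Fin 2) : Continuous (dθ θ h β) :=
  (((hθ.of_le (by norm_num : (1 : WithTop ℕ∞) ≤ 2)).continuous_fderiv one_ne_zero).comp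
    (continuous_id.const_smul h⁻¹)).clm_apply continuous_const

/-- The coefficients of the derivative of the normal. -/
noncomputable def dnormal (θ : R2 → ℝ) (h : ℝ) (β : Fin 2) (k : Fin 3) (x : R2) : ℝ :=
  co3 k (fderiv ℝ (normal θ h) x (e2 β))

theorem continuous_dnormal (hθ : ContDiff ℝ 2 θ) (h : ℝ) (β : Fin 2) (k : Fin 3) :
    Continuous (dnormal θ h β k) :=
  (co3 k).continuous.comp
    (((contDiff_normal hθ h).continuous_fderiv one_ne_zero).clm_apply continuous_const)

/-- Splits the tangent into a part independent of x₃ and a part linear in x₃. Against functions of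
x' the two are sorted out by ∫η' = 0 and ∫tη' = -∫η, or by ∫t = 0. -/
theorem co3_tangent (θ : R2 → ℝ) (h : ℝ) (β : Fin 2) (k : Fin 3) (x : R3) :
    co3 k (tangent θ h β x) =
      co3 k (e2 β, h * dθ θ h β x.1) + h ^ 2 * (dnormal θ h β k x.1 * x.2) := by
  rw [tangent, map_add, map_smul, dnormal, smul_eq_mul]; ring

theorem continuous_co3_flat (hθ : ContDiff ℝ 2 θ) (h : ℝ) (β : Fin 2) (k : Fin 3) :
    Continuous fun x : R2 => co3 k (e2 β, h * dθ θ h β x) :=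
  (co3 k).continuous.comp (continuous_const.prodMk (continuous_const.mul (continuous_dθ hθ h β)))

theorem continuous_co3_tangent (hθ : ContDiff ℝ 2 θ) (h : ℝ) (β : Fin 2) (k : Fin 3) :
    Continuous fun x : R3 => co3 k (tangent θ h β x) := by
  simp_rw [co3_tangent]
  exact ((continuous_co3_flat hθ h β k).comp continuous_fst).add (continuous_const.mul
    (((continuous_dnormal hθ h β k).comp continuous_fst).mul continuous_snd))

theorem continuous_co3_normal (hθ : ContDiff ℝ 2 θ) (h : ℝ) (k : Fin 3) :
    Continuous fun x : R2 => co3 k (normal θ h x) :=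
  (co3 k).continuous.comp (contDiff_normal hθ h).continuous

theorem sum_mul_co3_flat (r : Fin 3 → ℝ) (h : ℝ) (β : Fin 2) (x : R2) :
    ∑ k, r k * co3 k (e2 β, h * dθ θ h β x) = r β.castSucc + h * dθ θ h β x * r 2 := by
  rw [Fin.sum_univ_three]
  fin_cases β <;> simp [co3, e2] <;> ring

end WrinkledPlate

/-! ### The chain rule tested with tensor products, and the share of the rotation field -/

namespace WrinkledPlate

variable {θ : R2 → ℝ} {ω : Set R2}

theorem integrable_mul_plate₁ (hω : IsOpen ω) (hωb : Bornology.IsBounded ω) {f W : R3 → ℝ}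
    (hf : IntegrableOn f (plate₁ ω)) (hW : Continuous W) :
    IntegrableOn (fun x => f x * W x) (plate₁ ω) :=
  IntegrableOn.mul_continuous_of_isBounded (isOpen_plate hω 1).measurableSet
    (isBounded_plate₁ hωb) hf hW

theorem integrable_mul_plane (hω : IsOpen ω) (hωb : Bornology.IsBounded ω) {f w : R2 → ℝ}
    (hf : IntegrableOn f ω) (hw : Continuous w) : IntegrableOn (fun x => f x * w x) ω :=
  IntegrableOn.mul_continuous_of_isBounded hω.measurableSet hωb hf hw

theorem continuous_fderiv_apply_of_testFunctions {φ : R2 → ℝ} (hφ : φ ∈ testFunctions ω)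
    (e : R2) : Continuous fun x => fderiv ℝ φ x e :=
  (hφ.1.continuous_fderiv (by simp)).clm_apply continuous_const

theorem fderiv_apply_mem_testFunctions {φ : R2 → ℝ} (hφ : φ ∈ testFunctions ω) (e : R2) :
    (fun x => fderiv ℝ φ x e) ∈ testFunctions ω :=
  ⟨(hφ.1.fderiv_right (by simp)).clm_apply contDiff_const, hφ.2.1.fderiv_apply ℝ e,
    (tsupport_fderiv_apply_subset ℝ e).trans hφ.2.2⟩

theorem deriv_mem_testFunctions {I : Set ℝ} {η : ℝ → ℝ} (hη : η ∈ testFunctions I) :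
    deriv η ∈ testFunctions I :=
  ⟨(contDiff_infty_iff_deriv.1 hη.1).2, hη.2.1.deriv, tsupport_deriv_subset.trans hη.2.2⟩

/-- The contribution of a function of the plane variables to the transverse identity. -/
theorem integral_plane_tangent (hω : IsOpen ω) (hωb : Bornology.IsBounded ω)
    (hθ : ContDiff ℝ 2 θ) (h : ℝ) (β : Fin 2) (k : Fin 3) {r : R2 → ℝ} {Dr : R2 → Fin 2 → ℝ}
    (hr : IntegrableOn r ω) (hDr : ∀ i, IntegrableOn (fun x => Dr x i) ω)
    (hw : ∀ i, IsWeakDeriv ω (e2 i) r (fun x => Dr x i)) {φ : R2 → ℝ}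
    (hφ : φ ∈ testFunctions ω) {η : ℝ → ℝ} (hη : η ∈ testFunctions thick) :
    ∫ x in plate₁ ω, r x.1 * (co3 k (tangent θ h β x) * (φ x.1 * deriv η x.2)) =
      h ^ 2 * (∫ x in plate₁ ω, r x.1 *
        (co3 k (normal θ h x.1) * (fderiv ℝ φ x.1 (e2 β) * η x.2))) +
      h ^ 2 * ∫ x in plate₁ ω, Dr x.1 β * (co3 k (normal θ h x.1) * (φ x.1 * η x.2)) := by
  have hφc := hφ.1.continuous
  have hηc := hη.1.continuous
  have hη'c := (deriv_mem_testFunctions hη).1.continuous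
  have hφ1 : ContDiff ℝ 1 φ := hφ.1.of_le (by norm_num)
  set n : R2 → ℝ := fun x => co3 k (normal θ h x) with hn
  have hn1 : ContDiff ℝ 1 n := (co3 k).contDiff.comp (contDiff_normal hθ h)
  -- The flat part of the tangent is annihilated by ∫η' = 0; only the derivative of the normal
  -- remains, with the factor h².
  have e1 : ∫ x in plate₁ ω, r x.1 * (co3 k (tangent θ h β x) * (φ x.1 * deriv η x.2)) =
      - h ^ 2 * (∫ x in ω, r x * (dnormal θ h β k x * φ x)) * ∫ t in thick, η t := by
    have a1 := integral_plate₁_mul ω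
      (fun x => r x * (co3 k (e2 β, h * dθ θ h β x) * φ x)) (deriv η)
    have a2 := integral_plate₁_mul ω
      (fun x => r x * (dnormal θ h β k x * φ x)) (fun t => t * deriv η t)
    rw [integral_thick_deriv hη, mul_zero] at a1
    rw [integral_thick_id_mul_deriv hη] at a2
    have i1 := integrable_mul_plate₁ hω hωb (integrable_fst_plate₁ hr)
      (W := fun x => co3 k (e2 β, h * dθ θ h β x.1) * φ x.1 * deriv η x.2)
      (((continuous_co3_flat hθ h β k).comp continuous_fst).mul (hφc.comp continuous_fst) |>.mul
        (hη'c.comp continuous_snd))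
    have i2 := integrable_mul_plate₁ hω hωb (integrable_fst_plate₁ hr)
      (W := fun x => dnormal θ h β k x.1 * φ x.1 * (x.2 * deriv η x.2))
      (((continuous_dnormal hθ h β k).comp continuous_fst).mul (hφc.comp continuous_fst) |>.mul
        (continuous_snd.mul (hη'c.comp continuous_snd)))
    have e : ∀ x : R3, r x.1 * (co3 k (tangent θ h β x) * (φ x.1 * deriv η x.2)) =
        r x.1 * (co3 k (e2 β, h * dθ θ h β x.1) * φ x.1 * deriv η x.2) +
        h ^ 2 * (r x.1 * (dnormal θ h β k x.1 * φ x.1 * (x.2 * deriv η x.2))) := by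
      intro x; rw [co3_tangent]; ring
    simp_rw [e]
    rw [integral_add i1 (Integrable.const_mul i2 _), integral_const_mul]
    have b1 : ∫ x in plate₁ ω, r x.1 * (co3 k (e2 β, h * dθ θ h β x.1) * φ x.1 * deriv η x.2) =
        0 := by
      rw [← a1]; congr 1; ext x; ring
    have b2 : ∫ x in plate₁ ω, r x.1 * (dnormal θ h β k x.1 * φ x.1 * (x.2 * deriv η x.2)) =
        (∫ x in ω, r x * (dnormal θ h β k x * φ x)) * -∫ t in thick, η t := by
      rw [← a2]; congr 1; ext x; ring
    rw [b1, b2]; ring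
  have e2' : ∫ x in plate₁ ω, r x.1 *
        (n x.1 * (fderiv ℝ φ x.1 (e2 β) * η x.2)) =
      (∫ x in ω, r x * (n x * fderiv ℝ φ x (e2 β))) * ∫ t in thick, η t := by
    rw [← integral_plate₁_mul]; congr 1; ext x; ring
  have e3' : ∫ x in plate₁ ω, Dr x.1 β * (n x.1 * (φ x.1 * η x.2)) =
      (∫ x in ω, Dr x β * (n x * φ x)) * ∫ t in thick, η t := by
    rw [← integral_plate₁_mul]; congr 1; ext x; ring
  have hprod : ∀ x, fderiv ℝ (fun x => n x * φ x) x (e2 β) =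
      dnormal θ h β k x * φ x + n x * fderiv ℝ φ x (e2 β) := by
    intro x
    have d1 : HasFDerivAt n _ x := (co3 k).hasFDerivAt.comp x
      ((contDiff_normal hθ h).differentiable one_ne_zero x).hasFDerivAt
    have d2 := (d1.mul (hφ1.differentiable one_ne_zero x).hasFDerivAt).fderiv
    have d3 : fderiv ℝ (fun x => n x * φ x) x = _ := d2
    rw [d3]
    simp [dnormal]; ring
  -- The normal is only C¹, since θ is C², so the product with φ is admissible only in the C¹ form
  -- of the weak derivative.
  have hC := integral_mul_fderiv_of_contDiff_one hω hr hDr hw (hn1.mul hφ1) hφ.2.1.mul_left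
    ((tsupport_mul_subset_right).trans hφ.2.2) β
  have hC' : ∫ x in ω, r x * fderiv ℝ (fun x => n x * φ x) x (e2 β) =
      - ∫ x in ω, Dr x β * (n x * φ x) := hC
  simp_rw [hprod, mul_add] at hC'
  have j1 : IntegrableOn (fun x => r x * (dnormal θ h β k x * φ x)) ω :=
    integrable_mul_plane hω hωb hr ((continuous_dnormal hθ h β k).mul hφc)
  have j2 : IntegrableOn (fun x => r x * (n x * fderiv ℝ φ x (e2 β))) ω :=
    integrable_mul_plane hω hωb hr
      (hn1.continuous.mul (continuous_fderiv_apply_of_testFunctions hφ _))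
  rw [integral_add j1 j2] at hC'
  rw [e1]
  simp only [hn] at e2' e3' hC' ⊢
  rw [e2', e3']
  linear_combination (- h ^ 2 * ∫ t in thick, η t) * hC'

/-- The weak form of the chain rule for a pulled back deformation `w`, with deformation
gradient `f`. -/
def ChainRule (θ : R2 → ℝ) (ω : Set R2) (h : ℝ) (w : R3 → ℝ) (f : R3 → Fin 3 → ℝ) : Prop :=
  ∀ Φ : R3 → ℝ, ContDiff ℝ 1 Φ → HasCompactSupport Φ → tsupport Φ ⊆ plate₁ ω →
    (∀ β, ∫ x in plate₁ ω, w x * fderiv ℝ Φ x (e2 β, 0) =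
      - ∫ x in plate₁ ω, (∑ k, f x k * co3 k (tangent θ h β x)) * Φ x) ∧
    ∫ x in plate₁ ω, w x * fderiv ℝ Φ x (0, 1) =
      - ∫ x in plate₁ ω, (∑ k, f x k * co3 k (h ^ 2 • normal θ h x.1)) * Φ x

theorem ChainRule.tangential {h : ℝ} {w : R3 → ℝ} {f : R3 → Fin 3 → ℝ}
    (hch : ChainRule θ ω h w f) (β : Fin 2) {φ : R2 → ℝ} (hφ : φ ∈ testFunctions ω)
    {η : ℝ → ℝ} (hη : η ∈ testFunctions thick) :
    ∫ x in plate₁ ω, w x * (fderiv ℝ φ x.1 (e2 β) * η x.2) =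
      - ∫ x in plate₁ ω, (∑ k, f x k * co3 k (tangent θ h β x)) * (φ x.1 * η x.2) := by
  have c1 : ContDiff ℝ 1 η := hη.1.of_le (by norm_num)
  have c2 : ContDiff ℝ 1 φ := hφ.1.of_le (by norm_num)
  have t1 := tensor_compact hφ.2.1 hφ.2.2 hη.2.1 hη.2.2
  have c3 : ContDiff ℝ 1 (fun x : R3 => φ x.1 * η x.2) :=
    (c2.comp contDiff_fst).mul (c1.comp contDiff_snd)
  have s1 := (hch (fun x => φ x.1 * η x.2) c3 t1.1 t1.2).1 β
  have d1 : ∀ x : R3, fderiv ℝ (fun x : R3 => φ x.1 * η x.2) x (e2 β, 0) =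
      fderiv ℝ φ x.1 (e2 β) * η x.2 := fun x => by
    rw [fderiv_tensor c2 c1]; simp
  simp_rw [d1] at s1
  exact s1

theorem ChainRule.transverse {h : ℝ} {w : R3 → ℝ} {f : R3 → Fin 3 → ℝ}
    (hch : ChainRule θ ω h w f) {φ : R2 → ℝ} (hφ : φ ∈ testFunctions ω)
    {η : ℝ → ℝ} (hη : η ∈ testFunctions thick) :
    ∫ x in plate₁ ω, w x * (φ x.1 * deriv η x.2) =
      - ∫ x in plate₁ ω, (∑ k, f x k * co3 k (h ^ 2 • normal θ h x.1)) * (φ x.1 * η x.2) := by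
  have c1 : ContDiff ℝ 1 η := hη.1.of_le (by norm_num)
  have c2 : ContDiff ℝ 1 φ := hφ.1.of_le (by norm_num)
  have t1 := tensor_compact hφ.2.1 hφ.2.2 hη.2.1 hη.2.2
  have c3 : ContDiff ℝ 1 (fun x : R3 => φ x.1 * η x.2) :=
    (c2.comp contDiff_fst).mul (c1.comp contDiff_snd)
  have s1 := (hch (fun x => φ x.1 * η x.2) c3 t1.1 t1.2).2
  have d1 : ∀ x : R3, fderiv ℝ (fun x : R3 => φ x.1 * η x.2) x (0, 1) =
      φ x.1 * deriv η x.2 := fun x => by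
    rw [fderiv_tensor c2 c1]; simp
  simp_rw [d1] at s1
  exact s1

end WrinkledPlate

namespace WrinkledPlate

/-! ### The transverse identity and the average over the thickness -/

section Integral

variable {X : Type*} [MeasurableSpace X] {μ : Measure X}

theorem integral_sum_mul_mul {ι : Type*} [Fintype ι] {f c : ι → X → ℝ} {W : X → ℝ}
    (hf : ∀ k, Integrable (fun x => f k x * (c k x * W x)) μ) :
    ∫ x, (∑ k, f k x * c k x) * W x ∂μ = ∑ k, ∫ x, f k x * (c k x * W x) ∂μ := by
  rw [← integral_finsetSum _ fun k _ => hf k]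
  congr 1; ext x
  rw [Finset.sum_mul]
  exact Finset.sum_congr rfl fun k _ => mul_assoc _ _ _

theorem integral_sub_div_mul {f r W : X → ℝ} (a : ℝ) (hf : Integrable (fun x => f x * W x) μ)
    (hr : Integrable (fun x => r x * W x) μ) :
    ∫ x, ((f x - r x) / a) * W x ∂μ = ((∫ x, f x * W x ∂μ) - ∫ x, r x * W x ∂μ) / a := by
  rw [← integral_sub hf hr, ← integral_div]
  congr 1; ext x; ring

theorem integral_div_mul (r W : X → ℝ) (a : ℝ) :
    ∫ x, (r x / a) * W x ∂μ = (∫ x, r x * W x ∂μ) / a := by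
  rw [← integral_div]
  congr 1; ext x; ring

end Integral

variable {θ : R2 → ℝ} {ω : Set R2}

/-- Commuting the transverse and the in-plane derivatives of the deformation. -/
theorem ChainRule.commute (hω : IsOpen ω) (hωb : Bornology.IsBounded ω)
    (hθ : ContDiff ℝ 2 θ) {h : ℝ} {w : R3 → ℝ} {f : R3 → Fin 3 → ℝ}
    (hf : ∀ k, IntegrableOn (fun x => f x k) (plate₁ ω)) (hch : ChainRule θ ω h w f)
    (β : Fin 2) {φ : R2 → ℝ} (hφ : φ ∈ testFunctions ω) {η : ℝ → ℝ} (hη : η ∈ testFunctions thick) :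
    ∑ k, ∫ x in plate₁ ω, f x k * (co3 k (tangent θ h β x) * (φ x.1 * deriv η x.2)) =
      h ^ 2 * ∑ k, ∫ x in plate₁ ω, f x k *
        (co3 k (normal θ h x.1) * (fderiv ℝ φ x.1 (e2 β) * η x.2)) := by
  have hη' := deriv_mem_testFunctions hη
  have hφ' := fderiv_apply_mem_testFunctions hφ (e2 β)
  -- Both the tangential rule with (φ, η') and the transverse rule with (∂_βφ, η) have ∫ w ∂_βφ η'
  -- on the left; equating their right sides expresses that the mixed derivatives commute.
  have s1 := hch.tangential β hφ hη'
  have s2 := hch.transverse hφ' hη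
  have w1 : ∀ k, Continuous fun x : R3 => co3 k (tangent θ h β x) * (φ x.1 * deriv η x.2) :=
    fun k => (continuous_co3_tangent hθ h β k).mul
      ((hφ.1.continuous.comp continuous_fst).mul (hη'.1.continuous.comp continuous_snd))
  have w2 : ∀ k, Continuous fun x : R3 =>
      co3 k (normal θ h x.1) * (fderiv ℝ φ x.1 (e2 β) * η x.2) :=
    fun k => ((continuous_co3_normal hθ h k).comp continuous_fst).mul
      ((hφ'.1.continuous.comp continuous_fst).mul (hη.1.continuous.comp continuous_snd))
  have j1 := fun k => integrable_mul_plate₁ hω hωb (hf k) (w1 k)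
  have j2 := fun k => integrable_mul_plate₁ hω hωb (hf k) (w2 k)
  have a1 := integral_sum_mul_mul (f := fun k (x : R3) => f x k)
    (c := fun k x => co3 k (tangent θ h β x)) (W := fun x => φ x.1 * deriv η x.2) j1
  have a2 := integral_sum_mul_mul (f := fun k (x : R3) => f x k)
    (c := fun k x => co3 k (normal θ h x.1))
    (W := fun x => fderiv ℝ φ x.1 (e2 β) * η x.2) j2
  have e : ∀ x : R3, (∑ k, f x k * co3 k (h ^ 2 • normal θ h x.1)) *
      (fderiv ℝ φ x.1 (e2 β) * η x.2) = h ^ 2 * ((∑ k, f x k * co3 k (normal θ h x.1)) *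
      (fderiv ℝ φ x.1 (e2 β) * η x.2)) := by
    intro x
    simp_rw [map_smul, smul_eq_mul, Finset.sum_mul, Finset.mul_sum]
    exact Finset.sum_congr rfl fun k _ => by ring
  simp_rw [e, integral_const_mul] at s2
  rw [← a1, ← a2]
  linarith

/-- The transverse identity for the scaled difference of the deformation gradient and a field
depending on the plane variables only. -/
theorem transverse_identity (hω : IsOpen ω) (hωb : Bornology.IsBounded ω)
    (hθ : ContDiff ℝ 2 θ) {h : ℝ} (hh : 0 < h) {w : R3 → ℝ} {f : R3 → Fin 3 → ℝ}
    (hf : ∀ k, IntegrableOn (fun x => f x k) (plate₁ ω)) (hch : ChainRule θ ω h w f)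
    {r : R2 → Fin 3 → ℝ} {Dr : R2 → Fin 3 → Fin 2 → ℝ}
    (hr : ∀ k, IntegrableOn (fun x => r x k) ω)
    (hDr : ∀ k i, IntegrableOn (fun x => Dr x k i) ω)
    (hw : ∀ k i, IsWeakDeriv ω (e2 i) (fun x => r x k) (fun x => Dr x k i)) (β : Fin 2)
    {φ : R2 → ℝ} (hφ : φ ∈ testFunctions ω) {η : ℝ → ℝ} (hη : η ∈ testFunctions thick) :
    ∑ k, ∫ x in plate₁ ω, ((f x k - r x.1 k) / h ^ 4) *
        (co3 k (tangent θ h β x) * (φ x.1 * deriv η x.2)) =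
      ∑ k, (h ^ 2 * (∫ x in plate₁ ω, ((f x k - r x.1 k) / h ^ 4) *
          (co3 k (normal θ h x.1) * (fderiv ℝ φ x.1 (e2 β) * η x.2))) -
        ∫ x in plate₁ ω, (Dr x.1 k β / h ^ 2) *
          (co3 k (normal θ h x.1) * (φ x.1 * η x.2))) := by
  have hη' := deriv_mem_testFunctions hη
  have hφ' := fderiv_apply_mem_testFunctions hφ (e2 β)
  have E1 := hch.commute hω hωb hθ hf β hφ hη
  have w1 : ∀ k, Continuous fun x : R3 => co3 k (tangent θ h β x) * (φ x.1 * deriv η x.2) :=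
    fun k => (continuous_co3_tangent hθ h β k).mul
      ((hφ.1.continuous.comp continuous_fst).mul (hη'.1.continuous.comp continuous_snd))
  have w2 : ∀ k, Continuous fun x : R3 =>
      co3 k (normal θ h x.1) * (fderiv ℝ φ x.1 (e2 β) * η x.2) :=
    fun k => ((continuous_co3_normal hθ h k).comp continuous_fst).mul
      ((hφ'.1.continuous.comp continuous_fst).mul (hη.1.continuous.comp continuous_snd))
  have L1 := fun k => integral_sub_div_mul (f := fun x : R3 => f x k)
    (r := fun x : R3 => r x.1 k) (W := fun x => co3 k (tangent θ h β x) * (φ x.1 * deriv η x.2))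
    (h ^ 4) (integrable_mul_plate₁ hω hωb (hf k) (w1 k))
    (integrable_mul_plate₁ hω hωb (integrable_fst_plate₁ (hr k)) (w1 k))
  have L2 := fun k => integral_sub_div_mul (f := fun x : R3 => f x k)
    (r := fun x : R3 => r x.1 k)
    (W := fun x => co3 k (normal θ h x.1) * (fderiv ℝ φ x.1 (e2 β) * η x.2))
    (h ^ 4) (integrable_mul_plate₁ hω hωb (hf k) (w2 k))
    (integrable_mul_plate₁ hω hωb (integrable_fst_plate₁ (hr k)) (w2 k))
  have L3 := fun k => integral_div_mul (μ := (volume : Measure R3).restrict (plate₁ ω))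
    (fun x : R3 => Dr x.1 k β) (fun x => co3 k (normal θ h x.1) * (φ x.1 * η x.2)) (h ^ 2)
  -- The rotation field is not a gradient, and its defect in the commutation identity is h² (∂_βR)
  -- n. Division by h⁴ leaves the quantity ∂_βR/h².
  have E2 := fun k => integral_plane_tangent hω hωb hθ h β k (hr k) (hDr k) (hw k) hφ hη
  have h0 : h ≠ 0 := hh.ne'
  simp_rw [L1, L2, L3, E2, ← Finset.sum_div, Finset.sum_sub_distrib, E1]
  rw [← Finset.sum_div, Finset.sum_add_distrib, ← Finset.mul_sum, ← Finset.mul_sum,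
    ← Finset.mul_sum, ← Finset.sum_div, Finset.sum_sub_distrib]
  field_simp
  ring

/-- A sequence of test functions on the thickness interval increasing to `1`. -/
theorem exists_cutoff : ∃ η : ℕ → ℝ → ℝ, (∀ m, η m ∈ testFunctions thick) ∧
    (∀ m t, ‖η m t‖ ≤ 1) ∧ ∀ t ∈ thick, Tendsto (fun m => η m t) atTop (𝓝 1) := by
  -- The shift by 3 keeps the inner radius at least 1/6; the outer radius stays below 1/2, so the
  -- closed support lies in the open interval.
  let b : ℕ → ContDiffBump (0 : ℝ) := fun m =>
    ⟨1 / 2 - 1 / (m + 3), 1 / 2 - 1 / (m + 4), by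
      have : (1:ℝ) / (m + 3) ≤ 1 / 3 := one_div_le_one_div_of_le (by norm_num) (by simp)
      linarith, by
      have : (1:ℝ) / (m + 4) < 1 / (m + 3) :=
        one_div_lt_one_div_of_lt (by positivity) (by linarith)
      linarith⟩
  have e : (1:ℝ) ^ 2 / 2 = 1 / 2 := by norm_num
  refine ⟨fun m t => b m t, fun m => ⟨(b m).contDiff, (b m).hasCompactSupport, ?_⟩,
    fun m t => ?_, fun t ht => ?_⟩
  · rw [(b m).tsupport_eq]
    intro t ht
    rw [mem_closedBall_zero_iff, Real.norm_eq_abs, abs_le] at ht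
    have : (0:ℝ) < 1 / (m + 4) := by positivity
    have h2 : (b m).rOut = 1 / 2 - 1 / (m + 4) := rfl
    rw [h2] at ht
    constructor <;> rw [e] <;> linarith [ht.1, ht.2]
  · rw [Real.norm_of_nonneg (b m).nonneg]
    exact (b m).le_one
  · refine tendsto_const_nhds.congr' ?_
    rw [Set.mem_Ioo, e] at ht
    have h1 : |t| < 1 / 2 := abs_lt.2 ht
    have h2 : Tendsto (fun m : ℕ => (1:ℝ) / 2 - 1 / (m + 3)) atTop (𝓝 (1 / 2)) := by
      have h4 := (tendsto_const_div_atTop_nhds_zero_nat (1:ℝ)).comp (tendsto_add_atTop_nat 3)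
      have := (tendsto_const_nhds (x := (1:ℝ) / 2)).sub h4
      simpa using this
    filter_upwards [h2.eventually (lt_mem_nhds h1)] with m hm
    refine ((b m).one_of_mem_closedBall ?_).symm
    rw [mem_closedBall_zero_iff]
    exact hm.le

theorem tendsto_integral_mul_cutoff (hω : IsOpen ω) (hωb : Bornology.IsBounded ω)
    {η : ℕ → ℝ → ℝ} (hη : ∀ m, η m ∈ testFunctions thick) (hη1 : ∀ m t, ‖η m t‖ ≤ 1)
    (hηl : ∀ t ∈ thick, Tendsto (fun m => η m t) atTop (𝓝 1)) {q : R3 → ℝ}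
    (hq : IntegrableOn q (plate₁ ω)) :
    Tendsto (fun m => ∫ x in plate₁ ω, q x * η m x.2) atTop (𝓝 (∫ x in plate₁ ω, q x)) := by
  have hi : ∀ m, IntegrableOn (fun x : R3 => q x * η m x.2) (plate₁ ω) := fun m =>
    integrable_mul_plate₁ hω hωb hq ((hη m).1.continuous.comp continuous_snd)
  refine tendsto_integral_of_dominated_convergence (fun x => ‖q x‖)
    (fun m => (hi m).1) hq.norm (fun m => ae_of_all _ fun x => ?_) ?_
  · rw [norm_mul]
    exact mul_le_of_le_one_right (norm_nonneg _) (hη1 m _)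
  · filter_upwards [ae_restrict_mem (isOpen_plate hω 1).measurableSet] with x hx
    have := (hηl x.2 hx.2).const_mul (q x)
    rwa [mul_one] at this

theorem integral_plate₁_mul_fst {w : R3 → ℝ} {g : R2 → ℝ}
    (hi : IntegrableOn (fun x : R3 => w x * g x.1) (plate₁ ω)) :
    ∫ x in plate₁ ω, w x * g x.1 =
      ∫ x in ω, (∫ t in (-1 / 2 : ℝ)..(1 / 2), w (x, t)) * g x := by
  have e : ∀ x, ∫ t in (-1 / 2 : ℝ)..(1 / 2), w (x, t) = ∫ t in thick, w (x, t) := by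
    intro x
    have e1 : (1:ℝ) ^ 2 / 2 = 1 / 2 := by norm_num
    have e2 : (-1 / 2:ℝ) = -(1 / 2) := by norm_num
    rw [intervalIntegral.integral_of_le (by norm_num), integral_Ioc_eq_integral_Ioo, thick, e1, e2]
  simp_rw [e]
  rw [IntegrableOn, restrict_plate₁] at hi
  rw [restrict_plate₁, integral_prod _ hi]
  congr 1; ext x
  exact integral_mul_const (g x) fun t => w (x, t)

/-- The weak derivative of the average over the thickness. -/
theorem ChainRule.average (hω : IsOpen ω) (hωb : Bornology.IsBounded ω)
    (hθ : ContDiff ℝ 2 θ) {h : ℝ} {w : R3 → ℝ} {f : R3 → Fin 3 → ℝ}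
    (hwi : IntegrableOn w (plate₁ ω))
    (hf : ∀ k, IntegrableOn (fun x => f x k) (plate₁ ω)) (hch : ChainRule θ ω h w f)
    (β : Fin 2) {φ : R2 → ℝ} (hφ : φ ∈ testFunctions ω) :
    ∫ x in ω, (∫ t in (-1 / 2 : ℝ)..(1 / 2), w (x, t)) * fderiv ℝ φ x (e2 β) =
      - ∑ k, ∫ x in plate₁ ω, f x k * (co3 k (tangent θ h β x) * φ x.1) := by
  obtain ⟨η, hη, hη1, hηl⟩ := exists_cutoff
  have hφ' := fderiv_apply_mem_testFunctions hφ (e2 β)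
  have w1 : ∀ k, Continuous fun x : R3 => co3 k (tangent θ h β x) * φ x.1 :=
    fun k => (continuous_co3_tangent hθ h β k).mul (hφ.1.continuous.comp continuous_fst)
  have i1 : IntegrableOn (fun x : R3 => w x * fderiv ℝ φ x.1 (e2 β)) (plate₁ ω) :=
    integrable_mul_plate₁ hω hωb hwi (hφ'.1.continuous.comp continuous_fst)
  have j := fun k => integrable_mul_plate₁ hω hωb (hf k) (w1 k)
  have i2 : IntegrableOn (fun x : R3 => (∑ k, f x k * co3 k (tangent θ h β x)) * φ x.1)
      (plate₁ ω) := by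
    have := integrable_finsetSum (μ := (volume : Measure R3).restrict (plate₁ ω))
      Finset.univ fun k _ => j k
    refine this.congr (ae_of_all _ fun x => ?_)
    simp only [Finset.sum_mul, mul_assoc]
  -- The weak chain rule admits only test functions with compact support in x₃ as well, so the
  -- constant 1 in the thickness variable is reached as a limit of cutoffs.
  have key : ∀ m, ∫ x in plate₁ ω, w x * fderiv ℝ φ x.1 (e2 β) * η m x.2 =
      - ∫ x in plate₁ ω, (∑ k, f x k * co3 k (tangent θ h β x)) * φ x.1 * η m x.2 := by
    intro m
    simp_rw [mul_assoc]
    exact hch.tangential β hφ (hη m)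
  have h1 := tendsto_nhds_unique
    ((tendsto_integral_mul_cutoff hω hωb hη hη1 hηl i1).congr key)
    (tendsto_integral_mul_cutoff hω hωb hη hη1 hηl i2).neg
  rw [← integral_plate₁_mul_fst i1, h1]
  congr 1
  exact integral_sum_mul_mul (f := fun k (x : R3) => f x k)
    (c := fun k x => co3 k (tangent θ h β x)) (W := fun x => φ x.1) j

end WrinkledPlate

namespace WrinkledPlate

variable {θ : R2 → ℝ} {ω : Set R2}

/-! ### The in-plane identity -/

/-- The contribution of a function of the plane variables to the in-plane identity. -/
theorem sum_integral_plane_tangent (hω : IsOpen ω) (hωb : Bornology.IsBounded ω)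
    (hθ : ContDiff ℝ 2 θ) (h : ℝ) (β : Fin 2) {r : R2 → Fin 3 → ℝ}
    (hr : ∀ k, IntegrableOn (fun x => r x k) ω) {φ : R2 → ℝ} (hφ : Continuous φ) :
    ∑ k, ∫ x in plate₁ ω, r x.1 k * (co3 k (tangent θ h β x) * φ x.1) =
      (∫ x in ω, r x β.castSucc * φ x) + h * ∫ x in ω, r x 2 * (dθ θ h β x * φ x) := by
  have e1 : ∀ k, ∫ x in plate₁ ω, r x.1 k * (co3 k (tangent θ h β x) * φ x.1) =
      ∫ x in ω, r x k * (co3 k (e2 β, h * dθ θ h β x) * φ x) := by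
    intro k
    have a1 := integral_plate₁_fst ω
      (fun x => r x k * (co3 k (e2 β, h * dθ θ h β x) * φ x))
    have a2 := integral_plate₁_mul ω
      (fun x => r x k * (dnormal θ h β k x * φ x)) (fun t => t)
    -- The thickness interval is symmetric, so the part of the tangent linear in x₃ does not
    -- contribute.
    rw [integral_thick_id, mul_zero] at a2
    have i1 := integrable_mul_plate₁ hω hωb (integrable_fst_plate₁ (hr k))
      (W := fun x => co3 k (e2 β, h * dθ θ h β x.1) * φ x.1)
      (((continuous_co3_flat hθ h β k).comp continuous_fst).mul (hφ.comp continuous_fst))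
    have i2 := integrable_mul_plate₁ hω hωb (integrable_fst_plate₁ (hr k))
      (W := fun x => dnormal θ h β k x.1 * φ x.1 * x.2)
      (((continuous_dnormal hθ h β k).comp continuous_fst).mul (hφ.comp continuous_fst) |>.mul
        continuous_snd)
    have e : ∀ x : R3, r x.1 k * (co3 k (tangent θ h β x) * φ x.1) =
        r x.1 k * (co3 k (e2 β, h * dθ θ h β x.1) * φ x.1) +
        h ^ 2 * (r x.1 k * (dnormal θ h β k x.1 * φ x.1 * x.2)) := by
      intro x; rw [co3_tangent]; ring
    simp_rw [e]
    rw [integral_add i1 (Integrable.const_mul i2 _), integral_const_mul, a1]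
    have b2 : ∫ x in plate₁ ω, r x.1 k * (dnormal θ h β k x.1 * φ x.1 * x.2) = 0 := by
      rw [← a2]; congr 1; ext x; ring
    rw [b2]; ring
  have j : ∀ k, IntegrableOn (fun x => r x k * (co3 k (e2 β, h * dθ θ h β x) * φ x)) ω :=
    fun k => integrable_mul_plane hω hωb (hr k) ((continuous_co3_flat hθ h β k).mul hφ)
  simp_rw [e1]
  rw [← integral_sum_mul_mul (f := fun k x => r x k)
    (c := fun k x => co3 k (e2 β, h * dθ θ h β x)) (W := φ) j, ← integral_const_mul]
  have j1 : IntegrableOn (fun x => r x β.castSucc * φ x) ω :=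
    integrable_mul_plane hω hωb (hr _) hφ
  have j2 : IntegrableOn (fun x => h * (r x 2 * (dθ θ h β x * φ x))) ω :=
    (integrable_mul_plane hω hωb (hr 2) ((continuous_dθ hθ h β).mul hφ)).const_mul h
  rw [← integral_add j1 j2]
  simp_rw [sum_mul_co3_flat]
  congr 1; ext x; ring

theorem contDiff_θ₀ (hθ : ContDiff ℝ 2 θ) : ContDiff ℝ 2 (θ₀ θ) := hθ.sub contDiff_const

/-- Integration by parts with the C¹ test function θ₀(x'/h) φ. The h⁻¹ comes from differentiating
the fast variable; the factor h² of the corrector turns it into a term of size h. -/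
theorem integral_mul_θ₀_fderiv (hω : IsOpen ω) (hωb : Bornology.IsBounded ω)
    (hθ : ContDiff ℝ 2 θ) (h : ℝ) (β : Fin 2) {r : R2 → ℝ} {Dr : R2 → Fin 2 → ℝ}
    (hr : IntegrableOn r ω) (hDr : ∀ i, IntegrableOn (fun x => Dr x i) ω)
    (hw : ∀ i, IsWeakDeriv ω (e2 i) r (fun x => Dr x i)) {φ : R2 → ℝ}
    (hφ : φ ∈ testFunctions ω) :
    ∫ x in ω, r x * (θ₀ θ (h⁻¹ • x) * fderiv ℝ φ x (e2 β)) =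
      - (∫ x in ω, Dr x β * (θ₀ θ (h⁻¹ • x) * φ x)) -
        h⁻¹ * ∫ x in ω, r x * (dθ θ h β x * φ x) := by
  have hφ1 : ContDiff ℝ 1 φ := hφ.1.of_le (by norm_num)
  have hs : ContDiff ℝ 1 (fun x : R2 => θ₀ θ (h⁻¹ • x)) :=
    ((contDiff_θ₀ hθ).of_le (by norm_num)).comp (contDiff_id.const_smul h⁻¹)
  have hd : ∀ x, fderiv ℝ (fun x : R2 => θ₀ θ (h⁻¹ • x) * φ x) x (e2 β) =
      h⁻¹ * (dθ θ h β x * φ x) + θ₀ θ (h⁻¹ • x) * fderiv ℝ φ x (e2 β) := by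
    intro x
    have d0 : HasFDerivAt (fun x : R2 => h⁻¹ • x) (h⁻¹ • ContinuousLinearMap.id ℝ R2) x :=
      (hasFDerivAt_id x).const_smul h⁻¹
    have d1 : HasFDerivAt (fun x : R2 => θ₀ θ (h⁻¹ • x)) _ x :=
      HasFDerivAt.comp x (((hθ.differentiable two_ne_zero (h⁻¹ • x)).hasFDerivAt).sub_const _) d0
    have d2 := (d1.mul (hφ1.differentiable one_ne_zero x).hasFDerivAt).fderiv
    have d3 : fderiv ℝ (fun x : R2 => θ₀ θ (h⁻¹ • x) * φ x) x = _ := d2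
    rw [d3]
    simp [dθ]; ring
  have hC := integral_mul_fderiv_of_contDiff_one hω hr hDr hw (hs.mul hφ1) hφ.2.1.mul_left
    ((tsupport_mul_subset_right).trans hφ.2.2) β
  have hC' : ∫ x in ω, r x * fderiv ℝ (fun x : R2 => θ₀ θ (h⁻¹ • x) * φ x) x (e2 β) =
      - ∫ x in ω, Dr x β * (θ₀ θ (h⁻¹ • x) * φ x) := hC
  simp_rw [hd, mul_add, mul_left_comm _ h⁻¹] at hC'
  have j1 : IntegrableOn (fun x => r x * (dθ θ h β x * φ x)) ω :=
    integrable_mul_plane hω hωb hr ((continuous_dθ hθ h β).mul hφ1.continuous)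
  have j2 : IntegrableOn (fun x => r x * (θ₀ θ (h⁻¹ • x) * fderiv ℝ φ x (e2 β))) ω :=
    integrable_mul_plane hω hωb hr
      (hs.continuous.mul (continuous_fderiv_apply_of_testFunctions hφ _))
  rw [integral_add (j1.const_mul _) j2, integral_const_mul] at hC'
  linarith

theorem integral_coord_mul_fderiv (α β : Fin 2)
    {φ : R2 → ℝ} (hφ : φ ∈ testFunctions ω) :
    ∫ x in ω, x α * fderiv ℝ φ x (e2 β) =
      - ((1 : Matrix (Fin 2) (Fin 2) ℝ) α β * ∫ x in ω, φ x) := by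
  have hφ1 : ContDiff ℝ 1 φ := hφ.1.of_le (by norm_num)
  have z1 : ∀ x ∉ ω, x α * fderiv ℝ φ x (e2 β) = 0 := fun x hx => by
    rw [image_eq_zero_of_notMem_tsupport
      fun h => hx ((fderiv_apply_mem_testFunctions hφ (e2 β)).2.2 h), mul_zero]
  have z2 : ∀ x ∉ ω, φ x = 0 := fun x hx =>
    image_eq_zero_of_notMem_tsupport fun h => hx (hφ.2.2 h)
  rw [setIntegral_eq_integral_of_forall_compl_eq_zero z1,
    setIntegral_eq_integral_of_forall_compl_eq_zero z2]
  have hφ' := fderiv_apply_mem_testFunctions hφ (e2 β)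
  have hc : Continuous fun x : R2 => x α := continuous_apply α
  have key := integral_mul_fderiv_eq_neg_fderiv_mul_of_integrable (𝕜 := ℝ) (μ := volume)
    (f := fun x : R2 => x α) (g := φ) (v := e2 β)
    ?_ ((hc.mul hφ'.1.continuous).integrable_of_hasCompactSupport hφ'.2.1.mul_left)
    ((hc.mul hφ1.continuous).integrable_of_hasCompactSupport hφ.2.1.mul_left)
    (fun x _ => (ContinuousLinearMap.proj (R := ℝ) (φ := fun _ : Fin 2 => ℝ) α).differentiableAt)
    (fun x _ => hφ1.differentiable one_ne_zero x)
  · rw [key]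
    have e : ∀ x, fderiv ℝ (fun x : R2 => x α) x (e2 β) = (1 : Matrix (Fin 2) (Fin 2) ℝ) α β := by
      intro x
      have : fderiv ℝ (fun x : R2 => x α) x = ContinuousLinearMap.proj α :=
        (ContinuousLinearMap.proj (R := ℝ) (φ := fun _ : Fin 2 => ℝ) α).fderiv
      rw [this]
      simp [e2, Matrix.one_apply, Pi.single_apply]
    simp_rw [e, integral_const_mul]
  · have e : ∀ x, fderiv ℝ (fun x : R2 => x α) x (e2 β) =
        (ContinuousLinearMap.proj (R := ℝ) (φ := fun _ : Fin 2 => ℝ) α) (e2 β) := by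
      intro x
      have : fderiv ℝ (fun x : R2 => x α) x = ContinuousLinearMap.proj α :=
        (ContinuousLinearMap.proj (R := ℝ) (φ := fun _ : Fin 2 => ℝ) α).fderiv
      rw [this]
    simp_rw [e]
    exact (hφ1.continuous.integrable_of_hasCompactSupport hφ.2.1).const_mul _

/-- The in-plane identity: the weak derivative of the corrected in-plane displacement. -/
theorem in_plane_identity (hω : IsOpen ω) (hωb : Bornology.IsBounded ω)
    (hθ : ContDiff ℝ 2 θ) {h : ℝ} (hh : 0 < h) {y : R3 → Fin 3 → ℝ}
    {R : R2 → Matrix (Fin 3) (Fin 3) ℝ} {α : Fin 2} {f : R3 → Fin 3 → ℝ}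
    (hwi : IntegrableOn (fun x => y (Θ θ h (P h x)) α.castSucc) (plate₁ ω))
    (hf : ∀ k, IntegrableOn (fun x => f x k) (plate₁ ω))
    (hch : ChainRule θ ω h (fun x => y (Θ θ h (P h x)) α.castSucc) f)
    {DR : R2 → Fin 3 → Fin 2 → ℝ}
    (hr : ∀ k, IntegrableOn (fun x => R x α.castSucc k) ω)
    (hDr : ∀ k i, IntegrableOn (fun x => DR x k i) ω)
    (hw : ∀ k i, IsWeakDeriv ω (e2 i) (fun x => R x α.castSucc k) (fun x => DR x k i))
    (β : Fin 2) {Du : R2 → ℝ}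
    (hu : IntegrableOn (fun x => inPlaneDisp θ h y R x α) ω)
    (hDu : IsWeakDeriv ω (e2 β) (fun x => inPlaneDisp θ h y R x α) Du)
    {φ : R2 → ℝ} (hφ : φ ∈ testFunctions ω) :
    ∫ x in ω, Du x * φ x =
      (∑ k, ∫ x in plate₁ ω, ((f x k - R x.1 α.castSucc k) / h ^ 4) *
        (co3 k (tangent θ h β x) * φ x.1)) +
      (∫ x in ω, ((R x α.castSucc β.castSucc - (1 : Matrix (Fin 2) (Fin 2) ℝ) α β) / h ^ 4) * φ x)
      - ∫ x in ω, (DR x 2 β / h ^ 2) * (θ₀ θ (h⁻¹ • x) * φ x) := by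
  have h0 : h ≠ 0 := hh.ne'
  have hφ' := fderiv_apply_mem_testFunctions hφ (e2 β)
  have hφc := hφ.1.continuous
  have hs : Continuous (fun x : R2 => θ₀ θ (h⁻¹ • x)) :=
    (contDiff_θ₀ hθ).continuous.comp (continuous_id.const_smul h⁻¹)
  have A := hch.average hω hωb hθ hwi hf β hφ
  have e : ∀ x, (∫ t in (-1 / 2 : ℝ)..(1 / 2), y (Θ θ h (P h (x, t))) α.castSucc) *
      fderiv ℝ φ x (e2 β) = h ^ 4 * (inPlaneDisp θ h y R x α * fderiv ℝ φ x (e2 β)) +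
        x α * fderiv ℝ φ x (e2 β) +
        h ^ 2 * (R x α.castSucc 2 * (θ₀ θ (h⁻¹ • x) * fderiv ℝ φ x (e2 β))) := by
    intro x
    rw [inPlaneDisp]
    field_simp
    ring
  have hx : IntegrableOn (fun x : R2 => x α * fderiv ℝ φ x (e2 β)) ω :=
    ((continuous_apply α).mul hφ'.1.continuous).integrable_of_hasCompactSupport
      hφ'.2.1.mul_left |>.integrableOn
  have j1 : IntegrableOn (fun x => h ^ 4 * (inPlaneDisp θ h y R x α * fderiv ℝ φ x (e2 β))) ω :=
    (integrable_mul_plane hω hωb hu hφ'.1.continuous).const_mul _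
  have j2 : IntegrableOn (fun x =>
      h ^ 2 * (R x α.castSucc 2 * (θ₀ θ (h⁻¹ • x) * fderiv ℝ φ x (e2 β)))) ω :=
    (integrable_mul_plane hω hωb (hr 2) (hs.mul hφ'.1.continuous)).const_mul _
  simp_rw [e] at A
  have j3 : IntegrableOn (fun x => h ^ 4 * (inPlaneDisp θ h y R x α * fderiv ℝ φ x (e2 β)) +
      x α * fderiv ℝ φ x (e2 β)) ω := j1.add hx
  rw [integral_add j3 j2, integral_add j1 hx, integral_const_mul, integral_const_mul,
    hDu φ hφ.1 hφ.2.1 hφ.2.2, integral_coord_mul_fderiv α β hφ,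
    integral_mul_θ₀_fderiv hω hωb hθ h β (hr 2) (hDr 2) (hw 2) hφ] at A
  -- The term h ∫ R_{α3} ∂_βθ φ occurring here is the one that the corrector in the displacement
  -- produced in `A`. Their cancellation is the reason for the corrector.
  have B := sum_integral_plane_tangent hω hωb hθ h β (r := fun x k => R x α.castSucc k) hr hφc
  have w1 : ∀ k, Continuous fun x : R3 => co3 k (tangent θ h β x) * φ x.1 :=
    fun k => (continuous_co3_tangent hθ h β k).mul (hφc.comp continuous_fst)
  have L1 := fun k => integral_sub_div_mul (f := fun x : R3 => f x k)
    (r := fun x : R3 => R x.1 α.castSucc k) (W := fun x => co3 k (tangent θ h β x) * φ x.1)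
    (h ^ 4) (integrable_mul_plate₁ hω hωb (hf k) (w1 k))
    (integrable_mul_plate₁ hω hωb (integrable_fst_plate₁ (hr k)) (w1 k))
  have hφi : IntegrableOn φ ω := (hφc.integrable_of_hasCompactSupport hφ.2.1).integrableOn
  have L2 := integral_sub_div_mul (μ := (volume : Measure R2).restrict ω)
    (f := fun x => R x α.castSucc β.castSucc)
    (r := fun _ => (1 : Matrix (Fin 2) (Fin 2) ℝ) α β) (W := φ)
    (h ^ 4) (integrable_mul_plane hω hωb (hr _) hφc) (hφi.const_mul _)
  rw [integral_const_mul] at L2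
  have L3 := integral_div_mul (μ := (volume : Measure R2).restrict ω)
    (fun x => DR x 2 β) (fun x => θ₀ θ (h⁻¹ • x) * φ x) (h ^ 2)
  simp_rw [L1]
  rw [L2, L3, ← Finset.sum_div, Finset.sum_sub_distrib, B]
  have A' := neg_injective (a₁ := ∑ k, ∫ x in plate₁ ω, f x k * (co3 k (tangent θ h β x) * φ x.1))
    (a₂ := _) (A.symm.trans (neg_neg _).symm)
  rw [A']
  field_simp
  ring

end WrinkledPlate

namespace WrinkledPlate

/-! ### Limits of the integral identities -/

section Limits

variable {X : Type*} [MeasurableSpace X] {μ : Measure X}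

theorem enorm_integral_mul_le_of_bound {F W : X → ℝ} {c : ℝ} (hW : ∀ᵐ x ∂μ, |W x| ≤ c) :
    ‖∫ x, F x * W x ∂μ‖ₑ ≤ ENNReal.ofReal c * eLpNorm F 1 μ := by
  refine (enorm_integral_le_eLpNorm_one _).trans (eLpNorm_le_mul_eLpNorm_of_ae_le_mul ?_ 1)
  filter_upwards [hW] with x hx
  rw [norm_mul, mul_comm, Real.norm_eq_abs (W x)]
  exact mul_le_mul_of_nonneg_right hx (norm_nonneg _)

theorem tendsto_integral_mul_zero_of_bound {F W : ℕ → X → ℝ} {C : ENNReal} (hC : C ≠ ⊤)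
    (hF : ∀ n, eLpNorm (F n) 1 μ ≤ C) {c : ℕ → ℝ} (hc : Tendsto c atTop (𝓝 0))
    (hW : ∀ᶠ n in atTop, ∀ᵐ x ∂μ, |W n x| ≤ c n) :
    Tendsto (fun n => ∫ x, F n x * W n x ∂μ) atTop (𝓝 0) := by
  refine tendsto_zero_of_enorm_le (b := fun n => ENNReal.ofReal (c n) * C) ?_ ?_
  · filter_upwards [hW] with n hn
    exact (enorm_integral_mul_le_of_bound hn).trans (by gcongr; exact hF n)
  · have := ENNReal.Tendsto.mul_const (b := C) (ENNReal.tendsto_ofReal hc) (Or.inr hC)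
    rwa [ENNReal.ofReal_zero, zero_mul] at this

theorem tendsto_integral_mul_zero_of_eLpNorm {F W : ℕ → X → ℝ}
    (hF : Tendsto (fun n => eLpNorm (F n) 1 μ) atTop (𝓝 0)) {c : ℝ}
    (hW : ∀ n, ∀ᵐ x ∂μ, |W n x| ≤ c) :
    Tendsto (fun n => ∫ x, F n x * W n x ∂μ) atTop (𝓝 0) := by
  refine tendsto_zero_of_enorm_le (b := fun n => ENNReal.ofReal c * eLpNorm (F n) 1 μ)
    (Eventually.of_forall fun n => enorm_integral_mul_le_of_bound (hW n)) ?_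
  have := ENNReal.Tendsto.const_mul (a := ENNReal.ofReal c) hF (Or.inr ENNReal.ofReal_ne_top)
  rwa [mul_zero] at this

/-- Replacing uniformly convergent coefficients by their constant limit. -/
theorem tendsto_integral_mul_coeff {F a W : ℕ → X → ℝ} {C : ENNReal} (hC : C ≠ ⊤)
    (hF : ∀ n, Integrable (F n) μ) (hFC : ∀ n, eLpNorm (F n) 1 μ ≤ C)
    (ha : ∀ n, AEStronglyMeasurable (a n) μ) (hW : ∀ n, AEStronglyMeasurable (W n) μ) {B : ℝ}
    (hWB : ∀ n, ∀ᵐ x ∂μ, |W n x| ≤ B) {c : ℕ → ℝ} (hc : Tendsto c atTop (𝓝 0)) {δ : ℝ}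
    (hac : ∀ᶠ n in atTop, ∀ᵐ x ∂μ, |a n x - δ| ≤ c n) {L : ℝ}
    (hL : δ ≠ 0 → Tendsto (fun n => ∫ x, F n x * W n x ∂μ) atTop (𝓝 L)) :
    Tendsto (fun n => ∫ x, F n x * (a n x * W n x) ∂μ) atTop (𝓝 (δ * L)) := by
  have hL' : Tendsto (fun n => δ * ∫ x, F n x * W n x ∂μ) atTop (𝓝 (δ * L)) := by
    -- With a vanishing limit coefficient the L¹ bound on F alone suffices, so components that
    -- disappear in the limit need no limit of their own.
    by_cases h : δ = 0
    · simp [h]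
    · exact (hL h).const_mul δ
  have hb : ∀ᶠ n in atTop, ∀ᵐ x ∂μ, |(a n x - δ) * W n x| ≤ c n * B := by
    filter_upwards [hac] with n hn
    filter_upwards [hn, hWB n] with x hx hx'
    rw [abs_mul]
    exact mul_le_mul hx hx' (abs_nonneg _) ((abs_nonneg _).trans hx)
  have hz := tendsto_integral_mul_zero_of_bound hC hFC
    (by simpa using hc.mul_const B : Tendsto (fun n => c n * B) atTop (𝓝 0)) hb
  have := hz.add hL'
  rw [zero_add] at this
  refine this.congr' ?_
  filter_upwards [hb] with n hn
  have i1 : Integrable (fun x => F n x * ((a n x - δ) * W n x)) μ :=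
    (hF n).mul_bdd (((ha n).sub aestronglyMeasurable_const).mul (hW n)) hn
  have i2 : Integrable (fun x => F n x * W n x) μ := (hF n).mul_bdd (hW n) (hWB n)
  rw [← integral_const_mul, ← integral_add i1 (i2.const_mul δ)]
  congr 1; ext x; ring

theorem exists_eLpNorm_one_le [IsFiniteMeasure μ] {C : ENNReal} (hC : C ≠ ⊤) :
    ∃ C' : ENNReal, C' ≠ ⊤ ∧ ∀ F : X → ℝ, AEStronglyMeasurable F μ → eLpNorm F 2 μ ≤ C →
      eLpNorm F 1 μ ≤ C' := by
  refine ⟨C * μ Set.univ ^ (1 / (1 : ENNReal).toReal - 1 / (2 : ENNReal).toReal), ?_,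
    fun F hF hFC => (eLpNorm_le_eLpNorm_mul_rpow_measure_univ one_le_two hF).trans
      (by gcongr)⟩
  refine ENNReal.mul_ne_top hC (ENNReal.rpow_ne_top_of_nonneg (by norm_num) (measure_ne_top _ _))

end Limits

variable {θ : R2 → ℝ} {ω : Set R2}

theorem co3_flat (k : Fin 3) (β : Fin 2) :
    co3 k ((e2 β, 0) : R3) = if k = β.castSucc then 1 else 0 := by
  fin_cases k <;> fin_cases β <;> simp [co3, e2]

theorem co3_vertical (k : Fin 3) : co3 k ((0, 1) : R3) = if k = 2 then 1 else 0 := by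
  fin_cases k <;> simp [co3]

theorem abs_snd_le_of_mem_plate₁ {x : R3} (hx : x ∈ plate₁ ω) : |x.2| ≤ 1 := by
  have h := hx.2
  rw [Set.mem_Ioo] at h
  rw [abs_le]
  constructor <;> linarith [h.1, h.2]

/-- The frame of the wrinkled plate is uniformly close to the standard frame. -/
theorem exists_frame_bound (hθ : ContDiff ℝ 2 θ) (hper : IsYPeriodic θ) :
    ∃ M : ℝ, 0 ≤ M ∧ ∀ h, 0 < h → h ≤ 1 → ∀ k,
      (∀ β (x : R3), |x.2| ≤ 1 →
        |co3 k (tangent θ h β x) - if k = β.castSucc then 1 else 0| ≤ M * h) ∧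
      ∀ x, |co3 k (normal θ h x) - if k = 2 then 1 else 0| ≤ M * h := by
  obtain ⟨M, hM, -, hdθ, hn⟩ := exists_geometry_bound hθ hper
  refine ⟨2 * M, by linarith, fun h hh h1 k => ⟨fun β x hx => ?_, fun x => ?_⟩⟩
  · rw [← co3_flat, ← map_sub]
    refine (abs_co3_le _ _).trans ?_
    have e : tangent θ h β x - ((e2 β, 0) : R3) = ((0, h * dθ θ h β x.1) : R3) +
        (h ^ 2 * x.2) • fderiv ℝ (normal θ h) x.1 (e2 β) := by
      rw [tangent, add_sub_right_comm]
      congr 1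
      ext <;> simp
    rw [e]
    have n1 : ‖((0, h * dθ θ h β x.1) : R3)‖ ≤ h * M := by
      have : |dθ θ h β x.1| ≤ M := by
        have := (fderiv ℝ θ (h⁻¹ • x.1)).le_of_opNorm_le (hdθ _) (e2 β)
        exact this.trans (mul_le_of_le_one_right hM (norm_e2 β))
      rw [Prod.norm_mk, norm_zero, norm_mul, Real.norm_of_nonneg hh.le, Real.norm_eq_abs]
      exact max_le (by positivity) (by gcongr)
    have n2 : ‖(h ^ 2 * x.2) • fderiv ℝ (normal θ h) x.1 (e2 β)‖ ≤ h * M := by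
      have a1 := (fderiv ℝ (normal θ h) x.1).le_of_opNorm_le ((hn h hh h1 x.1).1) (e2 β)
      have a2 : ‖fderiv ℝ (normal θ h) x.1 (e2 β)‖ ≤ M :=
        a1.trans (mul_le_of_le_one_right hM (norm_e2 β))
      rw [norm_smul, norm_mul, Real.norm_of_nonneg (by positivity), Real.norm_eq_abs]
      have a3 : h ^ 2 * |x.2| ≤ h * 1 := by
        rw [pow_two, mul_assoc]
        gcongr
        exact mul_le_one₀ h1 (abs_nonneg _) hx
      calc h ^ 2 * |x.2| * _ ≤ h * 1 * M := by gcongr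
        _ = h * M := by ring
    linarith [norm_add_le ((0, h * dθ θ h β x.1) : R3)
      ((h ^ 2 * x.2) • fderiv ℝ (normal θ h) x.1 (e2 β))]
  · rw [← co3_vertical, ← map_sub]
    refine (abs_co3_le _ _).trans ((hn h hh h1 x).2.trans ?_)
    nlinarith

/-- The oscillating test functions. -/
theorem mul_periodic_mem_testFunctions {φ : R2 → ℝ} (hφ : φ ∈ testFunctions ω) {g : R2 → ℝ}
    (hg : g ∈ smoothPeriodic) (h : ℝ) : (fun x => φ x * g (h⁻¹ • x)) ∈ testFunctions ω :=
  ⟨hφ.1.mul (hg.1.comp (contDiff_id.const_smul h⁻¹)), hφ.2.1.mul_right,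
    (tsupport_mul_subset_left).trans hφ.2.2⟩

theorem fderiv_apply_mem_smoothPeriodic {g : R2 → ℝ} (hg : g ∈ smoothPeriodic) (e : R2) :
    (fun y => fderiv ℝ g y e) ∈ smoothPeriodic :=
  ⟨(hg.1.fderiv_right (by simp)).clm_apply contDiff_const, fun i y => by
    simp only [fderiv_periodic (hg.2 i)]⟩

/-- Only the derivative falling on the oscillating factor produces h⁻¹; for h ≤ 1 the other term is
absorbed because h⁻¹ ≥ 1. -/
theorem exists_bound_fderiv_mul_periodic {φ : R2 → ℝ} (hφ : φ ∈ testFunctions ω) {g : R2 → ℝ}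
    (hg : g ∈ smoothPeriodic) (e : R2) : ∃ B : ℝ, 0 ≤ B ∧ ∀ h, 0 < h → h ≤ 1 → ∀ x,
      |fderiv ℝ (fun x => φ x * g (h⁻¹ • x)) x e| ≤ B * h⁻¹ := by
  obtain ⟨a, ha⟩ := testFunctions_bounded hφ
  obtain ⟨b, hb⟩ := testFunctions_bounded (fderiv_apply_mem_testFunctions hφ e)
  obtain ⟨c, hc⟩ := smoothPeriodic_bounded hg
  obtain ⟨d, hd⟩ := smoothPeriodic_bounded (fderiv_apply_mem_smoothPeriodic hg e)
  have ha0 := (abs_nonneg _).trans (ha 0)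
  have hb0 := (abs_nonneg _).trans (hb 0)
  have hc0 := (abs_nonneg _).trans (hc 0)
  have hd0 := (abs_nonneg _).trans (hd 0)
  refine ⟨a * d + b * c, by positivity, fun h hh h1 x => ?_⟩
  have d0 : HasFDerivAt (fun x : R2 => h⁻¹ • x) (h⁻¹ • ContinuousLinearMap.id ℝ R2) x :=
    (hasFDerivAt_id x).const_smul h⁻¹
  have d1 : HasFDerivAt (fun x : R2 => g (h⁻¹ • x)) _ x :=
    HasFDerivAt.comp x ((hg.1.differentiable (by simp) (h⁻¹ • x)).hasFDerivAt) d0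
  have d2 := ((hφ.1.differentiable (by simp) x).hasFDerivAt.mul d1).fderiv
  have d3 : fderiv ℝ (fun x : R2 => φ x * g (h⁻¹ • x)) x e =
      φ x * (h⁻¹ * fderiv ℝ g (h⁻¹ • x) e) + g (h⁻¹ • x) * fderiv ℝ φ x e := by
    have d4 : fderiv ℝ (fun x : R2 => φ x * g (h⁻¹ • x)) x = _ := d2
    rw [d4]
    simp
  have hi : 1 ≤ h⁻¹ := (one_le_inv₀ hh).2 h1
  rw [d3]
  calc _ ≤ |φ x * (h⁻¹ * fderiv ℝ g (h⁻¹ • x) e)| + |g (h⁻¹ • x) * fderiv ℝ φ x e| :=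
        abs_add_le _ _
    _ = |φ x| * (h⁻¹ * |fderiv ℝ g (h⁻¹ • x) e|) + |g (h⁻¹ • x)| * |fderiv ℝ φ x e| := by
        rw [abs_mul, abs_mul, abs_mul, abs_of_pos (inv_pos.2 hh)]
    _ ≤ a * (h⁻¹ * d) + c * b := by
        gcongr
        exacts [ha x, hd _, hc _, hb x]
    _ ≤ (a * d + b * c) * h⁻¹ := by nlinarith [mul_nonneg hb0 hc0]

end WrinkledPlate

/-! ### Passing to the limit in the transverse and the in-plane identity -/

namespace WrinkledPlate

variable {θ : R2 → ℝ} {ω : Set R2}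

theorem measurePreserving_fst_plate₁ (ω : Set R2) : MeasurePreserving (Prod.fst : R3 → R2)
    ((volume : Measure R3).restrict (plate₁ ω)) (volume.restrict ω) := by
  rw [restrict_plate₁]
  exact measurePreserving_fst

theorem eLpNorm_fst_plate₁ {f : R2 → ℝ} (hf : AEStronglyMeasurable f (volume.restrict ω))
    (p : ENNReal) : eLpNorm (fun x : R3 => f x.1) p (volume.restrict (plate₁ ω)) =
      eLpNorm f p (volume.restrict ω) :=
  eLpNorm_comp_measurePreserving hf (measurePreserving_fst_plate₁ ω)

theorem memLp_fst_plate₁ {f : R2 → ℝ} {p : ENNReal} (hf : MemLp f p (volume.restrict ω)) :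
    MemLp (fun x : R3 => f x.1) p (volume.restrict (plate₁ ω)) :=
  hf.comp_measurePreserving (measurePreserving_fst_plate₁ ω)

theorem ae_plate₁_of_ae {p : R2 → Prop} (hp : ∀ᵐ x ∂(volume.restrict ω), p x) :
    ∀ᵐ x : R3 ∂(volume.restrict (plate₁ ω)), p x.1 :=
  (measurePreserving_fst_plate₁ ω).quasiMeasurePreserving.ae hp

theorem frame_bounds (hω : IsOpen ω) (hθ : ContDiff ℝ 2 θ) (hper : IsYPeriodic θ) {h : ℕ → ℝ}
    (h_pos : ∀ n, 0 < h n) (h_lim : Tendsto h atTop (𝓝 0)) :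
    ∃ c : ℕ → ℝ, Tendsto c atTop (𝓝 0) ∧ ∀ k,
      (∀ β, ∀ᶠ n in atTop, ∀ᵐ x : R3 ∂(volume.restrict (plate₁ ω)),
        |co3 k (tangent θ (h n) β x) - if k = β.castSucc then 1 else 0| ≤ c n) ∧
      ∀ᶠ n in atTop, ∀ x, |co3 k (normal θ (h n) x) - if k = 2 then 1 else 0| ≤ c n := by
  obtain ⟨M, hM, hb⟩ := exists_frame_bound hθ hper
  refine ⟨fun n => M * h n, by simpa using h_lim.const_mul M, fun k => ⟨fun β => ?_, ?_⟩⟩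
  · filter_upwards [h_lim.eventually_le_const one_pos] with n hn
    filter_upwards [ae_restrict_mem (isOpen_plate hω 1).measurableSet] with x hx
    exact (hb (h n) (h_pos n) hn k).1 β x (abs_snd_le_of_mem_plate₁ hx)
  · filter_upwards [h_lim.eventually_le_const one_pos] with n hn x
    exact (hb (h n) (h_pos n) hn k).2 x

/-- The terms of the transverse identity carrying a derivative of the test function vanish in the
limit. -/
theorem tendsto_transverse_remainder (hω : IsOpen ω)
    (hθ : ContDiff ℝ 2 θ) (hper : IsYPeriodic θ) {h : ℕ → ℝ} (h_pos : ∀ n, 0 < h n)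
    (h_lim : Tendsto h atTop (𝓝 0)) {F : ℕ → R3 → ℝ} {C : ENNReal} (hC : C ≠ ⊤)
    (hFC : ∀ n, eLpNorm (F n) 1 (volume.restrict (plate₁ ω)) ≤ C) (k : Fin 3) (β : Fin 2)
    {φ : R2 → ℝ} (hφ : φ ∈ testFunctions ω) {g : R2 → ℝ} (hg : g ∈ smoothPeriodic)
    {η : ℝ → ℝ} (hη : η ∈ testFunctions thick) :
    Tendsto (fun n => h n ^ 2 * ∫ x in plate₁ ω, F n x * (co3 k (normal θ (h n) x.1) *
      (fderiv ℝ (fun x => φ x * g ((h n)⁻¹ • x)) x.1 (e2 β) * η x.2))) atTop (𝓝 0) := by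
  obtain ⟨c, hc, hb⟩ := frame_bounds hω hθ hper h_pos h_lim
  obtain ⟨B, hB, hφg⟩ := exists_bound_fderiv_mul_periodic hφ hg (e2 β)
  obtain ⟨E, hE⟩ := testFunctions_bounded hη
  have hE0 : 0 ≤ E := (abs_nonneg _).trans (hE 0)
  -- The factor h² is moved into the test function: h² times the h⁻¹ lost by differentiation leaves
  -- h, which outweighs bounded quantities.
  have key := tendsto_integral_mul_zero_of_bound (μ := (volume : Measure R3).restrict (plate₁ ω))
    (F := F) (W := fun n x => h n ^ 2 * (co3 k (normal θ (h n) x.1) *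
      (fderiv ℝ (fun x => φ x * g ((h n)⁻¹ • x)) x.1 (e2 β) * η x.2)))
    hC hFC (c := fun n => h n * ((1 + c n) * (B * E))) ?_ ?_
  · refine key.congr fun n => ?_
    rw [← integral_const_mul]
    congr 1; ext x; ring
  · have := h_lim.mul ((hc.const_add 1).mul_const (B * E))
    rwa [zero_mul] at this
  · filter_upwards [(hb k).2, h_lim.eventually_le_const one_pos] with n hn h1
    refine ae_of_all _ fun x => ?_
    have hpos := h_pos n
    have n1 : |co3 k (normal θ (h n) x.1)| ≤ 1 + c n := by
      have a := hn x.1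
      split_ifs at a
      · have := abs_sub_abs_le_abs_sub (co3 k (normal θ (h n) x.1)) 1
        rw [abs_one] at this
        linarith
      · rw [sub_zero] at a
        linarith
    have n0 : 0 ≤ 1 + c n := (abs_nonneg _).trans n1
    rw [abs_mul, abs_mul, abs_mul, abs_of_pos (pow_pos hpos 2)]
    calc h n ^ 2 * (|co3 k (normal θ (h n) x.1)| *
          (|fderiv ℝ (fun x => φ x * g ((h n)⁻¹ • x)) x.1 (e2 β)| * |η x.2|))
        ≤ h n ^ 2 * ((1 + c n) * ((B * (h n)⁻¹) * E)) := by
          gcongr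
          exacts [hφg _ hpos h1 _, hE _]
      _ = h n * ((1 + c n) * (B * E)) := by field_simp

/-- The tangent tends uniformly to e_β, so in the sum over k only the component β survives. -/
theorem tendsto_tangent_term (hω : IsOpen ω)
    (hθ : ContDiff ℝ 2 θ) (hper : IsYPeriodic θ) {h : ℕ → ℝ} (h_pos : ∀ n, 0 < h n)
    (h_lim : Tendsto h atTop (𝓝 0)) {H : ℕ → R3 → Fin 3 → ℝ} {C : ENNReal} (hC : C ≠ ⊤)
    (β : Fin 2) (hH : ∀ n k, IntegrableOn (fun x => H n x k) (plate₁ ω))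
    (hHC : ∀ n k, eLpNorm (fun x => H n x k) 1 (volume.restrict (plate₁ ω)) ≤ C)
    {W : ℕ → R3 → ℝ} (hW : ∀ n, Continuous (W n)) {B : ℝ} (hB : ∀ n x, |W n x| ≤ B) {L : ℝ}
    (hL : Tendsto (fun n => ∫ x in plate₁ ω, H n x β.castSucc * W n x) atTop (𝓝 L)) (k : Fin 3) :
    Tendsto (fun n => ∫ x in plate₁ ω, H n x k * (co3 k (tangent θ (h n) β x) * W n x)) atTop
      (𝓝 ((if k = β.castSucc then 1 else 0) * L)) := by
  obtain ⟨c, hc, hb⟩ := frame_bounds hω hθ hper h_pos h_lim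
  refine tendsto_integral_mul_coeff (μ := (volume : Measure R3).restrict (plate₁ ω))
    (F := fun n x => H n x k) (a := fun n x => co3 k (tangent θ (h n) β x))
    (W := W) hC (fun n => hH n k) (fun n => hHC n k)
    (fun n => (continuous_co3_tangent hθ _ β k).aestronglyMeasurable)
    (fun n => (hW n).aestronglyMeasurable)
    (fun n => ae_of_all _ (hB n)) hc ((hb k).1 β) fun hk => ?_
  have hk' : k = β.castSucc := by
    by_contra hne; simp [hne] at hk
  rw [hk']
  exact hL

/-- Same mechanism with the normal tending to e₃. This is why only the third column of the rotation
enters the limit. -/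
theorem tendsto_normal_term (hω : IsOpen ω)
    (hθ : ContDiff ℝ 2 θ) (hper : IsYPeriodic θ) {h : ℕ → ℝ} (h_pos : ∀ n, 0 < h n)
    (h_lim : Tendsto h atTop (𝓝 0)) {D : ℕ → R3 → Fin 3 → ℝ} {C : ENNReal} (hC : C ≠ ⊤)
    (hD : ∀ n k, IntegrableOn (fun x => D n x k) (plate₁ ω))
    (hDC : ∀ n k, eLpNorm (fun x => D n x k) 1 (volume.restrict (plate₁ ω)) ≤ C)
    {W : ℕ → R3 → ℝ} (hW : ∀ n, Continuous (W n)) {B : ℝ} (hB : ∀ n x, |W n x| ≤ B) {L : ℝ}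
    (hL : Tendsto (fun n => ∫ x in plate₁ ω, D n x 2 * W n x) atTop (𝓝 L)) (k : Fin 3) :
    Tendsto (fun n => ∫ x in plate₁ ω, D n x k * (co3 k (normal θ (h n) x.1) * W n x)) atTop
      (𝓝 ((if k = 2 then 1 else 0) * L)) := by
  obtain ⟨c, hc, hb⟩ := frame_bounds hω hθ hper h_pos h_lim
  have hn : ∀ᶠ n in atTop, ∀ᵐ x : R3 ∂(volume.restrict (plate₁ ω)),
      |co3 k (normal θ (h n) x.1) - if k = 2 then 1 else 0| ≤ c n := by
    filter_upwards [(hb k).2] with n hn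
    exact ae_of_all _ fun x => hn x.1
  have hm : ∀ n, Continuous fun x : R3 => co3 k (normal θ (h n) x.1) := fun n =>
    (continuous_co3_normal hθ (h n) k).comp continuous_fst
  refine tendsto_integral_mul_coeff (μ := (volume : Measure R3).restrict (plate₁ ω))
    (F := fun n x => D n x k) (a := fun n x => co3 k (normal θ (h n) x.1))
    (W := W) hC (fun n => hD n k) (fun n => hDC n k)
    (fun n => (hm n).aestronglyMeasurable)
    (fun n => (hW n).aestronglyMeasurable)
    (fun n => ae_of_all _ (hB n)) hc hn fun hk => ?_
  have hk' : k = 2 := by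
    by_contra hne; simp [hne] at hk
  rw [hk']
  exact hL

/-- The limit of the transverse identity. -/
theorem transverse_limit (hω : IsOpen ω)
    (hθ : ContDiff ℝ 2 θ) (hper : IsYPeriodic θ) {h : ℕ → ℝ} (h_pos : ∀ n, 0 < h n)
    (h_lim : Tendsto h atTop (𝓝 0)) {H : ℕ → R3 → Fin 3 → ℝ} {D : ℕ → R2 → Fin 3 → ℝ}
    {C C' : ENNReal} (hC : C ≠ ⊤) (hC' : C' ≠ ⊤) (β : Fin 2)
    (hH : ∀ n k, IntegrableOn (fun x => H n x k) (plate₁ ω))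
    (hHC : ∀ n k, eLpNorm (fun x => H n x k) 1 (volume.restrict (plate₁ ω)) ≤ C)
    (hD : ∀ n k, IntegrableOn (fun x => D n x k) ω)
    (hDC : ∀ n k, eLpNorm (fun x => D n x k) 1 (volume.restrict ω) ≤ C')
    {φ : R2 → ℝ} (hφ : φ ∈ testFunctions ω) {g : R2 → ℝ} (hg : g ∈ smoothPeriodic)
    {η : ℝ → ℝ} (hη : η ∈ testFunctions thick)
    (hid : ∀ᶠ n in atTop, ∀ φ ∈ testFunctions ω,
      ∑ k, ∫ x in plate₁ ω, H n x k * (co3 k (tangent θ (h n) β x) * (φ x.1 * deriv η x.2)) =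
      ∑ k, (h n ^ 2 * (∫ x in plate₁ ω, H n x k *
          (co3 k (normal θ (h n) x.1) * (fderiv ℝ φ x.1 (e2 β) * η x.2))) -
        ∫ x in plate₁ ω, D n x.1 k * (co3 k (normal θ (h n) x.1) * (φ x.1 * η x.2))))
    {L L' : ℝ}
    (hL : Tendsto (fun n => ∫ x in plate₁ ω, H n x β.castSucc *
      (φ x.1 * deriv η x.2 * g ((h n)⁻¹ • x.1))) atTop (𝓝 L))
    (hL' : Tendsto (fun n => ∫ x in ω, D n x 2 * (φ x * g ((h n)⁻¹ • x))) atTop (𝓝 L')) :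
    L = - (L' * ∫ t in thick, η t) := by
  obtain ⟨a, ha⟩ := testFunctions_bounded hφ
  obtain ⟨b, hb'⟩ := smoothPeriodic_bounded hg
  obtain ⟨d, hd⟩ := testFunctions_bounded hη
  obtain ⟨d', hd'⟩ := testFunctions_bounded (deriv_mem_testFunctions hη)
  have ha0 := (abs_nonneg _).trans (ha 0)
  have hb0 := (abs_nonneg _).trans (hb' 0)
  have hgc : ∀ n, Continuous fun x : R3 => g ((h n)⁻¹ • x.1) := fun n =>
    hg.1.continuous.comp ((continuous_const_smul (h n)⁻¹).comp continuous_fst)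
  have hφc : Continuous fun x : R3 => φ x.1 := hφ.1.continuous.comp continuous_fst
  have hηc : Continuous fun x : R3 => η x.2 := hη.1.continuous.comp continuous_snd
  have hηc' : Continuous fun x : R3 => deriv η x.2 :=
    (deriv_mem_testFunctions hη).1.continuous.comp continuous_snd
  have hW1 : ∀ n, Continuous fun x : R3 => φ x.1 * g ((h n)⁻¹ • x.1) * deriv η x.2 := fun n =>
    (hφc.mul (hgc n)).mul hηc'
  have hW2 : ∀ n, Continuous fun x : R3 => φ x.1 * g ((h n)⁻¹ • x.1) * η x.2 := fun n =>
    (hφc.mul (hgc n)).mul hηc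
  have hB1 : ∀ n (x : R3), |φ x.1 * g ((h n)⁻¹ • x.1) * deriv η x.2| ≤ a * b * d' := by
    intro n x
    rw [abs_mul, abs_mul]
    have := ha x.1
    have := hb' ((h n)⁻¹ • x.1)
    have := hd' x.2
    gcongr
  have hB2 : ∀ n (x : R3), |φ x.1 * g ((h n)⁻¹ • x.1) * η x.2| ≤ a * b * d := by
    intro n x
    rw [abs_mul, abs_mul]
    have := ha x.1
    have := hb' ((h n)⁻¹ • x.1)
    have := hd x.2
    gcongr
  have hL1 : Tendsto (fun n => ∫ x in plate₁ ω, H n x β.castSucc *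
      (φ x.1 * g ((h n)⁻¹ • x.1) * deriv η x.2)) atTop (𝓝 L) := by
    refine hL.congr fun n => ?_
    congr 1; ext x; ring
  have hL2 : Tendsto (fun n => ∫ x in plate₁ ω, D n x.1 2 *
      (φ x.1 * g ((h n)⁻¹ • x.1) * η x.2)) atTop (𝓝 (L' * ∫ t in thick, η t)) := by
    refine (hL'.mul_const (∫ t in thick, η t)).congr fun n => ?_
    rw [← integral_plate₁_mul]
    congr 1; ext x; ring
  have hD3 : ∀ n k, IntegrableOn (fun x : R3 => D n x.1 k) (plate₁ ω) := fun n k =>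
    integrable_fst_plate₁ (hD n k)
  have hDC3 : ∀ n k, eLpNorm (fun x : R3 => D n x.1 k) 1 (volume.restrict (plate₁ ω)) ≤ C' :=
    fun n k => (eLpNorm_fst_plate₁ (hD n k).1 1).trans_le (hDC n k)
  have T1 := tendsto_tangent_term hω hθ hper h_pos h_lim hC β hH hHC hW1 hB1 hL1
  have T3 := tendsto_normal_term hω hθ hper h_pos h_lim hC' (D := fun n x k => D n x.1 k)
    hD3 hDC3 hW2 hB2 hL2
  have T2 : ∀ k, Tendsto (fun n => h n ^ 2 * ∫ x in plate₁ ω, H n x k *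
      (co3 k (normal θ (h n) x.1) *
      (fderiv ℝ (fun x => φ x * g ((h n)⁻¹ • x)) x.1 (e2 β) * η x.2))) atTop (𝓝 0) := fun k =>
    tendsto_transverse_remainder hω hθ hper h_pos h_lim hC (F := fun n x => H n x k)
      (fun n => hHC n k) k β hφ hg hη
  have S1 := tendsto_finsetSum Finset.univ fun k _ => T1 k
  have S2 := tendsto_finsetSum Finset.univ fun k _ => (T2 k).sub (T3 k)
  -- Both sides of the identity are now known to converge when it is tested with φ(x') g(x'/h).
  have := tendsto_nhds_unique (S1.congr' ?_) S2
  · simpa using this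
  · filter_upwards [hid] with n hn
    exact hn _ (mul_periodic_mem_testFunctions hφ hg (h n))

/-- The limit of the in-plane identity. -/
theorem in_plane_limit (hω : IsOpen ω)
    (hθ : ContDiff ℝ 2 θ) (hper : IsYPeriodic θ) {h : ℕ → ℝ} (h_pos : ∀ n, 0 < h n)
    (h_lim : Tendsto h atTop (𝓝 0)) {H : ℕ → R3 → Fin 3 → ℝ} {U S D : ℕ → R2 → ℝ}
    {C : ENNReal} (hC : C ≠ ⊤) (β : Fin 2)
    (hH : ∀ n k, IntegrableOn (fun x => H n x k) (plate₁ ω))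
    (hHC : ∀ n k, eLpNorm (fun x => H n x k) 1 (volume.restrict (plate₁ ω)) ≤ C)
    {φ : R2 → ℝ} (hφ : φ ∈ testFunctions ω) {g : R2 → ℝ} (hg : g ∈ smoothPeriodic)
    (hid : ∀ᶠ n in atTop, ∀ φ ∈ testFunctions ω, ∫ x in ω, U n x * φ x =
      (∑ k, ∫ x in plate₁ ω, H n x k * (co3 k (tangent θ (h n) β x) * φ x.1)) +
      (∫ x in ω, S n x * φ x) - ∫ x in ω, D n x * (θ₀ θ ((h n)⁻¹ • x) * φ x))
    {L L' L'' : ℝ}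
    (hL : Tendsto (fun n => ∫ x in plate₁ ω, H n x β.castSucc *
      (φ x.1 * g ((h n)⁻¹ • x.1))) atTop (𝓝 L))
    (hL' : Tendsto (fun n => ∫ x in ω, D n x * (φ x * (θ₀ θ ((h n)⁻¹ • x) * g ((h n)⁻¹ • x))))
      atTop (𝓝 L'))
    (hL'' : Tendsto (fun n => ∫ x in ω, U n x * (φ x * g ((h n)⁻¹ • x))) atTop (𝓝 L'')) :
    Tendsto (fun n => ∫ x in ω, S n x * (φ x * g ((h n)⁻¹ • x))) atTop (𝓝 (L'' - L + L')) := by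
  obtain ⟨a, ha⟩ := testFunctions_bounded hφ
  obtain ⟨b, hb'⟩ := smoothPeriodic_bounded hg
  have ha0 := (abs_nonneg _).trans (ha 0)
  have hgc : ∀ n, Continuous fun x : R3 => g ((h n)⁻¹ • x.1) := fun n =>
    hg.1.continuous.comp ((continuous_const_smul (h n)⁻¹).comp continuous_fst)
  have hφc : Continuous fun x : R3 => φ x.1 := hφ.1.continuous.comp continuous_fst
  have hB : ∀ n (x : R3), |φ x.1 * g ((h n)⁻¹ • x.1)| ≤ a * b := by
    intro n x
    rw [abs_mul]
    have := ha x.1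
    have := hb' ((h n)⁻¹ • x.1)
    gcongr
  have T1 := tendsto_tangent_term hω hθ hper h_pos h_lim hC β hH hHC
    (W := fun n x => φ x.1 * g ((h n)⁻¹ • x.1)) (fun n => hφc.mul (hgc n)) hB hL
  -- The identity is solved for the term with S. In the application S is an entry of (R - I)/h⁴,
  -- whose convergence is not given beforehand, so it has to be a conclusion.
  have S1 := (hL''.sub (tendsto_finsetSum Finset.univ fun k _ => T1 k)).add hL'
  have e : ∑ k, ((if k = β.castSucc then (1:ℝ) else 0) * L) = L := by simp
  rw [e] at S1
  refine S1.congr' ?_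
  filter_upwards [hid] with n hn
  have h1 := hn _ (mul_periodic_mem_testFunctions hφ hg (h n))
  have h2 : ∫ x in ω, D n x * (φ x * (θ₀ θ ((h n)⁻¹ • x) * g ((h n)⁻¹ • x))) =
      ∫ x in ω, D n x * (θ₀ θ ((h n)⁻¹ • x) * (φ x * g ((h n)⁻¹ • x))) := by
    congr 1; ext x; ring
  rw [h2]
  linarith

end WrinkledPlate

namespace WrinkledPlate

/-! ### Functions that are constant in the thickness variable -/

/-- The primitive starting at `a` vanishes to the left of the support of ψ, and to its right because
ψ has mean zero; hence it is again compactly supported in the interval. -/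
theorem exists_primitive_testFunctions {a b : ℝ} {ψ : ℝ → ℝ}
    (hψ : ψ ∈ testFunctions (Set.Ioo a b)) (h0 : ∫ t in Set.Ioo a b, ψ t = 0) :
    ∃ η ∈ testFunctions (Set.Ioo a b), deriv η = ψ := by
  have hψc : Continuous ψ := hψ.1.continuous
  rcases (tsupport ψ).eq_empty_or_nonempty with he | hne
  · rw [tsupport_eq_empty_iff] at he
    subst he
    refine ⟨0, ⟨contDiff_const, HasCompactSupport.zero, by simp⟩, ?_⟩
    ext t; simp
  have hK : IsCompact (tsupport ψ) := hψ.2.1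
  obtain ⟨c, hc⟩ := hK.exists_isLeast hne
  obtain ⟨d, hd⟩ := hK.exists_isGreatest hne
  have hca := hψ.2.2 hc.1
  have hdb := hψ.2.2 hd.1
  have hz : ∀ t, t < c ∨ d < t → ψ t = 0 := fun t ht =>
    image_eq_zero_of_notMem_tsupport fun h => by
      rcases ht with ht | ht
      · exact absurd (hc.2 h) (not_le.2 ht)
      · exact absurd (hd.2 h) (not_le.2 ht)
  have hderiv : ∀ t, HasDerivAt (fun t => ∫ s in a..t, ψ s) (ψ t) t := fun t =>
    (hψc.integral_hasStrictDerivAt a t).hasDerivAt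
  have hd' : deriv (fun t => ∫ s in a..t, ψ s) = ψ := funext fun t => (hderiv t).deriv
  have hzero1 : ∀ t, t < c → ∫ s in a..t, ψ s = 0 := by
    intro t ht
    refine intervalIntegral.integral_zero_ae (ae_of_all _ fun s hs => hz s (Or.inl ?_))
    have := hs.2
    rcases max_cases a t with h | h <;> rw [h.1] at this
    · exact this.trans_lt hca.1
    · exact this.trans_lt ht
  have hzero2 : ∀ t, d < t → ∫ s in a..t, ψ s = 0 := by
    intro t ht
    have e1 : ∫ s in a..b, ψ s = 0 := by
      rw [intervalIntegral.integral_of_le (hca.1.trans hca.2).le, integral_Ioc_eq_integral_Ioo, h0]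
    have e2 : ∫ s in t..b, ψ s = 0 := by
      refine intervalIntegral.integral_zero_ae (ae_of_all _ fun s hs => hz s (Or.inr ?_))
      have := hs.1
      rcases min_cases t b with h | h <;> rw [h.1] at this
      · exact ht.trans this
      · exact hdb.2.trans this
    have := intervalIntegral.integral_add_adjacent_intervals (μ := volume)
      (hψc.intervalIntegrable a t) (hψc.intervalIntegrable t b)
    linarith
  have hsupp : tsupport (fun t => ∫ s in a..t, ψ s) ⊆ Set.Icc c d := by
    refine closure_minimal (fun t ht => ?_) isClosed_Icc
    have ht' : ∫ s in a..t, ψ s ≠ 0 := ht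
    by_contra hn
    rw [Set.mem_Icc, not_and_or, not_le, not_le] at hn
    exact ht' (hn.elim (hzero1 t) (hzero2 t))
  refine ⟨fun t => ∫ s in a..t, ψ s, ⟨?_, ?_, ?_⟩, hd'⟩
  · rw [contDiff_infty_iff_deriv, hd']
    exact ⟨fun t => (hderiv t).differentiableAt, hψ.1⟩
  · exact isCompact_Icc.of_isClosed_subset (isClosed_tsupport _) hsupp
  · exact hsupp.trans fun t ht => ⟨hca.1.trans_le ht.1, ht.2.trans_lt hdb.2⟩

theorem exists_testFunction_integral_eq_one :
    ∃ ζ ∈ testFunctions thick, ∫ t in thick, ζ t = 1 := by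
  let b : ContDiffBump (0 : ℝ) := ⟨1 / 8, 1 / 4, by norm_num, by norm_num⟩
  have hs : tsupport (b.normed volume) ⊆ thick := by
    rw [b.tsupport_normed_eq, Real.closedBall_eq_Icc]
    have h2 : b.rOut = 1 / 4 := rfl
    rw [h2]
    exact fun t ht => ⟨by norm_num; linarith [ht.1], by norm_num; linarith [ht.2]⟩
  refine ⟨b.normed volume, ⟨b.contDiff_normed, b.hasCompactSupport_normed, hs⟩, ?_⟩
  rw [setIntegral_eq_integral_of_forall_compl_eq_zero, b.integral_normed]
  exact fun t ht => image_eq_zero_of_notMem_tsupport fun h => ht (hs h)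

/-- The du Bois-Reymond lemma with parameters. -/
theorem ae_eq_integral_thick {Z : Type*} [MeasurableSpace Z] {ρ : Measure Z} [SFinite ρ]
    {S : Set (Z → ℝ)} (hS : ∀ s ∈ S, AEStronglyMeasurable s ρ ∧ ∃ C, ∀ z, |s z| ≤ C)
    (sepS : IsSeparating ρ S) {F : Z × ℝ → ℝ} (hF : Integrable F (ρ.prod (volume.restrict thick)))
    (h : ∀ s ∈ S, ∀ η ∈ testFunctions thick,
      ∫ z, (∫ t in thick, F (z, t) * deriv η t) * s z ∂ρ = 0) :
    ∀ᵐ z ∂(ρ.prod (volume.restrict thick)), F z = ∫ t in thick, F (z.1, t) := by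
  obtain ⟨ζ₀, hζ₀, hζ₀1⟩ := exists_testFunction_integral_eq_one
  have hFs : ∀ s ∈ S, Integrable (fun z : Z × ℝ => F z * s z.1)
      (ρ.prod (volume.restrict thick)) := by
    intro s hs
    obtain ⟨hm, C, hC⟩ := hS s hs
    exact hF.mul_bdd (c := C) hm.comp_fst (ae_of_all _ fun z => hC z.1)
  have swap : ∀ s ∈ S, ∀ ψ : ℝ → ℝ, Continuous ψ → (∃ C, ∀ t, |ψ t| ≤ C) →
      ∫ z, (∫ t in thick, F (z, t) * ψ t) * s z ∂ρ =
        ∫ t in thick, (∫ z, F (z, t) * s z ∂ρ) * ψ t := by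
    intro s hs ψ hψ hψC
    obtain ⟨C, hC⟩ := hψC
    have hi : Integrable (fun z : Z × ℝ => F z * s z.1 * ψ z.2)
        (ρ.prod (volume.restrict thick)) :=
      (hFs s hs).mul_bdd (c := C) hψ.aestronglyMeasurable.comp_snd (ae_of_all _ fun z => hC z.2)
    have := integral_integral_swap (f := fun z t => F (z, t) * s z * ψ t) hi
    simp_rw [← integral_mul_const]
    rw [← this]
    congr 1; ext z; congr 1; ext t; ring
  -- For a fixed parameter test function `s` the moment is a scalar function of t, to which the
  -- one-dimensional argument applies; the parameters are separated only at the end.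
  have const : ∀ s ∈ S, ∀ ζ ∈ testFunctions thick,
      ∫ t in thick, (∫ z, F (z, t) * s z ∂ρ) * ζ t =
        (∫ t in thick, ζ t) * ∫ z, (∫ t in thick, F (z, t)) * s z ∂ρ := by
    intro s hs
    have hf : Integrable (fun t => ∫ z, F (z, t) * s z ∂ρ) (volume.restrict thick) :=
      (hFs s hs).integral_prod_right
    set f : ℝ → ℝ := fun t => ∫ z, F (z, t) * s z ∂ρ with hfdef
    set c := ∫ t in thick, f t * ζ₀ t with hc
    have hfi : ∀ ζ ∈ testFunctions thick, Integrable (fun t => f t * ζ t)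
        (volume.restrict thick) := by
      intro ζ hζ
      obtain ⟨C, hC⟩ := testFunctions_bounded hζ
      exact hf.mul_bdd (c := C) hζ.1.continuous.aestronglyMeasurable (ae_of_all _ hC)
    have hti : ∀ ζ ∈ testFunctions thick, Integrable ζ (volume.restrict thick) := fun ζ hζ =>
      (hζ.1.continuous.integrable_of_hasCompactSupport hζ.2.1).restrict
    have h1 : ∀ ζ ∈ testFunctions thick, ∫ t in thick, f t * ζ t = (∫ t in thick, ζ t) * c := by
      intro ζ hζ
      set m := ∫ t in thick, ζ t with hm
      -- Subtracting m ζ₀, with ∫ζ₀ = 1, makes the mean zero, so the difference is the derivative of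
      -- a test function and the hypothesis applies to it.
      have hψ : (fun t => ζ t - m * ζ₀ t) ∈ testFunctions thick :=
        ⟨hζ.1.sub (contDiff_const.mul hζ₀.1), hζ.2.1.sub (hζ₀.2.1.mul_left),
          (tsupport_sub _ _).trans (Set.union_subset hζ.2.2
            ((tsupport_mul_subset_right).trans hζ₀.2.2))⟩
      obtain ⟨η, hη, hηψ⟩ := exists_primitive_testFunctions hψ (by
        rw [integral_sub (hti ζ hζ) ((hti ζ₀ hζ₀).const_mul m), integral_const_mul, hζ₀1, ← hm]
        ring)
      have h2 := h s hs η hη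
      rw [hηψ, swap s hs _ hψ.1.continuous (testFunctions_bounded hψ)] at h2
      have h3 : ∫ t in thick, f t * ζ t - m * (f t * ζ₀ t) = 0 := by
        rw [← h2]; congr 1; ext t; ring
      rw [integral_sub (hfi ζ hζ) ((hfi ζ₀ hζ₀).const_mul m), integral_const_mul] at h3
      linarith
    have h2 : (fun t => f t - c) =ᵐ[volume.restrict thick] 0 := by
      refine isSeparating_testFunctions isOpen_Ioo _ (hf.sub (integrable_const c)) fun ζ hζ => ?_
      simp_rw [sub_mul]
      rw [integral_sub (hfi ζ hζ) ((hti ζ hζ).const_mul c), integral_const_mul, h1 ζ hζ]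
      ring
    have h3 : ∫ z, (∫ t in thick, F (z, t)) * s z ∂ρ = c := by
      have h4 := swap s hs (fun _ => 1) continuous_const ⟨1, by simp⟩
      simp only [mul_one] at h4
      rw [h4]
      have h5 : f =ᵐ[volume.restrict thick] fun _ => c := by
        filter_upwards [h2] with t ht
        exact sub_eq_zero.1 ht
      rw [integral_congr_ae h5]
      simp
    intro ζ hζ
    rw [h3, h1 ζ hζ]
  have hF0 : Integrable (fun z => ∫ t in thick, F (z, t)) ρ := hF.integral_prod_left
  have hF' : Integrable (fun z : Z × ℝ => F z - ∫ t in thick, F (z.1, t))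
      (ρ.prod (volume.restrict thick)) := hF.sub (hF0.comp_fst _)
  have key := ae_eq_zero_of_integral_prod_mul_eq_zero hF' (S := S) (T := testFunctions thick)
    (fun t ht => ⟨ht.1.continuous.aestronglyMeasurable, testFunctions_bounded ht⟩) sepS
    (isSeparating_testFunctions isOpen_Ioo) fun s hs ζ hζ => ?_
  · filter_upwards [key] with z hz
    exact sub_eq_zero.1 hz
  · obtain ⟨C, hC⟩ := testFunctions_bounded hζ
    obtain ⟨hsm, C', hC'⟩ := hS s hs
    have hζi : Integrable ζ (volume.restrict thick) :=
      (hζ.1.continuous.integrable_of_hasCompactSupport hζ.2.1).restrict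
    have hFζ : Integrable (fun z : Z × ℝ => F z * ζ z.2) (ρ.prod (volume.restrict thick)) :=
      hF.mul_bdd (c := C) hζ.1.continuous.aestronglyMeasurable.comp_snd
        (ae_of_all _ fun z => hC z.2)
    have e : ∀ᵐ z ∂ρ, (∫ t in thick, (F (z, t) - ∫ t in thick, F (z, t)) * ζ t) * s z =
        (∫ t in thick, F (z, t) * ζ t) * s z -
          (∫ t in thick, ζ t) * ((∫ t in thick, F (z, t)) * s z) := by
      filter_upwards [hFζ.prod_right_ae] with z hz
      simp_rw [sub_mul]
      rw [integral_sub hz (hζi.const_mul _), integral_const_mul]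
      ring
    have i1 : Integrable (fun z => (∫ t in thick, F (z, t) * ζ t) * s z) ρ :=
      hFζ.integral_prod_left.mul_bdd (c := C') hsm (ae_of_all _ hC')
    have i2 : Integrable (fun z => (∫ t in thick, F (z, t)) * s z) ρ :=
      hF0.mul_bdd (c := C') hsm (ae_of_all _ hC')
    rw [integral_congr_ae e, integral_sub i1 (i2.const_mul _), integral_const_mul,
      swap s hs ζ hζ.1.continuous ⟨C, hC⟩, const s hs ζ hζ, sub_self]

end WrinkledPlate

namespace WrinkledPlate

/-! ### Tensor products and the order of integration -/

section Product

variable {α β γ : Type*} [MeasurableSpace α] [MeasurableSpace β] [MeasurableSpace γ]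

/-- The tensor products of two families of functions. -/
def tensor (S : Set (α → ℝ)) (T : Set (β → ℝ)) : Set (α × β → ℝ) :=
  {u | ∃ s ∈ S, ∃ t ∈ T, u = fun z => s z.1 * t z.2}

theorem integral_prod_mul_mul {μ : Measure α} {ν : Measure β} [SFinite μ] [SFinite ν]
    {F : α × β → ℝ} (hF : Integrable F (μ.prod ν)) {s : α → ℝ} {t : β → ℝ}
    (hs : AEStronglyMeasurable s μ) {C : ℝ} (hC : ∀ x, |s x| ≤ C)
    (ht : AEStronglyMeasurable t ν) {C' : ℝ} (hC' : ∀ y, |t y| ≤ C') :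
    ∫ z, F z * (s z.1 * t z.2) ∂(μ.prod ν) = ∫ x, (∫ y, F (x, y) * t y ∂ν) * s x ∂μ := by
  have hi : Integrable (fun z : α × β => F z * (s z.1 * t z.2)) (μ.prod ν) := by
    refine hF.mul_bdd (c := C * C') (hs.comp_fst.mul ht.comp_snd) (ae_of_all _ fun z => ?_)
    rw [norm_mul]
    exact mul_le_mul (hC _) (hC' _) (norm_nonneg _) ((abs_nonneg _).trans (hC z.1))
  rw [integral_prod _ hi]
  congr 1; ext x
  rw [← integral_mul_const]
  congr 1; ext y; ring

theorem IsSeparating.tensor {μ : Measure α} {ν : Measure β} [SFinite μ] [SFinite ν]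
    {S : Set (α → ℝ)} {T : Set (β → ℝ)} (sepS : IsSeparating μ S) (sepT : IsSeparating ν T)
    (hS : ∀ s ∈ S, AEStronglyMeasurable s μ ∧ ∃ C, ∀ x, |s x| ≤ C)
    (hT : ∀ t ∈ T, AEStronglyMeasurable t ν ∧ ∃ C, ∀ y, |t y| ≤ C) :
    IsSeparating (μ.prod ν) (tensor S T) := by
  intro F hF h
  refine ae_eq_zero_of_integral_prod_mul_eq_zero hF hT sepS sepT fun s hs t ht => ?_
  obtain ⟨hsm, C, hC⟩ := hS s hs
  obtain ⟨htm, C', hC'⟩ := hT t ht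
  rw [← integral_prod_mul_mul hF hsm hC htm hC', ← h _ ⟨s, hs, t, ht, rfl⟩]

theorem tensor_bounded {μ : Measure α} {ν : Measure β} [SFinite μ] [SFinite ν]
    {S : Set (α → ℝ)} {T : Set (β → ℝ)}
    (hS : ∀ s ∈ S, AEStronglyMeasurable s μ ∧ ∃ C, ∀ x, |s x| ≤ C)
    (hT : ∀ t ∈ T, AEStronglyMeasurable t ν ∧ ∃ C, ∀ y, |t y| ≤ C) :
    ∀ u ∈ tensor S T, AEStronglyMeasurable u (μ.prod ν) ∧ ∃ C, ∀ z, |u z| ≤ C := by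
  rintro _ ⟨s, hs, t, ht, rfl⟩
  obtain ⟨hsm, C, hC⟩ := hS s hs
  obtain ⟨htm, C', hC'⟩ := hT t ht
  refine ⟨hsm.comp_fst.mul htm.comp_snd, C * C', fun z => ?_⟩
  rw [abs_mul]
  exact mul_le_mul (hC _) (hC' _) (abs_nonneg _) ((abs_nonneg _).trans (hC z.1))

/-- Exchanging the last two of three factors. -/
def prodSwapRight : (α × β) × γ ≃ᵐ (α × γ) × β :=
  (MeasurableEquiv.prodAssoc.trans
    ((MeasurableEquiv.refl α).prodCongr MeasurableEquiv.prodComm)).trans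
    MeasurableEquiv.prodAssoc.symm

@[simp]
theorem prodSwapRight_apply (z : (α × β) × γ) :
    prodSwapRight z = ((z.1.1, z.2), z.1.2) := rfl

@[simp]
theorem prodSwapRight_symm_apply (z : (α × γ) × β) :
    prodSwapRight.symm z = ((z.1.1, z.2), z.1.2) := rfl

theorem measurePreserving_prodSwapRight (μ : Measure α) (ν : Measure β) (τ : Measure γ)
    [SFinite μ] [SFinite ν] [SFinite τ] : MeasurePreserving
      (prodSwapRight : (α × β) × γ ≃ᵐ (α × γ) × β) ((μ.prod ν).prod τ) ((μ.prod τ).prod ν) := by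
  have h1 := measurePreserving_prodAssoc μ ν τ
  have h2 := (MeasurePreserving.id μ).prod (Measure.measurePreserving_swap (μ := ν) (ν := τ))
  have h3 := (measurePreserving_prodAssoc μ τ ν).symm
  exact h3.comp (h2.comp h1)

end Product

variable {ω : Set R2}

theorem restrict_plate₁_prod (ω : Set R2) :
    ((volume : Measure R3).restrict (plate₁ ω)).prod ((volume : Measure R2).restrict Y) =
      ((volume.restrict ω).prod (volume.restrict thick)).prod (volume.restrict Y) := by
  rw [restrict_plate₁]

theorem measurePreserving_cell (ω : Set R2) : MeasurePreserving
    (prodSwapRight : (R2 × R2) × ℝ ≃ᵐ (R2 × ℝ) × R2)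
    (((volume.restrict ω).prod (volume.restrict Y)).prod (volume.restrict thick))
    (((volume : Measure R3).restrict (plate₁ ω)).prod (volume.restrict Y)) := by
  rw [restrict_plate₁_prod]
  exact measurePreserving_prodSwapRight _ _ _

theorem bounded_testFunctions (ω : Set R2) : ∀ φ ∈ testFunctions ω,
    AEStronglyMeasurable φ (volume.restrict ω) ∧ ∃ C, ∀ x, |φ x| ≤ C :=
  fun _ hφ => ⟨hφ.1.continuous.aestronglyMeasurable, testFunctions_bounded hφ⟩

theorem bounded_smoothPeriodic : ∀ g ∈ smoothPeriodic,
    AEStronglyMeasurable g (volume.restrict Y) ∧ ∃ C, ∀ y, |g y| ≤ C :=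
  fun _ hg => ⟨hg.1.continuous.aestronglyMeasurable, smoothPeriodic_bounded hg⟩

/-- Testing a function on the plate and the cell, in the order of integration adapted to the
dimension reduction. -/
theorem integral_plate₁_cell (hωb : Bornology.IsBounded ω) {G : R3 → R2 → ℝ}
    (hG : MemLp (fun z : R3 × R2 => G z.1 z.2) 2
      ((volume.restrict (plate₁ ω)).prod (volume.restrict Y)))
    {φ : R2 → ℝ} (hφ : φ ∈ testFunctions ω) {g : R2 → ℝ} (hg : g ∈ smoothPeriodic) {ψ : ℝ → ℝ}
    (hψ : Continuous ψ) {C : ℝ} (hψC : ∀ t, |ψ t| ≤ C) :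
    ∫ x in plate₁ ω, (∫ y in Y, G x y * g y) * (φ x.1 * ψ x.2) =
      ∫ z, (∫ t in thick, G (z.1, t) z.2 * ψ t) * (φ z.1 * g z.2)
        ∂((volume.restrict ω).prod (volume.restrict Y)) := by
  have := isFiniteMeasure_restrict_of_isBounded (μ := (volume : Measure R2)) hωb
  have := isFiniteMeasure_restrict_of_isBounded (μ := (volume : Measure R3))
    (isBounded_plate₁ hωb)
  have hGi := hG.integrable one_le_two
  obtain ⟨a, ha⟩ := testFunctions_bounded hφ
  obtain ⟨b, hb⟩ := smoothPeriodic_bounded hg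
  have hmp := measurePreserving_cell ω
  have hGi' : Integrable (fun z : (R2 × R2) × ℝ => G (z.1.1, z.2) z.1.2)
      (((volume.restrict ω).prod (volume.restrict Y)).prod (volume.restrict thick)) :=
    hmp.integrable_comp_of_integrable hGi
  have hφψ : Continuous fun x : R3 => φ x.1 * ψ x.2 :=
    (hφ.1.continuous.comp continuous_fst).mul (hψ.comp continuous_snd)
  have hφg : Continuous fun z : R2 × R2 => φ z.1 * g z.2 :=
    (hφ.1.continuous.comp continuous_fst).mul (hg.1.continuous.comp continuous_snd)
  have e1 := integral_prod_mul_mul hGi (s := fun x : R3 => φ x.1 * ψ x.2) (t := g)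
    hφψ.aestronglyMeasurable (C := a * C) (fun x => by
      rw [abs_mul]
      exact mul_le_mul (ha _) (hψC _) (abs_nonneg _) ((abs_nonneg _).trans (ha x.1)))
    hg.1.continuous.aestronglyMeasurable hb
  have e2 := integral_prod_mul_mul hGi' (s := fun z : R2 × R2 => φ z.1 * g z.2) (t := ψ)
    hφg.aestronglyMeasurable (C := a * b) (fun x => by
      rw [abs_mul]
      exact mul_le_mul (ha _) (hb _) (abs_nonneg _) ((abs_nonneg _).trans (ha x.1)))
    hψ.aestronglyMeasurable hψC
  rw [← e1, ← e2, ← hmp.integral_comp' (g := fun z : R3 × R2 =>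
    G z.1 z.2 * (φ z.1.1 * ψ z.1.2 * g z.2))]
  congr 1; ext z
  simp only [prodSwapRight_apply]
  ring

/-- A function whose derivative in the thickness variable is independent of the thickness
variable is affine in it. -/
theorem affine_of_transverse (hω : IsOpen ω) (hωb : Bornology.IsBounded ω) {G : R3 → R2 → ℝ}
    (hG : MemLp (fun z : R3 × R2 => G z.1 z.2) 2
      ((volume.restrict (plate₁ ω)).prod (volume.restrict Y))) {G₁ : R2 → R2 → ℝ}
    (hG₁ : MemL2Cell ω G₁)
    (h : ∀ φ ∈ testFunctions ω, ∀ η ∈ testFunctions thick, ∀ g ∈ smoothPeriodic,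
      ∫ x in plate₁ ω, (∫ y in Y, G x y * g y) * (φ x.1 * deriv η x.2) =
        - ((∫ x in ω, (∫ y in Y, G₁ x y * g y) * φ x) * ∫ t in thick, η t)) :
    MemL2Cell ω (fun x y => ∫ t in thick, G (x, t) y) ∧
    ∀ᵐ q : R3 × R2 ∂((volume.restrict (plate₁ ω)).prod (volume.restrict Y)),
      G q.1 q.2 = (∫ t in thick, G (q.1.1, t) q.2) + q.1.2 * G₁ q.1.1 q.2 := by
  have := isFiniteMeasure_restrict_of_isBounded (μ := (volume : Measure R2)) hωb
  have hmp := measurePreserving_cell ω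
  have hG' : MemLp (fun z : (R2 × R2) × ℝ => G (z.1.1, z.2) z.1.2) 2
      (((volume.restrict ω).prod (volume.restrict Y)).prod (volume.restrict thick)) :=
    hG.comp_measurePreserving hmp
  have hG₁' : MemLp (fun z : (R2 × R2) × ℝ => G₁ z.1.1 z.1.2) 2
      (((volume.restrict ω).prod (volume.restrict Y)).prod (volume.restrict thick)) :=
    MemLp.comp_measurePreserving hG₁ measurePreserving_fst
  have hthick : ∀ᵐ z : (R2 × R2) × ℝ
      ∂(((volume.restrict ω).prod (volume.restrict Y)).prod (volume.restrict thick)),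
      |z.2| ≤ 1 := by
    have h1 : ∀ᵐ t ∂((volume : Measure ℝ).restrict thick), |t| ≤ 1 := by
      filter_upwards [ae_restrict_mem measurableSet_Ioo] with t ht
      rw [abs_le]
      constructor <;> linarith [ht.1, ht.2]
    exact Measure.quasiMeasurePreserving_snd.ae h1
  have htG₁ : MemLp (fun z : (R2 × R2) × ℝ => z.2 * G₁ z.1.1 z.1.2) 2
      (((volume.restrict ω).prod (volume.restrict Y)).prod (volume.restrict thick)) := by
    refine hG₁'.mono (measurable_snd.aestronglyMeasurable.mul hG₁'.1) ?_
    filter_upwards [hthick] with z hz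
    rw [norm_mul]
    exact mul_le_of_le_one_left (norm_nonneg _) hz
  -- Subtracting t G₁ leaves a function with zero transverse derivative, to which the du
  -- Bois-Reymond lemma applies.
  have hF := hG'.sub htG₁
  have hFi := hF.integrable one_le_two
  have hG₁i := MemLp.integrable one_le_two hG₁
  have hGi := hG'.integrable one_le_two
  have sep := (isSeparating_testFunctions (μ := volume) hω).tensor isSeparating_smoothPeriodic
    (bounded_testFunctions ω) bounded_smoothPeriodic
  have key := ae_eq_integral_thick
    (tensor_bounded (bounded_testFunctions ω) bounded_smoothPeriodic) sep hFi ?_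
  -- As t has mean zero over the thickness, the constant part of the affine function is the average
  -- of G itself.
  · have e : ∀ᵐ z : R2 × R2 ∂((volume.restrict ω).prod (volume.restrict Y)),
        ∫ t in thick, (G (z.1, t) z.2 - t * G₁ z.1 z.2) = ∫ t in thick, G (z.1, t) z.2 := by
      filter_upwards [hGi.prod_right_ae] with z hz
      have ht : IntegrableOn (fun t : ℝ => t * G₁ z.1 z.2) thick :=
        (continuous_id.mul continuous_const).integrableOn_Icc.mono_set Set.Ioo_subset_Icc_self
      rw [integral_sub hz ht, integral_mul_const, integral_thick_id, zero_mul, sub_zero]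
    have key2 : ∀ᵐ z : (R2 × R2) × ℝ
        ∂(((volume.restrict ω).prod (volume.restrict Y)).prod (volume.restrict thick)),
        G (z.1.1, z.2) z.1.2 - z.2 * G₁ z.1.1 z.1.2 = ∫ t in thick, G (z.1.1, t) z.1.2 := by
      filter_upwards [key, Measure.quasiMeasurePreserving_fst.ae e] with z hz hz'
      rw [← hz']
      exact hz
    constructor
    -- The average agrees almost everywhere on the full product with the L² function G - t G₁. Since
    -- the thickness interval has mass one, its square integrability descends to ω × Y.
    · have hm : AEStronglyMeasurable (fun z : R2 × R2 => ∫ t in thick, G (z.1, t) z.2)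
          ((volume.restrict ω).prod (volume.restrict Y)) := hGi.integral_prod_left.1
      have hm' := measurePreserving_fst (μ := (volume.restrict ω).prod
        ((volume : Measure R2).restrict Y)) (ν := (volume : Measure ℝ).restrict thick)
      rw [MemL2Cell, ← hm'.map_eq, memLp_map_measure_iff (by rw [hm'.map_eq]; exact hm)
        measurable_fst.aemeasurable]
      exact hF.ae_eq key2
    · have h2 := (hmp.symm.quasiMeasurePreserving).ae key2
      filter_upwards [h2] with q hq
      rw [prodSwapRight_symm_apply] at hq
      rw [← hq]; ring
  · rintro _ ⟨φ, hφ, g, hg, rfl⟩ η hη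
    obtain ⟨C, hC⟩ := testFunctions_bounded (deriv_mem_testFunctions hη)
    obtain ⟨a, ha⟩ := testFunctions_bounded hφ
    obtain ⟨b, hb⟩ := smoothPeriodic_bounded hg
    have hη' := (deriv_mem_testFunctions hη).1.continuous
    have h1 := h φ hφ η hη g hg
    rw [integral_plate₁_cell hωb hG hφ hg hη' hC] at h1
    have h2 := integral_prod_mul_mul hG₁i hφ.1.continuous.aestronglyMeasurable ha
      hg.1.continuous.aestronglyMeasurable hb
    rw [← h2] at h1
    have hφg : Continuous fun z : R2 × R2 => φ z.1 * g z.2 :=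
      (hφ.1.continuous.comp continuous_fst).mul (hg.1.continuous.comp continuous_snd)
    have hφgb : ∀ z : R2 × R2, ‖φ z.1 * g z.2‖ ≤ a * b := fun z => by
      rw [norm_mul]
      exact mul_le_mul (ha _) (hb _) (norm_nonneg _) ((abs_nonneg _).trans (ha z.1))
    have hGη : Integrable (fun z : (R2 × R2) × ℝ => G (z.1.1, z.2) z.1.2 * deriv η z.2)
        (((volume.restrict ω).prod (volume.restrict Y)).prod (volume.restrict thick)) :=
      hGi.mul_bdd (c := C) hη'.aestronglyMeasurable.comp_snd (ae_of_all _ fun z => hC z.2)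
    have e : ∀ᵐ z : R2 × R2 ∂((volume.restrict ω).prod (volume.restrict Y)),
        (∫ t in thick, (G (z.1, t) z.2 - t * G₁ z.1 z.2) * deriv η t) * (φ z.1 * g z.2) =
        (∫ t in thick, G (z.1, t) z.2 * deriv η t) * (φ z.1 * g z.2) +
          (∫ t in thick, η t) * (G₁ z.1 z.2 * (φ z.1 * g z.2)) := by
      filter_upwards [hGη.prod_right_ae] with z hz
      have ht : IntegrableOn (fun t : ℝ => G₁ z.1 z.2 * (t * deriv η t)) thick :=
        (continuous_const.mul (continuous_id.mul hη')).integrableOn_Icc.mono_set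
          Set.Ioo_subset_Icc_self
      have e1 : ∫ t in thick, (G (z.1, t) z.2 - t * G₁ z.1 z.2) * deriv η t =
          (∫ t in thick, G (z.1, t) z.2 * deriv η t) + G₁ z.1 z.2 * ∫ t in thick, η t := by
        have e2 : ∀ t, (G (z.1, t) z.2 - t * G₁ z.1 z.2) * deriv η t =
            G (z.1, t) z.2 * deriv η t - G₁ z.1 z.2 * (t * deriv η t) := fun t => by ring
        simp_rw [e2]
        rw [integral_sub hz ht, integral_const_mul, integral_thick_id_mul_deriv hη]
        ring
      rw [e1]; ring
    have i1 : Integrable (fun z : R2 × R2 => (∫ t in thick, G (z.1, t) z.2 * deriv η t) *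
        (φ z.1 * g z.2)) ((volume.restrict ω).prod (volume.restrict Y)) :=
      hGη.integral_prod_left.mul_bdd (c := a * b) hφg.aestronglyMeasurable (ae_of_all _ hφgb)
    have i2 : Integrable (fun z : R2 × R2 => G₁ z.1 z.2 * (φ z.1 * g z.2))
        ((volume.restrict ω).prod (volume.restrict Y)) :=
      hG₁i.mul_bdd (c := a * b) hφg.aestronglyMeasurable (ae_of_all _ hφgb)
    have e3 := integral_congr_ae e
    rw [integral_add i1 (i2.const_mul _), integral_const_mul, h1] at e3
    refine e3.trans ?_
    ring

end WrinkledPlate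

namespace WrinkledPlate

/-! ### Symmetry of weak Hessians -/

theorem fderiv_fderiv_apply_comm {φ : R2 → ℝ} (hφ : ContDiff ℝ (⊤ : ℕ∞) φ) (x a b : R2) :
    fderiv ℝ (fun x => fderiv ℝ φ x a) x b = fderiv ℝ (fun x => fderiv ℝ φ x b) x a := by
  have hd : DifferentiableAt ℝ (fderiv ℝ φ) x :=
    (hφ.fderiv_right (m := (⊤ : ℕ∞)) (by simp)).differentiable (by simp) x
  have e : ∀ a b, fderiv ℝ (fun x => fderiv ℝ φ x a) x b = fderiv ℝ (fderiv ℝ φ) x b a := by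
    intro a b
    rw [fderiv_clm_apply hd (differentiableAt_const a)]
    simp
  rw [e, e]
  exact (hφ.contDiffAt.isSymmSndFDerivAt (by
    rw [minSmoothness_of_isRCLikeNormedField]
    exact WithTop.coe_le_coe.2 (le_top : (2 : ℕ∞) ≤ ⊤))).eq b a

variable {ω : Set R2}

/-- Both mixed derivatives can be shifted to the test function, where they commute. The symmetry is
needed because the in-plane identity yields only the symmetric part of a Hessian that the final
formula contains in full. -/
theorem hessian_symm (hω : IsOpen ω) (hωb : Bornology.IsBounded ω) {v : R2 → ℝ}
    {Dv : R2 → Fin 2 → ℝ} {D2v : R2 → Matrix (Fin 2) (Fin 2) ℝ} (hv : HasW12Grad e2 ω v Dv)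
    (hDv : ∀ α, HasW12Grad e2 ω (fun x => Dv x α) (fun x => D2v x α)) (α β : Fin 2) :
    ∀ᵐ x ∂(volume.restrict ω), D2v x α β = D2v x β α := by
  have := isFiniteMeasure_restrict_of_isBounded (μ := (volume : Measure R2)) hωb
  have hi : ∀ α β, Integrable (fun x => D2v x α β) (volume.restrict ω) := fun α β =>
    ((hDv α).grad_memLp β).integrable one_le_two
  have key : ∀ α β, ∀ φ ∈ testFunctions ω, ∫ x in ω, D2v x α β * φ x =
      ∫ x in ω, v x * fderiv ℝ (fun x => fderiv ℝ φ x (e2 β)) x (e2 α) := by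
    intro α β φ hφ
    have hφ' := fderiv_apply_mem_testFunctions hφ (e2 β)
    have h1 := (hDv α).weakDeriv β φ hφ.1 hφ.2.1 hφ.2.2
    have h2 := hv.weakDeriv α _ hφ'.1 hφ'.2.1 hφ'.2.2
    linarith
  have h0 := isSeparating_testFunctions hω (fun x => D2v x α β - D2v x β α)
    ((hi α β).sub (hi β α)) fun φ hφ => ?_
  · filter_upwards [h0] with x hx
    exact sub_eq_zero.1 hx
  · simp_rw [sub_mul]
    rw [integral_sub (integrable_mul_plane hω hωb (hi α β) hφ.1.continuous)
      (integrable_mul_plane hω hωb (hi β α) hφ.1.continuous), key α β φ hφ, key β α φ hφ]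
    simp_rw [fderiv_fderiv_apply_comm hφ.1 _ (e2 β)]
    exact sub_self _

theorem cell_hessian_symm (hω : IsOpen ω) (hωb : Bornology.IsBounded ω) {v : R2 → R2 → ℝ}
    {Dv : R2 → R2 → Fin 2 → ℝ} {D2v : R2 → R2 → Matrix (Fin 2) (Fin 2) ℝ}
    (hv : HasL2DotH2Hess ω v Dv D2v) (α β : Fin 2) :
    ∀ᵐ q : R2 × R2 ∂((volume.restrict ω).prod (volume.restrict Y)),
      D2v q.1 q.2 α β = D2v q.1 q.2 β α := by
  have := isFiniteMeasure_restrict_of_isBounded (μ := (volume : Measure R2)) hωb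
  have hi : ∀ α β, Integrable (fun q : R2 × R2 => D2v q.1 q.2 α β)
      ((volume.restrict ω).prod (volume.restrict Y)) := fun α β =>
    MemLp.integrable one_le_two (hv.hess_memLp α β)
  have h0 := ae_eq_zero_of_integral_prod_mul_eq_zero ((hi α β).sub (hi β α))
    bounded_smoothPeriodic (isSeparating_testFunctions hω) isSeparating_smoothPeriodic
    fun s _ g hg => ?_
  · filter_upwards [h0] with x hx
    exact sub_eq_zero.1 hx
  · obtain ⟨C, hC⟩ := smoothPeriodic_bounded hg
    have key : ∀ᵐ x ∂(volume.restrict ω),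
        (∫ y in Y, (D2v x y α β - D2v x y β α) * g y) * s x = 0 := by
      filter_upwards [hv.hess_weakDeriv, hv.grad.weakDeriv, (hi α β).prod_right_ae,
        (hi β α).prod_right_ae] with x h1 h2 i1 i2
      have key : ∀ α β, ∫ y in Y, D2v x y α β * g y =
          ∫ y in Y, v x y * fderiv ℝ (fun y => fderiv ℝ g y (e2 β)) y (e2 α) := by
        intro α β
        have hg' := fderiv_apply_mem_smoothPeriodic hg (e2 β)
        have h3 := h1 α β g hg.1 hg.2
        have h4 := h2 α _ hg'.1 hg'.2
        linarith
      have j : ∀ {f : R2 → ℝ}, Integrable f (volume.restrict Y) →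
          Integrable (fun y => f y * g y) (volume.restrict Y) := fun hf =>
        hf.mul_bdd (c := C) hg.1.continuous.aestronglyMeasurable (ae_of_all _ hC)
      simp_rw [sub_mul]
      rw [integral_sub (j i1) (j i2), key α β, key β α]
      simp_rw [fderiv_fderiv_apply_comm hg.1 _ (e2 β)]
      rw [sub_self, zero_mul]
    exact (integral_congr_ae key).trans (integral_zero _ _)

/-! ### The scaled strain -/

section Scaling

variable {X : Type*} [MeasurableSpace X] {μ : Measure X}

theorem eLpNorm_div_le {f : X → ℝ} {p : ENNReal} {a C : ℝ} (ha : 0 < a)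
    (hf : eLpNorm f p μ ≤ ENNReal.ofReal (C * a)) :
    eLpNorm (fun x => f x / a) p μ ≤ ENNReal.ofReal C := by
  have e : (fun x => f x / a) = a⁻¹ • f := by
    ext x; simp [div_eq_inv_mul]
  rw [e, eLpNorm_const_smul, Real.enorm_of_nonneg (inv_nonneg.2 ha.le)]
  refine (mul_le_mul_right hf _).trans ?_
  rw [← ENNReal.ofReal_mul (inv_nonneg.2 ha.le)]
  refine le_of_eq ?_
  congr 1; field_simp

theorem memLp_of_sub_div [IsFiniteMeasure μ] {f : X → ℝ} {p : ENNReal} {a c : ℝ} (ha : a ≠ 0)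
    (hf : MemLp (fun x => (f x - c) / a) p μ) : MemLp f p μ := by
  have := (hf.const_mul a).add (memLp_const c)
  refine this.ae_eq (ae_of_all _ fun x => ?_)
  simp only [Pi.add_apply]
  field_simp
  ring

end Scaling

theorem sum_mul_self_of_mem {M : Matrix (Fin 3) (Fin 3) ℝ}
    (hM : M ∈ Matrix.specialOrthogonalGroup (Fin 3) ℝ) (i j : Fin 3) :
    ∑ k, M k i * M k j = (1 : Matrix (Fin 3) (Fin 3) ℝ) i j := by
  have h1 := (Matrix.mem_orthogonalGroup_iff' (Fin 3) ℝ).1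
    (Matrix.mem_specialOrthogonalGroup_iff.1 hM).1
  rw [← h1, Matrix.mul_apply]
  rfl

theorem abs_le_one_of_mem {M : Matrix (Fin 3) (Fin 3) ℝ}
    (hM : M ∈ Matrix.specialOrthogonalGroup (Fin 3) ℝ) (i j : Fin 3) : |M i j| ≤ 1 := by
  have h1 := sum_mul_self_of_mem hM j j
  rw [Matrix.one_apply_eq] at h1
  have h2 : M i j * M i j ≤ ∑ k, M k j * M k j :=
    Finset.single_le_sum (f := fun k => M k j * M k j) (fun k _ => mul_self_nonneg _)
      (Finset.mem_univ i)
  rw [abs_le]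
  constructor <;> nlinarith

/-- From RᵀR = I one gets RᵀF - I = Rᵀ(F - R), so the strain inherits the L² bound of the scaled
difference. -/
theorem strain_apply {θ : R2 → ℝ} {h : ℝ} {Dy : R3 → Matrix (Fin 3) (Fin 3) ℝ}
    {R : R2 → Matrix (Fin 3) (Fin 3) ℝ} {x : R3}
    (hR : R x.1 ∈ Matrix.specialOrthogonalGroup (Fin 3) ℝ) (i j : Fin 3) :
    strain θ h Dy R x i j =
      ∑ k, R x.1 k i * ((pulledGrad θ h Dy x k j - R x.1 k j) / h ^ 4) := by
  rw [strain, Matrix.smul_apply, Matrix.sub_apply, ← sum_mul_self_of_mem hR, Matrix.mul_apply,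
    ← Finset.sum_sub_distrib, smul_eq_mul, Finset.mul_sum]
  refine Finset.sum_congr rfl fun k _ => ?_
  rw [Matrix.transpose_apply]
  ring

theorem strain_sub_apply {θ : R2 → ℝ} {h : ℝ} {Dy : R3 → Matrix (Fin 3) (Fin 3) ℝ}
    {R : R2 → Matrix (Fin 3) (Fin 3) ℝ} {x : R3}
    (hR : R x.1 ∈ Matrix.specialOrthogonalGroup (Fin 3) ℝ) (i j : Fin 3) :
    strain θ h Dy R x i j - (pulledGrad θ h Dy x i j - R x.1 i j) / h ^ 4 =
      ∑ k, (R x.1 k i - (1 : Matrix (Fin 3) (Fin 3) ℝ) k i) *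
        ((pulledGrad θ h Dy x k j - R x.1 k j) / h ^ 4) := by
  rw [strain_apply hR]
  simp_rw [sub_mul, Finset.sum_sub_distrib]
  congr 1
  simp [Matrix.one_apply]

end WrinkledPlate

namespace WrinkledPlate

variable {θ : R2 → ℝ} {ω : Set R2}

/-! ### Convergence of the scaled strain -/

/-- The scaled difference of the deformation gradient and the rotation field. -/
noncomputable def scaledDiff (θ : R2 → ℝ) (h : ℝ) (Dy : R3 → Matrix (Fin 3) (Fin 3) ℝ)
    (R : R2 → Matrix (Fin 3) (Fin 3) ℝ) (x : R3) (i j : Fin 3) : ℝ :=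
  (pulledGrad θ h Dy x i j - R x.1 i j) / h ^ 4

section Single

variable {h : ℝ} {Dy : R3 → Matrix (Fin 3) (Fin 3) ℝ} {R : R2 → Matrix (Fin 3) (Fin 3) ℝ}

theorem memLp_scaledDiff {i j : Fin 3}
    (hF : MemLp (fun x => pulledGrad θ h Dy x i j) 2 (volume.restrict (plate₁ ω)))
    (hR : MemLp (fun x => R x i j) 2 (volume.restrict ω)) :
    MemLp (fun x => scaledDiff θ h Dy R x i j) 2 (volume.restrict (plate₁ ω)) := by
  have := (hF.sub (memLp_fst_plate₁ hR)).const_mul (h ^ 4)⁻¹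
  refine this.ae_eq (ae_of_all _ fun x => ?_)
  simp only [scaledDiff, div_eq_inv_mul]
  rfl

theorem strain_ae_eq
    (hSO : ∀ᵐ x ∂(volume.restrict ω), R x ∈ Matrix.specialOrthogonalGroup (Fin 3) ℝ)
    (i j : Fin 3) :
    (fun x => ∑ k, R x.1 k i * scaledDiff θ h Dy R x k j) =ᵐ[volume.restrict (plate₁ ω)]
      fun x => strain θ h Dy R x i j := by
  filter_upwards [ae_plate₁_of_ae hSO] with x hx using (strain_apply hx i j).symm

theorem eLpNorm_rotation_mul_le
    (hSO : ∀ᵐ x ∂(volume.restrict ω), R x ∈ Matrix.specialOrthogonalGroup (Fin 3) ℝ)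
    (i j : Fin 3) (f : R3 → ℝ) :
    ∀ᵐ x : R3 ∂(volume.restrict (plate₁ ω)), ‖R x.1 i j * f x‖ ≤ ‖f x‖ := by
  filter_upwards [ae_plate₁_of_ae hSO] with x hx
  rw [norm_mul]
  exact mul_le_of_le_one_left (norm_nonneg _) (abs_le_one_of_mem hx i j)

theorem memLp_strain
    (hSO : ∀ᵐ x ∂(volume.restrict ω), R x ∈ Matrix.specialOrthogonalGroup (Fin 3) ℝ)
    (hR : ∀ i j, MemLp (fun x => R x i j) 2 (volume.restrict ω))
    (hH : ∀ i j, MemLp (fun x => scaledDiff θ h Dy R x i j) 2 (volume.restrict (plate₁ ω)))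
    {C : ENNReal}
    (hC : ∀ i j, eLpNorm (fun x => scaledDiff θ h Dy R x i j) 2 (volume.restrict (plate₁ ω)) ≤ C)
    (i j : Fin 3) :
    MemLp (fun x => strain θ h Dy R x i j) 2 (volume.restrict (plate₁ ω)) ∧
      eLpNorm (fun x => strain θ h Dy R x i j) 2 (volume.restrict (plate₁ ω)) ≤ 3 * C := by
  have hm : ∀ k, MemLp (fun x => R x.1 k i * scaledDiff θ h Dy R x k j) 2
      (volume.restrict (plate₁ ω)) := fun k =>
    (hH k j).mono ((memLp_fst_plate₁ (hR k i)).1.mul (hH k j).1)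
      (eLpNorm_rotation_mul_le hSO k i _)
  have hs : MemLp (fun x => ∑ k, R x.1 k i * scaledDiff θ h Dy R x k j) 2
      (volume.restrict (plate₁ ω)) := memLp_finsetSum _ fun k _ => hm k
  refine ⟨hs.ae_eq (strain_ae_eq hSO i j), ?_⟩
  rw [← eLpNorm_congr_ae (strain_ae_eq hSO i j)]
  have e : (fun x => ∑ k, R x.1 k i * scaledDiff θ h Dy R x k j) =
      ∑ k, fun x => R x.1 k i * scaledDiff θ h Dy R x k j := by
    ext x; simp
  rw [e]
  refine (eLpNorm_sum_le (fun k _ => (hm k).1) one_le_two).trans ?_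
  calc ∑ k, eLpNorm (fun x => R x.1 k i * scaledDiff θ h Dy R x k j) 2
        (volume.restrict (plate₁ ω)) ≤ ∑ _k : Fin 3, C := by
        refine Finset.sum_le_sum fun k _ => ?_
        exact (eLpNorm_mono_ae (eLpNorm_rotation_mul_le hSO k i _)).trans (hC k j)
    _ = 3 * C := by simp

/-- The error is (R - I)ᵀ times the scaled difference. Hölder with two L² bounds gives smallness in
L¹ only, which is enough against bounded test functions. -/
theorem eLpNorm_strain_sub_le
    (hSO : ∀ᵐ x ∂(volume.restrict ω), R x ∈ Matrix.specialOrthogonalGroup (Fin 3) ℝ)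
    (hR : ∀ i j, MemLp (fun x => R x i j - (1 : Matrix (Fin 3) (Fin 3) ℝ) i j) 2
      (volume.restrict ω))
    (hH : ∀ i j, MemLp (fun x => scaledDiff θ h Dy R x i j) 2 (volume.restrict (plate₁ ω)))
    {C c : ENNReal}
    (hC : ∀ i j, eLpNorm (fun x => scaledDiff θ h Dy R x i j) 2 (volume.restrict (plate₁ ω)) ≤ C)
    (hc : ∀ i j, eLpNorm (fun x => R x i j - (1 : Matrix (Fin 3) (Fin 3) ℝ) i j) 2
      (volume.restrict ω) ≤ c)
    (i j : Fin 3) :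
    eLpNorm (fun x => strain θ h Dy R x i j - scaledDiff θ h Dy R x i j) 1
      (volume.restrict (plate₁ ω)) ≤ 3 * (c * C) := by
  have e : (fun x => strain θ h Dy R x i j - scaledDiff θ h Dy R x i j)
      =ᵐ[volume.restrict (plate₁ ω)] ∑ k, fun x : R3 =>
        (R x.1 k i - (1 : Matrix (Fin 3) (Fin 3) ℝ) k i) * scaledDiff θ h Dy R x k j := by
    filter_upwards [ae_plate₁_of_ae hSO] with x hx
    rw [Finset.sum_apply]
    exact strain_sub_apply hx i j
  have hR3 := fun k => memLp_fst_plate₁ (hR k i)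
  rw [eLpNorm_congr_ae e]
  refine (eLpNorm_sum_le (fun k _ => (hR3 k).1.mul (hH k j).1) le_rfl).trans ?_
  calc ∑ k, eLpNorm (fun x : R3 => (R x.1 k i - (1 : Matrix (Fin 3) (Fin 3) ℝ) k i) *
        scaledDiff θ h Dy R x k j) 1 (volume.restrict (plate₁ ω)) ≤ ∑ _k : Fin 3, c * C := by
        refine Finset.sum_le_sum fun k _ => ?_
        refine (eLpNorm_one_mul_le (hR3 k).1 (hH k j).1).trans (mul_le_mul' ?_ (hC k j))
        rw [eLpNorm_fst_plate₁ (hR k i).1]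
        exact hc k i
    _ = 3 * (c * C) := by simp

end Single

variable {h : ℕ → ℝ} {Dy : ℕ → R3 → Matrix (Fin 3) (Fin 3) ℝ}
  {R : ℕ → R2 → Matrix (Fin 3) (Fin 3) ℝ}

theorem exists_scaledDiff_bound (h_pos : ∀ n, 0 < h n)
    (h_grad : ∃ C : ℝ, ∀ n i j,
      eLpNorm (fun x : R3 => pulledGrad θ (h n) (Dy n) x i j - R n x.1 i j) 2
        (volume.restrict (plate₁ ω)) ≤ ENNReal.ofReal (C * h n ^ 4)) :
    ∃ C : ENNReal, C ≠ ⊤ ∧ ∀ n i j, eLpNorm (fun x => scaledDiff θ (h n) (Dy n) (R n) x i j) 2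
        (volume.restrict (plate₁ ω)) ≤ C := by
  obtain ⟨C, hC⟩ := h_grad
  exact ⟨ENNReal.ofReal C, ENNReal.ofReal_ne_top, fun n i j =>
    eLpNorm_div_le (pow_pos (h_pos n) 4) (hC n i j)⟩

/-- Up to a vanishing error, the scaled difference has the two-scale limit of the strain. -/
theorem tendsto_scaledDiff (hωb : Bornology.IsBounded ω) (h_lim : Tendsto h atTop (𝓝 0))
    (hSO : ∀ n, ∀ᵐ x ∂(volume.restrict ω),
      R n x ∈ Matrix.specialOrthogonalGroup (Fin 3) ℝ)
    (hR : ∀ n i j, MemLp (fun x => R n x i j) 2 (volume.restrict ω))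
    (hH : ∀ n i j, MemLp (fun x => scaledDiff θ (h n) (Dy n) (R n) x i j) 2
      (volume.restrict (plate₁ ω)))
    {C : ENNReal} (hC : C ≠ ⊤)
    (hHC : ∀ n i j, eLpNorm (fun x => scaledDiff θ (h n) (Dy n) (R n) x i j) 2
      (volume.restrict (plate₁ ω)) ≤ C)
    (hR_I : ∃ C : ℝ, ∀ n i j,
      eLpNorm (fun x => R n x i j - (1 : Matrix (Fin 3) (Fin 3) ℝ) i j) 2
        (volume.restrict ω) ≤ ENNReal.ofReal (C * h n ^ 2)) {i j : Fin 3} {G : R3 → R2 → ℝ}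
    (hG : TwoScaleTendsto (volume.restrict (plate₁ ω)) Prod.fst h
      (fun n x => strain θ (h n) (Dy n) (R n) x i j) G) {ϕ : R3 → ℝ} (hϕ : Continuous ϕ) {a : ℝ}
    (ha : ∀ x, |ϕ x| ≤ a) {g : R2 → ℝ} (hg : g ∈ smoothPeriodic) :
    Tendsto (fun n => ∫ x in plate₁ ω, scaledDiff θ (h n) (Dy n) (R n) x i j *
      (ϕ x * g ((h n)⁻¹ • x.1))) atTop (𝓝 (∫ x in plate₁ ω, (∫ y in Y, G x y * g y) * ϕ x)) := by
  have := isFiniteMeasure_restrict_of_isBounded (μ := (volume : Measure R2)) hωb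
  have := isFiniteMeasure_restrict_of_isBounded (μ := (volume : Measure R3))
    (isBounded_plate₁ hωb)
  obtain ⟨K, hK⟩ := hR_I
  obtain ⟨b, hb⟩ := smoothPeriodic_bounded hg
  have hW : ∀ n, Continuous fun x : R3 => ϕ x * g ((h n)⁻¹ • x.1) := fun n =>
    hϕ.mul (hg.1.continuous.comp ((continuous_const_smul (h n)⁻¹).comp continuous_fst))
  have hWb : ∀ n (x : R3), |ϕ x * g ((h n)⁻¹ • x.1)| ≤ a * b := by
    intro n x
    rw [abs_mul]
    exact mul_le_mul (ha _) (hb _) (abs_nonneg _) ((abs_nonneg _).trans (ha x))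
  have T := hG.test hϕ.aestronglyMeasurable ha hg.2 hg.1.continuous
  have hsub : Tendsto (fun n => eLpNorm (fun x => strain θ (h n) (Dy n) (R n) x i j -
      scaledDiff θ (h n) (Dy n) (R n) x i j) 1 (volume.restrict (plate₁ ω))) atTop (𝓝 0) := by
    have hz : Tendsto (fun n => 3 * (ENNReal.ofReal (K * h n ^ 2) * C)) atTop (𝓝 0) := by
      have h1 : Tendsto (fun n => K * h n ^ 2) atTop (𝓝 0) := by
        simpa using (h_lim.pow 2).const_mul K
      have h2 := ENNReal.Tendsto.const_mul (a := 3) (ENNReal.Tendsto.mul_const (b := C)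
        (ENNReal.tendsto_ofReal h1) (Or.inr hC)) (Or.inr (by simp))
      simpa using h2
    refine tendsto_of_tendsto_of_tendsto_of_le_of_le tendsto_const_nhds hz
      (fun _ => zero_le) fun n => ?_
    exact eLpNorm_strain_sub_le (hSO n) (fun i j => (hR n i j).sub (memLp_const _)) (hH n) (hHC n)
      (hK n) i j
  have T2 := tendsto_integral_mul_zero_of_eLpNorm hsub
    (W := fun n x => ϕ x * g ((h n)⁻¹ • x.1)) (c := a * b) fun n => ae_of_all _ (hWb n)
  have T3 := T.sub T2
  rw [sub_zero] at T3
  refine T3.congr fun n => ?_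
  have i1 : Integrable (fun x => strain θ (h n) (Dy n) (R n) x i j *
      (ϕ x * g ((h n)⁻¹ • x.1))) (volume.restrict (plate₁ ω)) :=
    ((hG.memLp n).integrable one_le_two).mul_bdd (hW n).aestronglyMeasurable
      (ae_of_all _ (hWb n))
  have i2 : Integrable (fun x => scaledDiff θ (h n) (Dy n) (R n) x i j *
      (ϕ x * g ((h n)⁻¹ • x.1))) (volume.restrict (plate₁ ω)) :=
    ((hH n i j).integrable one_le_two).mul_bdd (hW n).aestronglyMeasurable
      (ae_of_all _ (hWb n))
  simp_rw [sub_mul]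
  rw [integral_sub i1 i2, sub_sub_cancel]

/-- Strongly convergent sequences of functions on the plate two-scale converge. -/
theorem tendsto_of_strong (hω : IsOpen ω) (hωb : Bornology.IsBounded ω) (h_pos : ∀ n, 0 < h n)
    (h_lim : Tendsto h atTop (𝓝 0)) {s : ℕ → R3 → ℝ} {s₀ : R3 → ℝ}
    (hs : L2Tendsto (volume.restrict (plate₁ ω)) s s₀) {ϕ : R3 → ℝ} (hϕ : Continuous ϕ) {a : ℝ}
    (ha : ∀ x, |ϕ x| ≤ a) {g : R2 → ℝ} (hg : g ∈ smoothPeriodic) :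
    Tendsto (fun n => ∫ x in plate₁ ω, s n x * (ϕ x * g ((h n)⁻¹ • x.1))) atTop
      (𝓝 (∫ x in plate₁ ω, (∫ y in Y, s₀ x * g y) * ϕ x)) := by
  have := isFiniteMeasure_restrict_of_isBounded (μ := (volume : Measure R3))
    (isBounded_plate₁ hωb)
  obtain ⟨b, hb⟩ := smoothPeriodic_bounded hg
  have hm : MeasurableSet (plate₁ ω) := (isOpen_plate hω 1).measurableSet
  have hW : ∀ n, Continuous fun x : R3 => ϕ x * g ((h n)⁻¹ • x.1) := fun n =>
    hϕ.mul (hg.1.continuous.comp ((continuous_const_smul (h n)⁻¹).comp continuous_fst))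
  have hWb : ∀ n (x : R3), |ϕ x * g ((h n)⁻¹ • x.1)| ≤ a * b := by
    intro n x
    rw [abs_mul]
    exact mul_le_mul (ha _) (hb _) (abs_nonneg _) ((abs_nonneg _).trans (ha x))
  have T := (twoScaleTendsto_const hm h_pos h_lim hs.memLp_lim).test hϕ.aestronglyMeasurable ha
    hg.2 hg.1.continuous
  have e : ∫ x in plate₁ ω, (∫ y in Y, (plate₁ ω).indicator s₀ x * g y) * ϕ x =
      ∫ x in plate₁ ω, (∫ y in Y, s₀ x * g y) * ϕ x :=
    setIntegral_congr_fun hm fun x hx => by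
      have hx' : (plate₁ ω).indicator s₀ x = s₀ x := Set.indicator_of_mem hx s₀
      simp only [hx']
  have T' : Tendsto (fun n => ∫ x in plate₁ ω, s₀ x * (ϕ x * g ((h n)⁻¹ • x.1))) atTop
      (𝓝 (∫ x in plate₁ ω, (∫ y in Y, s₀ x * g y) * ϕ x)) := by
    rw [← e]
    exact T
  have hsub : Tendsto (fun n => eLpNorm (fun x => s n x - s₀ x) 1 (volume.restrict (plate₁ ω)))
      atTop (𝓝 0) := by
    have hz : Tendsto (fun n => eLpNorm (fun x => s n x - s₀ x) 2 (volume.restrict (plate₁ ω)) *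
        (volume.restrict (plate₁ ω)) Set.univ ^
          (1 / (1 : ENNReal).toReal - 1 / (2 : ENNReal).toReal)) atTop (𝓝 0) := by
      have := ENNReal.Tendsto.mul_const (b := (volume.restrict (plate₁ ω)) Set.univ ^
        (1 / (1 : ENNReal).toReal - 1 / (2 : ENNReal).toReal)) hs.tendsto
        (Or.inr (ENNReal.rpow_ne_top_of_nonneg (by norm_num) (measure_ne_top _ _)))
      rwa [zero_mul] at this
    exact tendsto_of_tendsto_of_tendsto_of_le_of_le tendsto_const_nhds hz (fun _ => zero_le)
      fun n => eLpNorm_le_eLpNorm_mul_rpow_measure_univ one_le_two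
        ((hs.memLp n).1.sub hs.memLp_lim.1)
  have T2 := tendsto_integral_mul_zero_of_eLpNorm hsub
    (W := fun n x => ϕ x * g ((h n)⁻¹ • x.1)) (c := a * b) fun n => ae_of_all _ (hWb n)
  have T3 := T2.add T'
  rw [zero_add] at T3
  refine T3.congr fun n => ?_
  have i1 : Integrable (fun x => s n x * (ϕ x * g ((h n)⁻¹ • x.1)))
      (volume.restrict (plate₁ ω)) :=
    ((hs.memLp n).integrable one_le_two).mul_bdd (hW n).aestronglyMeasurable (ae_of_all _ (hWb n))
  have i2 : Integrable (fun x => s₀ x * (ϕ x * g ((h n)⁻¹ • x.1)))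
      (volume.restrict (plate₁ ω)) :=
    (hs.memLp_lim.integrable one_le_two).mul_bdd (hW n).aestronglyMeasurable
      (ae_of_all _ (hWb n))
  simp_rw [sub_mul]
  rw [integral_sub i1 i2, sub_add_cancel]

end WrinkledPlate

/-! ### Sequences of deformations: compactness and the two limit relations -/

namespace WrinkledPlate

/-- Sequences of deformations of the wrinkled plate whose gradients are close to rotations, which
are in turn close to the identity. -/
structure IsPlateSequence (ω : Set R2) (θ : R2 → ℝ) (h : ℕ → ℝ) (y : ℕ → R3 → Fin 3 → ℝ)
    (Dy : ℕ → R3 → Matrix (Fin 3) (Fin 3) ℝ) (R : ℕ → R2 → Matrix (Fin 3) (Fin 3) ℝ)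
    (DR : ℕ → R2 → Fin 3 → Fin 3 → Fin 2 → ℝ) (Duh : ℕ → R2 → Matrix (Fin 2) (Fin 2) ℝ) :
    Prop where
  isOpen : IsOpen ω
  isBounded : Bornology.IsBounded ω
  contDiff : ContDiff ℝ 2 θ
  periodic : IsYPeriodic θ
  pos : ∀ n, 0 < h n
  lim : Tendsto h atTop (𝓝 0)
  deformation : ∀ n i, HasW12Grad e3 (wrinkledPlate ω θ (h n)) (fun x => y n x i)
    (fun x => Dy n x i)
  rotation : ∀ n i j, HasW12Grad e2 ω (fun x => R n x i j) (fun x => DR n x i j)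
  rotation_mem : ∀ n, ∀ᵐ x ∂(volume.restrict ω),
    R n x ∈ Matrix.specialOrthogonalGroup (Fin 3) ℝ
  grad_memLp : ∀ n i j, MemLp (fun x => pulledGrad θ (h n) (Dy n) x i j) 2
    (volume.restrict (plate₁ ω))
  grad_bound : ∃ C : ℝ, ∀ n i j,
    eLpNorm (fun x : R3 => pulledGrad θ (h n) (Dy n) x i j - R n x.1 i j) 2
      (volume.restrict (plate₁ ω)) ≤ ENNReal.ofReal (C * h n ^ 4)
  rotation_bound : ∃ C : ℝ, ∀ n i j,
    eLpNorm (fun x => R n x i j - (1 : Matrix (Fin 3) (Fin 3) ℝ) i j) 2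
      (volume.restrict ω) ≤ ENNReal.ofReal (C * h n ^ 2)
  rotation_grad_bound : ∃ C : ℝ, ∀ n i j β,
    eLpNorm (fun x => DR n x i j β) 2 (volume.restrict ω) ≤ ENNReal.ofReal (C * h n ^ 2)
  displacement : ∀ n α, HasW12Grad e2 ω (fun x => inPlaneDisp θ (h n) (y n) (R n) x α)
    (fun x => Duh n x α)

namespace IsPlateSequence

variable {ω : Set R2} {θ : R2 → ℝ} {h : ℕ → ℝ} {y : ℕ → R3 → Fin 3 → ℝ}
  {Dy : ℕ → R3 → Matrix (Fin 3) (Fin 3) ℝ} {R : ℕ → R2 → Matrix (Fin 3) (Fin 3) ℝ}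
  {DR : ℕ → R2 → Fin 3 → Fin 3 → Fin 2 → ℝ} {Duh : ℕ → R2 → Matrix (Fin 2) (Fin 2) ℝ}

theorem subseq (hs : IsPlateSequence ω θ h y Dy R DR Duh) {φ : ℕ → ℕ} (hφ : StrictMono φ) :
    IsPlateSequence ω θ (fun n => h (φ n)) (fun n => y (φ n)) (fun n => Dy (φ n))
      (fun n => R (φ n)) (fun n => DR (φ n)) (fun n => Duh (φ n)) where
  isOpen := hs.isOpen
  isBounded := hs.isBounded
  contDiff := hs.contDiff
  periodic := hs.periodic
  pos _ := hs.pos _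
  lim := hs.lim.comp hφ.tendsto_atTop
  deformation _ := hs.deformation _
  rotation _ := hs.rotation _
  rotation_mem _ := hs.rotation_mem _
  grad_memLp _ := hs.grad_memLp _
  grad_bound := let ⟨C, hC⟩ := hs.grad_bound; ⟨C, fun _ => hC _⟩
  rotation_bound := let ⟨C, hC⟩ := hs.rotation_bound; ⟨C, fun _ => hC _⟩
  rotation_grad_bound := let ⟨C, hC⟩ := hs.rotation_grad_bound; ⟨C, fun _ => hC _⟩
  displacement _ := hs.displacement _

theorem isFiniteMeasure (hs : IsPlateSequence ω θ h y Dy R DR Duh) :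
    IsFiniteMeasure ((volume : Measure R2).restrict ω) :=
  isFiniteMeasure_restrict_of_isBounded hs.isBounded

theorem isFiniteMeasure_plate₁ (hs : IsPlateSequence ω θ h y Dy R DR Duh) :
    IsFiniteMeasure ((volume : Measure R3).restrict (plate₁ ω)) :=
  isFiniteMeasure_restrict_of_isBounded (isBounded_plate₁ hs.isBounded)

theorem memLp_scaledDiff (hs : IsPlateSequence ω θ h y Dy R DR Duh) (n : ℕ) (i j : Fin 3) :
    MemLp (fun x => scaledDiff θ (h n) (Dy n) (R n) x i j) 2 (volume.restrict (plate₁ ω)) :=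
  WrinkledPlate.memLp_scaledDiff (hs.grad_memLp n i j) (hs.rotation n i j).memLp

theorem memLp_rotation_grad (hs : IsPlateSequence ω θ h y Dy R DR Duh) (n : ℕ) (i j : Fin 3)
    (β : Fin 2) : MemLp (fun x => DR n x i j β / h n ^ 2) 2 (volume.restrict ω) := by
  have := ((hs.rotation n i j).grad_memLp β).const_mul (h n ^ 2)⁻¹
  simpa only [div_eq_inv_mul] using this

/-- Every subsequence of the scaled strains has a two-scale convergent subsequence. -/
theorem exists_twoScale (hs : IsPlateSequence ω θ h y Dy R DR Duh) :
    ∃ ψ : ℕ → ℕ, StrictMono ψ ∧ ∃ G : R3 → R2 → Matrix (Fin 3) (Fin 3) ℝ, ∀ i j,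
      TwoScaleTendsto (volume.restrict (plate₁ ω)) Prod.fst (h ∘ ψ)
        (fun n x => strain θ (h (ψ n)) (Dy (ψ n)) (R (ψ n)) x i j) (fun x z => G x z i j) := by
  obtain ⟨C, hC, hHC⟩ := exists_scaledDiff_bound hs.pos hs.grad_bound
  have hm : MeasurableSet (plate₁ ω) := (isOpen_plate hs.isOpen 1).measurableSet
  have hS := fun n => memLp_strain (hs.rotation_mem n) (fun i j => (hs.rotation n i j).memLp)
    (hs.memLp_scaledDiff n) (hHC n)
  -- One matrix entry is treated at a time, and each extraction refines the preceding one; two-scale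
  -- limits already found persist along further subsequences.
  have key : ∀ s : Finset (Fin 3 × Fin 3), ∃ ψ : ℕ → ℕ, StrictMono ψ ∧
      ∃ G : Fin 3 × Fin 3 → R3 → R2 → ℝ, ∀ p ∈ s,
      TwoScaleTendsto (volume.restrict (plate₁ ω)) Prod.fst (h ∘ ψ)
        (fun n x => strain θ (h (ψ n)) (Dy (ψ n)) (R (ψ n)) x p.1 p.2) (G p) := by
    intro s
    induction s using Finset.induction_on with
    | empty => exact ⟨id, strictMono_id, fun _ _ _ => 0, by simp⟩
    | insert p s hp ih =>
      obtain ⟨ψ, hψ, G, hG⟩ := ih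
      obtain ⟨χ, hχ, w, hw⟩ := exists_subseq_twoScaleTendsto hm
        (h := h ∘ ψ) (fun n => hs.pos _) (hs.lim.comp hψ.tendsto_atTop)
        (u := fun n x => strain θ (h (ψ n)) (Dy (ψ n)) (R (ψ n)) x p.1 p.2)
        (fun n => (hS _ p.1 p.2).1) (ENNReal.mul_ne_top (by simp) hC)
        (fun n => (hS _ p.1 p.2).2)
      refine ⟨ψ ∘ χ, hψ.comp hχ, Function.update G p w, fun q hq => ?_⟩
      rcases Finset.mem_insert.1 hq with rfl | hq
      · rw [Function.update_self]
        exact hw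
      · have hne : q ≠ p := fun h => hp (by rwa [h] at hq)
        rw [Function.update_of_ne hne]
        exact (hG q hq).subseq hχ
  obtain ⟨ψ, hψ, G, hG⟩ := key Finset.univ
  exact ⟨ψ, hψ, fun x z => Matrix.of fun i j => G (i, j) x z, fun i j =>
    hG (i, j) (Finset.mem_univ _)⟩

/-- The chain rule needs h below the threshold at which Θ is a diffeomorphism onto its image, so
every identity along the sequence holds only eventually. -/
theorem eventually_chainRule (hs : IsPlateSequence ω θ h y Dy R DR Duh) :
    ∀ᶠ n in atTop, ∀ i, IntegrableOn (fun x => y n (Θ θ (h n) (P (h n) x)) i) (plate₁ ω) ∧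
      ChainRule θ ω (h n) (fun x => y n (Θ θ (h n) (P (h n) x)) i)
        (fun x k => pulledGrad θ (h n) (Dy n) x i k) := by
  obtain ⟨h₀, h₀pos, hch⟩ := exists_chain_rule hs.isOpen hs.isBounded hs.contDiff hs.periodic
  filter_upwards [hs.lim.eventually_lt_const h₀pos] with n hn i
  exact hch (h n) (hs.pos n) hn (fun x => y n x i) (fun x => Dy n x i) (hs.deformation n i)

theorem eventually_transverse_identity (hs : IsPlateSequence ω θ h y Dy R DR Duh) (i : Fin 3)
    (β : Fin 2) {η : ℝ → ℝ} (hη : η ∈ testFunctions thick) :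
    ∀ᶠ n in atTop, ∀ φ ∈ testFunctions ω,
      ∑ k, ∫ x in plate₁ ω, scaledDiff θ (h n) (Dy n) (R n) x i k *
        (co3 k (tangent θ (h n) β x) * (φ x.1 * deriv η x.2)) =
      ∑ k, (h n ^ 2 * (∫ x in plate₁ ω, scaledDiff θ (h n) (Dy n) (R n) x i k *
          (co3 k (normal θ (h n) x.1) * (fderiv ℝ φ x.1 (e2 β) * η x.2))) -
        ∫ x in plate₁ ω, (DR n x.1 i k β / h n ^ 2) *
          (co3 k (normal θ (h n) x.1) * (φ x.1 * η x.2))) := by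
  have := hs.isFiniteMeasure
  have := hs.isFiniteMeasure_plate₁
  filter_upwards [hs.eventually_chainRule] with n hn φ hφ
  exact transverse_identity hs.isOpen hs.isBounded hs.contDiff (hs.pos n)
    (f := fun x k => pulledGrad θ (h n) (Dy n) x i k) (r := fun x k => R n x i k)
    (Dr := fun x k β => DR n x i k β)
    (fun k => (hs.grad_memLp n i k).integrable one_le_two) (hn i).2
    (fun k => (hs.rotation n i k).memLp.integrable one_le_two)
    (fun k β => ((hs.rotation n i k).grad_memLp β).integrable one_le_two)
    (fun k => (hs.rotation n i k).weakDeriv) β hφ hη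

theorem eventually_in_plane_identity (hs : IsPlateSequence ω θ h y Dy R DR Duh)
    (α β : Fin 2) :
    ∀ᶠ n in atTop, ∀ φ ∈ testFunctions ω, ∫ x in ω, Duh n x α β * φ x =
      (∑ k, ∫ x in plate₁ ω, scaledDiff θ (h n) (Dy n) (R n) x α.castSucc k *
        (co3 k (tangent θ (h n) β x) * φ x.1)) +
      (∫ x in ω, ((R n x α.castSucc β.castSucc - (1 : Matrix (Fin 2) (Fin 2) ℝ) α β) /
        h n ^ 4) * φ x)
      - ∫ x in ω, (DR n x α.castSucc 2 β / h n ^ 2) * (θ₀ θ ((h n)⁻¹ • x) * φ x) := by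
  have := hs.isFiniteMeasure
  have := hs.isFiniteMeasure_plate₁
  filter_upwards [hs.eventually_chainRule] with n hn φ hφ
  exact in_plane_identity hs.isOpen hs.isBounded hs.contDiff (hs.pos n) (hn α.castSucc).1
    (f := fun x k => pulledGrad θ (h n) (Dy n) x α.castSucc k)
    (DR := fun x k β => DR n x α.castSucc k β)
    (fun k => (hs.grad_memLp n _ k).integrable one_le_two) (hn α.castSucc).2
    (fun k => (hs.rotation n _ k).memLp.integrable one_le_two)
    (fun k β => ((hs.rotation n _ k).grad_memLp β).integrable one_le_two)
    (fun k => (hs.rotation n _ k).weakDeriv) β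
    ((hs.displacement n α).memLp.integrable one_le_two) ((hs.displacement n α).weakDeriv β) hφ

/-- The two-scale limit of the strain has an explicit transverse derivative. -/
theorem transverse_limit (hs : IsPlateSequence ω θ h y Dy R DR Duh) {α β : Fin 2}
    {G : R3 → R2 → ℝ} {G₁ : R2 → R2 → ℝ}
    (hG : TwoScaleTendsto (volume.restrict (plate₁ ω)) Prod.fst h
      (fun n x => strain θ (h n) (Dy n) (R n) x α.castSucc β.castSucc) G)
    (hG₁ : TwoScaleTendsto (volume.restrict ω) id h
      (fun n x => DR n x α.castSucc 2 β / h n ^ 2) G₁) {φ : R2 → ℝ}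
    (hφ : φ ∈ testFunctions ω) {η : ℝ → ℝ} (hη : η ∈ testFunctions thick) {g : R2 → ℝ}
    (hg : g ∈ smoothPeriodic) :
    ∫ x in plate₁ ω, (∫ y in Y, G x y * g y) * (φ x.1 * deriv η x.2) =
      - ((∫ x in ω, (∫ y in Y, G₁ x y * g y) * φ x) * ∫ t in thick, η t) := by
  have := hs.isFiniteMeasure
  have := hs.isFiniteMeasure_plate₁
  obtain ⟨C, hC, hHC⟩ := exists_scaledDiff_bound hs.pos hs.grad_bound
  obtain ⟨C₁, hC₁, hone⟩ := exists_eLpNorm_one_le (μ := (volume : Measure R3).restrict (plate₁ ω)) hC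
  obtain ⟨K, hK⟩ := hs.rotation_grad_bound
  obtain ⟨K₁, hK₁, hone'⟩ := exists_eLpNorm_one_le (μ := (volume : Measure R2).restrict ω)
    (ENNReal.ofReal_ne_top (r := K))
  obtain ⟨a, ha⟩ := testFunctions_bounded hφ
  obtain ⟨d, hd⟩ := testFunctions_bounded (deriv_mem_testFunctions hη)
  have hϕ : Continuous fun x : R3 => φ x.1 * deriv η x.2 :=
    (hφ.1.continuous.comp continuous_fst).mul
      ((deriv_mem_testFunctions hη).1.continuous.comp continuous_snd)
  have hϕb : ∀ x : R3, |φ x.1 * deriv η x.2| ≤ a * d := fun x => by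
    rw [abs_mul]
    exact mul_le_mul (ha _) (hd _) (abs_nonneg _) ((abs_nonneg _).trans (ha x.1))
  have L := tendsto_scaledDiff hs.isBounded hs.lim hs.rotation_mem
    (fun n i j => (hs.rotation n i j).memLp) hs.memLp_scaledDiff hC hHC hs.rotation_bound hG hϕ
    hϕb hg
  have L' := hG₁.test hφ.1.continuous.aestronglyMeasurable ha hg.2 hg.1.continuous
  exact WrinkledPlate.transverse_limit hs.isOpen hs.contDiff hs.periodic hs.pos hs.lim
    (H := fun n x k => scaledDiff θ (h n) (Dy n) (R n) x α.castSucc k)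
    (D := fun n x k => DR n x α.castSucc k β / h n ^ 2) hC₁ hK₁ β
    (fun n k => (hs.memLp_scaledDiff n _ k).integrable one_le_two)
    (fun n k => hone _ (hs.memLp_scaledDiff n _ k).1 (hHC n _ k))
    (fun n k => (hs.memLp_rotation_grad n _ k β).integrable one_le_two)
    (fun n k => hone' _ (hs.memLp_rotation_grad n _ k β).1
      (eLpNorm_div_le (pow_pos (hs.pos n) 2) (hK n _ k β)))
    hφ hg hη (hs.eventually_transverse_identity α.castSucc β hη) L L'

theorem isYPeriodic_θ₀ (hθ : IsYPeriodic θ) : IsYPeriodic (θ₀ θ) := fun i x => by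
  rw [θ₀, θ₀, hθ i x]

/-- The two-scale limit of the in-plane identity. -/
theorem in_plane_limit (hs : IsPlateSequence ω θ h y Dy R DR Duh) {α β : Fin 2}
    {G : R3 → R2 → ℝ} {G₁ U : R2 → R2 → ℝ}
    (hG : TwoScaleTendsto (volume.restrict (plate₁ ω)) Prod.fst h
      (fun n x => strain θ (h n) (Dy n) (R n) x α.castSucc β.castSucc) G)
    (hG₁ : TwoScaleTendsto (volume.restrict ω) id h
      (fun n x => DR n x α.castSucc 2 β / h n ^ 2) G₁)
    (hU : TwoScaleTendsto (volume.restrict ω) id h (fun n x => Duh n x α β) U)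
    {φ : R2 → ℝ} (hφ : φ ∈ testFunctions ω) {g : R2 → ℝ} (hg : g ∈ smoothPeriodic) :
    Tendsto (fun n => ∫ x in ω, ((R n x α.castSucc β.castSucc -
        (1 : Matrix (Fin 2) (Fin 2) ℝ) α β) / h n ^ 4) * (φ x * g ((h n)⁻¹ • x))) atTop
      (𝓝 ((∫ x in ω, (∫ y in Y, U x y * g y) * φ x) -
        (∫ x in plate₁ ω, (∫ y in Y, G x y * g y) * φ x.1) +
        ∫ x in ω, (∫ y in Y, G₁ x y * (θ₀ θ y * g y)) * φ x)) := by
  have := hs.isFiniteMeasure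
  have := hs.isFiniteMeasure_plate₁
  obtain ⟨C, hC, hHC⟩ := exists_scaledDiff_bound hs.pos hs.grad_bound
  obtain ⟨C₁, hC₁, hone⟩ := exists_eLpNorm_one_le (μ := (volume : Measure R3).restrict (plate₁ ω)) hC
  obtain ⟨a, ha⟩ := testFunctions_bounded hφ
  have hϕ : Continuous fun x : R3 => φ x.1 := hφ.1.continuous.comp continuous_fst
  have L := tendsto_scaledDiff hs.isBounded hs.lim hs.rotation_mem
    (fun n i j => (hs.rotation n i j).memLp) hs.memLp_scaledDiff hC hHC hs.rotation_bound hG hϕ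
    (fun x => ha x.1) hg
  have hθg : IsYPeriodic fun y => θ₀ θ y * g y := fun i x => by
    simp only [isYPeriodic_θ₀ hs.periodic i x, hg.2 i x]
  have L' := hG₁.test hφ.1.continuous.aestronglyMeasurable ha hθg
    ((contDiff_θ₀ hs.contDiff).continuous.mul hg.1.continuous)
  have L'' := hU.test hφ.1.continuous.aestronglyMeasurable ha hg.2 hg.1.continuous
  exact WrinkledPlate.in_plane_limit hs.isOpen hs.contDiff hs.periodic hs.pos hs.lim
    (H := fun n x k => scaledDiff θ (h n) (Dy n) (R n) x α.castSucc k)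
    (U := fun n x => Duh n x α β) (D := fun n x => DR n x α.castSucc 2 β / h n ^ 2)
    hC₁ β
    (fun n k => (hs.memLp_scaledDiff n _ k).integrable one_le_two)
    (fun n k => hone _ (hs.memLp_scaledDiff n _ k).1 (hHC n _ k))
    hφ hg (hs.eventually_in_plane_identity α β) L L' L''

end IsPlateSequence

end WrinkledPlate

/-! ### The symmetrised average over the thickness -/

namespace WrinkledPlate

theorem integral_combination {X : Type*} [MeasurableSpace X] {μ : Measure X}
    {f₁ f₂ f₃ f₄ f₅ f₆ f₇ : X → ℝ} (h₁ : Integrable f₁ μ) (h₂ : Integrable f₂ μ)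
    (h₃ : Integrable f₃ μ) (h₄ : Integrable f₄ μ) (h₅ : Integrable f₅ μ) (h₆ : Integrable f₆ μ)
    (h₇ : Integrable f₇ μ) :
    ∫ x, f₁ x + f₂ x + (f₃ x + f₄ x) - 2 * f₅ x - (f₆ x + f₇ x) ∂μ =
      (∫ x, f₁ x ∂μ) + (∫ x, f₂ x ∂μ) + ((∫ x, f₃ x ∂μ) + ∫ x, f₄ x ∂μ) - 2 * (∫ x, f₅ x ∂μ) -
        ((∫ x, f₆ x ∂μ) + ∫ x, f₇ x ∂μ) := by
  have i12 : Integrable (fun x => f₁ x + f₂ x) μ := h₁.add h₂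
  have i34 : Integrable (fun x => f₃ x + f₄ x) μ := h₃.add h₄
  have i67 : Integrable (fun x => f₆ x + f₇ x) μ := h₆.add h₇
  have i1234 : Integrable (fun x => f₁ x + f₂ x + (f₃ x + f₄ x)) μ := i12.add i34
  have i5 : Integrable (fun x => 2 * f₅ x) μ := h₅.const_mul 2
  have i12345 : Integrable (fun x => f₁ x + f₂ x + (f₃ x + f₄ x) - 2 * f₅ x) μ := i1234.sub i5
  rw [integral_sub i12345 i67, integral_sub i1234 i5, integral_add i12 i34, integral_add h₁ h₂,
    integral_add h₃ h₄, integral_add h₆ h₇, integral_const_mul]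

namespace IsPlateSequence

variable {ω : Set R2} {θ : R2 → ℝ} {h : ℕ → ℝ} {y : ℕ → R3 → Fin 3 → ℝ}
  {Dy : ℕ → R3 → Matrix (Fin 3) (Fin 3) ℝ} {R : ℕ → R2 → Matrix (Fin 3) (Fin 3) ℝ}
  {DR : ℕ → R2 → Fin 3 → Fin 3 → Fin 2 → ℝ} {Duh : ℕ → R2 → Matrix (Fin 2) (Fin 2) ℝ}

/-- Links the symmetric part, whose strong convergence is known on the plate, with the two separate
entries that occur in the in-plane identities on ω. The 2 undoes the ½ in `sym`. -/
theorem integral_sym_rotation (hs : IsPlateSequence ω θ h y Dy R DR Duh) (n : ℕ) (α β : Fin 2)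
    {w : R2 → ℝ} (hw : Continuous w) :
    2 * ∫ x in plate₁ ω, sym (R n x.1 - 1) α.castSucc β.castSucc / h n ^ 4 * w x.1 =
      (∫ x in ω, ((R n x α.castSucc β.castSucc -
        (1 : Matrix (Fin 2) (Fin 2) ℝ) α β) / h n ^ 4) * w x) +
      ∫ x in ω, ((R n x β.castSucc α.castSucc -
        (1 : Matrix (Fin 2) (Fin 2) ℝ) β α) / h n ^ 4) * w x := by
  have := hs.isFiniteMeasure
  have hi : ∀ α β : Fin 2, IntegrableOn (fun x => ((R n x α.castSucc β.castSucc -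
      (1 : Matrix (Fin 2) (Fin 2) ℝ) α β) / h n ^ 4) * w x) ω := by
    intro α β
    refine integrable_mul_plane hs.isOpen hs.isBounded ?_ hw
    exact (((hs.rotation n _ _).memLp.integrable one_le_two).sub (integrable_const _)).div_const _
  rw [integral_plate₁_fst ω (fun x => sym (R n x - 1) α.castSucc β.castSucc / h n ^ 4 * w x),
    ← integral_add (hi α β) (hi β α), ← integral_const_mul]
  congr 1; ext x
  have e : ∀ α β : Fin 2, (1 : Matrix (Fin 3) (Fin 3) ℝ) α.castSucc β.castSucc =
      (1 : Matrix (Fin 2) (Fin 2) ℝ) α β := by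
    intro α β
    simp [Matrix.one_apply]
  simp only [sym, Matrix.smul_apply, Matrix.add_apply, Matrix.sub_apply, Matrix.transpose_apply,
    smul_eq_mul, e]
  ring

/-- The in-plane limits for (α, β) and (β, α) add up to a limit for twice the symmetric part of (R -
I)/h⁴, tested with oscillating functions. Strong convergence gives the limit of the same integrals
in terms of 2a. Equating the two and separating in (x', y) gives the relation; without
symmetrisation there would be no second limit to compare with. -/
theorem sym_average (hs : IsPlateSequence ω θ h y Dy R DR Duh)
    {G : R3 → R2 → Matrix (Fin 3) (Fin 3) ℝ} {G₁ U : R2 → R2 → Matrix (Fin 2) (Fin 2) ℝ}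
    (hG : ∀ i j, TwoScaleTendsto (volume.restrict (plate₁ ω)) Prod.fst h
      (fun n x => strain θ (h n) (Dy n) (R n) x i j) (fun x z => G x z i j))
    (hG₁ : ∀ α β : Fin 2, TwoScaleTendsto (volume.restrict ω) id h
      (fun n x => DR n x α.castSucc 2 β / h n ^ 2) (fun x z => G₁ x z α β))
    (hU : ∀ α β, TwoScaleTendsto (volume.restrict ω) id h (fun n x => Duh n x α β)
      (fun x z => U x z α β)) {a : R2 → ℝ} (ha : MemLp a 2 (volume.restrict ω)) {α β : Fin 2}
    (hsym : L2Tendsto (volume.restrict (plate₁ ω))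
      (fun n x => sym (R n x.1 - 1) α.castSucc β.castSucc / h n ^ 4) (fun x => a x.1)) :
    ∀ᵐ q : R2 × R2 ∂((volume.restrict ω).prod (volume.restrict Y)),
      (∫ t in thick, G (q.1, t) q.2 α.castSucc β.castSucc) +
        (∫ t in thick, G (q.1, t) q.2 β.castSucc α.castSucc) =
      U q.1 q.2 α β + U q.1 q.2 β α + θ₀ θ q.2 * (G₁ q.1 q.2 α β + G₁ q.1 q.2 β α) -
        2 * a q.1 := by
  have := hs.isFiniteMeasure
  have := hs.isFiniteMeasure_plate₁
  set ρ : Measure (R2 × R2) := (volume.restrict ω).prod (volume.restrict Y) with hρ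
  have hθc : Continuous (θ₀ θ) := (contDiff_θ₀ hs.contDiff).continuous
  obtain ⟨K, hK⟩ := (isYPeriodic_θ₀ hs.periodic).bounded hθc
  have iU : ∀ α β, Integrable (fun q : R2 × R2 => U q.1 q.2 α β) ρ := fun α β =>
    (hU α β).memLp_lim.integrable one_le_two
  have iG₁ : ∀ α β, Integrable (fun q : R2 × R2 => G₁ q.1 q.2 α β) ρ := fun α β =>
    (hG₁ α β).memLp_lim.integrable one_le_two
  have iθ : ∀ α β, Integrable (fun q : R2 × R2 => G₁ q.1 q.2 α β * θ₀ θ q.2) ρ := fun α β =>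
    (iG₁ α β).mul_bdd (c := K) (hθc.comp continuous_snd).aestronglyMeasurable
      (ae_of_all _ fun q => hK q.2)
  have ia : Integrable (fun q : R2 × R2 => a q.1) ρ := (ha.integrable one_le_two).comp_fst _
  have iG : ∀ α β : Fin 2, Integrable (fun q : R2 × R2 =>
      ∫ t in thick, G (q.1, t) q.2 α.castSucc β.castSucc) ρ := fun α β =>
    Integrable.integral_prod_left ((measurePreserving_cell ω).integrable_comp_of_integrable
      ((hG α.castSucc β.castSucc).memLp_lim.integrable one_le_two))
  have sep := (isSeparating_testFunctions (μ := volume) hs.isOpen).tensor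
    isSeparating_smoothPeriodic (bounded_testFunctions ω) bounded_smoothPeriodic
  have key := sep (fun q => ((U q.1 q.2 α β + U q.1 q.2 β α) +
      (G₁ q.1 q.2 α β * θ₀ θ q.2 + G₁ q.1 q.2 β α * θ₀ θ q.2) - 2 * a q.1) -
      ((∫ t in thick, G (q.1, t) q.2 α.castSucc β.castSucc) +
        ∫ t in thick, G (q.1, t) q.2 β.castSucc α.castSucc))
    (((((iU α β).add (iU β α)).add ((iθ α β).add (iθ β α))).sub (ia.const_mul 2)).sub
      ((iG α β).add (iG β α))) ?_
  · filter_upwards [key] with q hq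
    have hq' : ((U q.1 q.2 α β + U q.1 q.2 β α) +
      (G₁ q.1 q.2 α β * θ₀ θ q.2 + G₁ q.1 q.2 β α * θ₀ θ q.2) - 2 * a q.1) -
      ((∫ t in thick, G (q.1, t) q.2 α.castSucc β.castSucc) +
        ∫ t in thick, G (q.1, t) q.2 β.castSucc α.castSucc) = 0 := hq
    linarith
  rintro _ ⟨φ, hφ, g, hg, rfl⟩
  obtain ⟨b, hb⟩ := testFunctions_bounded hφ
  obtain ⟨d, hd⟩ := smoothPeriodic_bounded hg
  have hφg : Continuous fun z : R2 × R2 => φ z.1 * g z.2 :=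
    (hφ.1.continuous.comp continuous_fst).mul (hg.1.continuous.comp continuous_snd)
  have hφgb : ∀ z : R2 × R2, ‖φ z.1 * g z.2‖ ≤ b * d := fun z => by
    rw [norm_mul]
    exact mul_le_mul (hb _) (hd _) (norm_nonneg _) ((abs_nonneg _).trans (hb z.1))
  have test : ∀ {F : R2 × R2 → ℝ}, Integrable F ρ →
      Integrable (fun q : R2 × R2 => F q * (φ q.1 * g q.2)) ρ := fun hF =>
    hF.mul_bdd (c := b * d) hφg.aestronglyMeasurable (ae_of_all _ hφgb)
  have conv : ∀ {F : R2 × R2 → ℝ}, Integrable F ρ →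
      ∫ x in ω, (∫ y in Y, F (x, y) * g y) * φ x = ∫ q, F q * (φ q.1 * g q.2) ∂ρ := fun hF =>
    (integral_prod_mul_mul hF hφ.1.continuous.aestronglyMeasurable hb
      hg.1.continuous.aestronglyMeasurable hd).symm
  have cU := fun α β => conv (iU α β)
  have cθ : ∀ α β, ∫ x in ω, (∫ y in Y, G₁ x y α β * (θ₀ θ y * g y)) * φ x =
      ∫ q : R2 × R2, G₁ q.1 q.2 α β * θ₀ θ q.2 * (φ q.1 * g q.2) ∂ρ := by
    intro α β
    rw [← conv (iθ α β)]
    simp_rw [mul_assoc]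
  have cG : ∀ α β : Fin 2, ∫ x in plate₁ ω, (∫ y in Y, G x y α.castSucc β.castSucc * g y) * φ x.1 =
      ∫ q : R2 × R2, (∫ t in thick, G (q.1, t) q.2 α.castSucc β.castSucc) * (φ q.1 * g q.2) ∂ρ := by
    intro α β
    have := integral_plate₁_cell (G := fun x y => G x y α.castSucc β.castSucc) hs.isBounded
      (hG α.castSucc β.castSucc).memLp_lim hφ hg
      (ψ := fun _ => 1) continuous_const (C := 1) (by simp)
    simpa only [mul_one] using this
  have S1 := hs.in_plane_limit (hG α.castSucc β.castSucc) (hG₁ α β) (hU α β) hφ hg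
  have S2 := hs.in_plane_limit (hG β.castSucc α.castSucc) (hG₁ β α) (hU β α) hφ hg
  have S3 := (tendsto_of_strong hs.isOpen hs.isBounded hs.pos hs.lim hsym
    (hφ.1.continuous.comp continuous_fst) (fun x => hb x.1) hg).const_mul 2
  have e3 : ∫ x in plate₁ ω, (∫ y in Y, a x.1 * g y) * φ x.1 =
      ∫ q : R2 × R2, a q.1 * (φ q.1 * g q.2) ∂ρ := by
    rw [integral_plate₁_fst ω fun x => (∫ y in Y, a x * g y) * φ x]
    exact conv ia
  have heq := tendsto_nhds_unique (S1.add S2) (S3.congr fun n =>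
    hs.integral_sym_rotation n α β (w := fun x => φ x * g ((h n)⁻¹ • x))
      (mul_periodic_mem_testFunctions hφ hg (h n)).1.continuous)
  have e3' : ∫ x in plate₁ ω, (∫ y in Y, a x.1 * g y) * (φ ∘ Prod.fst) x =
      ∫ q : R2 × R2, a q.1 * (φ q.1 * g q.2) ∂ρ := e3
  rw [e3', cU, cU, cθ, cθ, cG, cG] at heq
  have split : ∀ q : R2 × R2, (((U q.1 q.2 α β + U q.1 q.2 β α) +
      (G₁ q.1 q.2 α β * θ₀ θ q.2 + G₁ q.1 q.2 β α * θ₀ θ q.2) - 2 * a q.1) -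
      ((∫ t in thick, G (q.1, t) q.2 α.castSucc β.castSucc) +
        ∫ t in thick, G (q.1, t) q.2 β.castSucc α.castSucc)) * (φ q.1 * g q.2) =
      (((U q.1 q.2 α β * (φ q.1 * g q.2) + U q.1 q.2 β α * (φ q.1 * g q.2)) +
      (G₁ q.1 q.2 α β * θ₀ θ q.2 * (φ q.1 * g q.2) +
        G₁ q.1 q.2 β α * θ₀ θ q.2 * (φ q.1 * g q.2))) - 2 * (a q.1 * (φ q.1 * g q.2))) -
      ((∫ t in thick, G (q.1, t) q.2 α.castSucc β.castSucc) * (φ q.1 * g q.2) +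
        (∫ t in thick, G (q.1, t) q.2 β.castSucc α.castSucc) * (φ q.1 * g q.2)) :=
    fun q => by ring
  simp_rw [split]
  refine (integral_combination (test (iU α β)) (test (iU β α)) (test (iθ α β)) (test (iθ β α))
    (test ia) (test (iG α β)) (test (iG β α))).trans ?_
  linarith

end IsPlateSequence

end WrinkledPlate

/-! ### The square of the limit rotation, and the conclusion -/

namespace WrinkledPlate

theorem memLp_of_fst_plate₁ {ω : Set R2} {f : R2 → ℝ}
    (hf : AEStronglyMeasurable f (volume.restrict ω))
    (hf2 : MemLp (fun x : R3 => f x.1) 2 (volume.restrict (plate₁ ω))) :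
    MemLp f 2 (volume.restrict ω) := by
  have hmp := measurePreserving_fst_plate₁ ω
  rw [← hmp.map_eq, memLp_map_measure_iff (by rw [hmp.map_eq]; exact hf)
    measurable_fst.aemeasurable]
  exact hf2

/-- With w orthogonal to e₃ the square is -w⊗w - |w|² e₃⊗e₃, and the last term misses the in-plane
block. The minus sign is what makes the membrane term +½ ∇v⊗∇v. -/
theorem skewOf_mul_self_apply (w : Fin 2 → ℝ) (α β : Fin 2) :
    (skewOf w * skewOf w) α.castSucc β.castSucc = - (w α * w β) := by
  rw [Matrix.mul_apply, Fin.sum_univ_three]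
  simp only [skewOf, Matrix.sub_apply, Matrix.vecMulVec_apply]
  fin_cases α <;> fin_cases β <;> simp

end WrinkledPlate

open WrinkledPlate in
theorem lemma10
    -- the domain and the shape function
    (ω : Set R2) (hω : IsLipschitzDomain ω)
    (θ : R2 → ℝ) (hθ : ContDiff ℝ 2 θ) (hθ_per : IsYPeriodic θ)
    -- the sequence of scales
    (h : ℕ → ℝ) (h_pos : ∀ n, 0 < h n) (h_lim : Tendsto h atTop (𝓝 0))
    -- deformations in W^{1,2} of the wrinkled plate, with weak gradients
    (y : ℕ → R3 → Fin 3 → ℝ) (Dy : ℕ → R3 → Matrix (Fin 3) (Fin 3) ℝ)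
    (hy : ∀ n i, HasW12Grad e3 (wrinkledPlate ω θ (h n)) (fun x => y n x i)
      (fun x => Dy n x i))
    -- rotation fields in W^{1,2}(ω; SO(3)), with weak gradients
    (R : ℕ → R2 → Matrix (Fin 3) (Fin 3) ℝ) (DR : ℕ → R2 → Fin 3 → Fin 3 → Fin 2 → ℝ)
    (hR : ∀ n i j, HasW12Grad e2 ω (fun x => R n x i j) (fun x => DR n x i j))
    (hR_SO : ∀ n, ∀ᵐ x ∂(volume.restrict ω),
      R n x ∈ Matrix.specialOrthogonalGroup (Fin 3) ℝ)
    -- the gradient is close to the rotations: order h^4 in L²(Ω)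
    (h_grad : ∃ C : ℝ, ∀ n i j,
      eLpNorm (fun x : R3 => pulledGrad θ (h n) (Dy n) x i j - R n x.1 i j) 2
        (volume.restrict (plate₁ ω)) ≤ ENNReal.ofReal (C * h n ^ 4))
    -- the rotations are close to the identity in every L^p, and have small gradients
    (hR_Lp : ∀ p : ENNReal, 1 ≤ p → p ≠ ⊤ → ∃ C : ℝ, ∀ n i j,
      eLpNorm (fun x => R n x i j - (1 : Matrix (Fin 3) (Fin 3) ℝ) i j) p
        (volume.restrict ω) ≤ ENNReal.ofReal (C * h n ^ 2))
    (hR_grad : ∃ C : ℝ, ∀ n i j β,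
      eLpNorm (fun x => DR n x i j β) 2 (volume.restrict ω) ≤ ENNReal.ofReal (C * h n ^ 2))
    -- out-of-plane displacement: strong convergence in W^{1,2}, limit in W^{2,2}
    (Dvh : ℕ → R2 → Fin 2 → ℝ) (v : R2 → ℝ) (Dv : R2 → Fin 2 → ℝ)
    (D2v : R2 → Matrix (Fin 2) (Fin 2) ℝ)
    (hv : W12Tendsto ω (fun n => outOfPlaneDisp θ (h n) (y n)) Dvh v Dv)
    (hv_W22 : ∀ α, HasW12Grad e2 ω (fun x => Dv x α) (fun x => D2v x α))
    -- in-plane displacement: weak convergence in W^{1,2}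
    (Duh : ℕ → R2 → Matrix (Fin 2) (Fin 2) ℝ) (u : R2 → Fin 2 → ℝ)
    (Du : R2 → Matrix (Fin 2) (Fin 2) ℝ)
    (hu : ∀ α, W12WeakTendsto ω (fun n x => inPlaneDisp θ (h n) (y n) (R n) x α)
      (fun n x => Duh n x α) (fun x => u x α) (fun x => Du x α))
    -- scaled rotations and scaled gradients converge weakly to A = e₃ ⊗ ∇v - ∇v ⊗ e₃
    (A : R2 → Matrix (Fin 3) (Fin 3) ℝ) (DA : R2 → Fin 3 → Fin 3 → Fin 2 → ℝ)
    (hA_rot : ∀ i j, W12WeakTendsto ω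
      (fun n x => (R n x i j - (1 : Matrix (Fin 3) (Fin 3) ℝ) i j) / h n ^ 2)
      (fun n x β => DR n x i j β / h n ^ 2) (fun x => A x i j) (fun x => DA x i j))
    (hA_grad : ∀ i j, L2WeakTendsto (volume.restrict (plate₁ ω))
      (fun n x => (pulledGrad θ (h n) (Dy n) x i j - (1 : Matrix (Fin 3) (Fin 3) ℝ) i j)
        / h n ^ 2) (fun x => A x.1 i j))
    (hA_eq : ∀ᵐ x ∂(volume.restrict ω), A x = skewOf (Dv x))
    (hA_sym : ∀ i j, L2Tendsto (volume.restrict (plate₁ ω))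
      (fun n x => sym (R n x.1 - 1) i j / h n ^ 4) (fun x => (A x.1 * A x.1) i j / 2))
    -- two-scale limits of the gradients of the in-plane displacement and the rotations
    (u₁ : R2 → R2 → Fin 2 → ℝ) (Dyu₁ : R2 → R2 → Matrix (Fin 2) (Fin 2) ℝ)
    (hu₁ : ∀ α, HasL2DotH1Grad ω (fun x z => u₁ x z α) (fun x z => Dyu₁ x z α))
    (v₁ : R2 → R2 → ℝ) (Dyv₁ : R2 → R2 → Fin 2 → ℝ)
    (D2yv₁ : R2 → R2 → Matrix (Fin 2) (Fin 2) ℝ)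
    (hv₁ : HasL2DotH2Hess ω v₁ Dyv₁ D2yv₁)
    (hu_two : ∀ α β, TwoScaleTendsto (volume.restrict ω) id h
      (fun n x => Duh n x α β) (fun x z => Du x α β + Dyu₁ x z α β))
    (hR_two : ∀ α β : Fin 2, TwoScaleTendsto (volume.restrict ω) id h
      (fun n x => DR n x α.castSucc 2 β / h n ^ 2)
      (fun x z => -D2v x α β - D2yv₁ x z α β)) :
    -- every subsequence has a two-scale convergent subsequence
    (∀ φ : ℕ → ℕ, StrictMono φ → ∃ ψ : ℕ → ℕ, StrictMono ψ ∧
      ∃ G : R3 → R2 → Matrix (Fin 3) (Fin 3) ℝ,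
        ∀ i j, TwoScaleTendsto (volume.restrict (plate₁ ω)) Prod.fst (h ∘ φ ∘ ψ)
          (fun n x => strain θ (h (φ (ψ n))) (Dy (φ (ψ n))) (R (φ (ψ n))) x i j)
          (fun x z => G x z i j)) ∧
    -- and every two-scale limit along a subsequence has the asserted form
    (∀ φ : ℕ → ℕ, StrictMono φ → ∀ G : R3 → R2 → Matrix (Fin 3) (Fin 3) ℝ,
      (∀ i j, TwoScaleTendsto (volume.restrict (plate₁ ω)) Prod.fst (h ∘ φ)
          (fun n x => strain θ (h (φ n)) (Dy (φ n)) (R (φ n)) x i j)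
          (fun x z => G x z i j)) →
      ∃ G₀ G₁ : R2 → R2 → Matrix (Fin 2) (Fin 2) ℝ,
        (∀ α β, MemL2Cell ω (fun x z => G₀ x z α β)) ∧
        (∀ α β, MemL2Cell ω (fun x z => G₁ x z α β)) ∧
        (∀ᵐ q : R3 × R2 ∂((volume.restrict (plate₁ ω)).prod (volume.restrict Y)),
          (G q.1 q.2).submatrix Fin.castSucc Fin.castSucc
            = G₀ q.1.1 q.2 + q.1.2 • G₁ q.1.1 q.2) ∧
        (∀ᵐ q : R2 × R2 ∂((volume.restrict ω).prod (volume.restrict Y)),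
          sym (G₀ q.1 q.2) = sym (Du q.1) + sym (Dyu₁ q.1 q.2)
            - θ₀ θ q.2 • (D2v q.1 + D2yv₁ q.1 q.2)
            + (1 / 2 : ℝ) • Matrix.vecMulVec (Dv q.1) (Dv q.1)) ∧
        (∀ᵐ q : R2 × R2 ∂((volume.restrict ω).prod (volume.restrict Y)),
          G₁ q.1 q.2 = -D2v q.1 - D2yv₁ q.1 q.2)) := by
  -- Square integrability of the pulled-back gradient is recovered from that of (F - I)/h², which is
  -- part of its weak convergence.
  have hm : ∀ n i j, MemLp (fun x => pulledGrad θ (h n) (Dy n) x i j) 2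
      (volume.restrict (plate₁ ω)) := fun n i j => by
    have := isFiniteMeasure_restrict_of_isBounded (μ := (volume : Measure R3))
      (isBounded_plate₁ hω.isBounded)
    exact memLp_of_sub_div (pow_pos (h_pos n) 2).ne' ((hA_grad i j).memLp n)
  have hs : IsPlateSequence ω θ h y Dy R DR Duh :=
    { isOpen := hω.isOpen
      isBounded := hω.isBounded
      contDiff := hθ
      periodic := hθ_per
      pos := h_pos
      lim := h_lim
      deformation := hy
      rotation := hR
      rotation_mem := hR_SO
      grad_memLp := hm
      grad_bound := h_grad
      rotation_bound := hR_Lp 2 one_le_two (by simp)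
      rotation_grad_bound := hR_grad
      displacement := fun n α => (hu α).grad n }
  refine ⟨fun φ hφ => (hs.subseq hφ).exists_twoScale, fun φ hφ G hG => ?_⟩
  have hs' := hs.subseq hφ
  have hR' := fun α β => (hR_two α β).subseq hφ
  have hu' := fun α β => (hu_two α β).subseq hφ
  have aff := fun α β : Fin 2 => affine_of_transverse hω.isOpen hω.isBounded
    (G := fun x z => G x z α.castSucc β.castSucc)
    (G₁ := fun x z => -D2v x α β - D2yv₁ x z α β) (hG α.castSucc β.castSucc).memLp_lim
    (hR' α β).memLp_lim fun _ hϕ _ hη _ hg =>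
      hs'.transverse_limit (hG α.castSucc β.castSucc) (hR' α β) hϕ hη hg
  -- G₀ is the thickness average of the in-plane block. G₁ is taken equal to its formula, so the
  -- last claim holds by definition and the content lies in the affine representation.
  refine ⟨fun x z => Matrix.of fun α β => ∫ t in thick, G (x, t) z α.castSucc β.castSucc,
    fun x z => -D2v x - D2yv₁ x z, fun α β => (aff α β).1, fun α β => (hR_two α β).memLp_lim,
    ?_, ?_, ae_of_all _ fun _ => rfl⟩
  · filter_upwards [ae_all_iff.2 fun α => ae_all_iff.2 fun β => (aff α β).2] with q hq
    ext α β
    exact hq α β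
  -- A product of two L² functions need not be in L². Here the square integrability of A² comes from
  -- its being a strong L² limit on the plate, and is transferred to ω.
  · have hAm : ∀ α β : Fin 2, MemLp (fun x => (A x * A x) α.castSucc β.castSucc / 2) 2
        (volume.restrict ω) := fun α β => by
      refine memLp_of_fst_plate₁ ?_ (hA_sym α.castSucc β.castSucc).memLp_lim
      simp_rw [Matrix.mul_apply, Fin.sum_univ_three, div_eq_mul_inv]
      have hA := fun i j => (hA_rot i j).tendsto.memLp_lim.1
      exact ((((hA _ _).mul (hA _ _)).add ((hA _ _).mul (hA _ _))).add
        ((hA _ _).mul (hA _ _))).mul_const _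
    have hS : ∀ α β : Fin 2, L2Tendsto (volume.restrict (plate₁ ω))
        (fun n x => sym (R (φ n) x.1 - 1) α.castSucc β.castSucc / h (φ n) ^ 4)
        (fun x => (A x.1 * A x.1) α.castSucc β.castSucc / 2) := fun α β =>
      ⟨fun n => (hA_sym _ _).memLp _, (hA_sym _ _).memLp_lim,
        (hA_sym _ _).tendsto.comp hφ.tendsto_atTop⟩
    have avg := fun α β => hs'.sym_average hG (G₁ := fun x z => -D2v x - D2yv₁ x z)
      (U := fun x z => Du x + Dyu₁ x z) hR' hu' (hAm α β) (hS α β)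
    have hfst : ∀ {p : R2 → Prop}, (∀ᵐ x ∂(volume.restrict ω), p x) →
        ∀ᵐ q : R2 × R2 ∂((volume.restrict ω).prod (volume.restrict Y)), p q.1 := fun hp =>
      Measure.quasiMeasurePreserving_fst.ae hp
    filter_upwards [ae_all_iff.2 fun α => ae_all_iff.2 fun β => avg α β, hfst hA_eq,
      hfst (hessian_symm hω.isOpen hω.isBounded hv.grad_lim hv_W22 0 1),
      cell_hessian_symm hω.isOpen hω.isBounded hv₁ 0 1] with q hq hA h1 h2
    have h3 : ∀ α β, D2v q.1 α β + D2yv₁ q.1 q.2 α β = D2v q.1 β α + D2yv₁ q.1 q.2 β α := by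
      intro α β
      fin_cases α <;> fin_cases β <;> simp [h1, h2]
    ext α β
    have h4 := hq α β
    have h5 := h3 α β
    rw [hA, skewOf_mul_self_apply] at h4
    simp only [sym, Matrix.smul_apply, Matrix.add_apply, Matrix.sub_apply, Matrix.neg_apply,
      Matrix.transpose_apply, smul_eq_mul, Matrix.of_apply, Matrix.vecMulVec_apply] at h4 ⊢
    -- Half the averaged relation gives the symmetric part; the multiple of `h5` replaces the
    -- symmetrised Hessian next to θ₀ by the Hessian itself.
    linear_combination (1 / 2 : ℝ) * h4 + (1 / 2 : ℝ) * θ₀ θ q.2 * h5
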